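/- Let $k$ be an algebraically closed field of characteristic $p>0$. A line arrangement in $\mathbb{P}^2_k$ is a finite union of distinct lines $V(l_1),\dots,V(l_d)$, viewed as the reduced curve $V(f)$ with $f=l_1\cdots l_d$, where $l_1,\dots,l_d\in k[x_0,x_1,x_2]$ are nonzero linear forms, no two of them proportional; the equation $f$ is determined up to a nonzero constant. The arrangement is called homaloidal if $f$ is homaloidal, that is, if the partial derivatives $\frac{\partial f}{\partial x_0},\frac{\partial f}{\partial x_1},\frac{\partial f}{\partial x_2}$ are not all zero and have no nonconstant common factor, and the polar map $$\Phi_f=\Big(\frac{\partial f}{\partial x_0}:\frac{\partial f}{\partial x_1}:\frac{\partial f}{\partial x_2}\Big):\mathbb{P}^2_k\dashrightarrow\mathbb{P}^2_k$$ is birational. For an integer $n\geq 1$, a near-pencil of $n+1$ lines is the union of $n$ distinct lines through a point $z_0$ and of one further line not passing through $z_0$. Proposition. A line arrangement in $\mathbb{P}^2_k$ is homaloidal if and only if it is one of the following: (i) the union of three lines in general position (three distinct lines without a common point); (ii) a near-pencil of $n+1$ lines, where $n\geq 1$ and $p$ divides $n$. -/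

import Mathlib

open MvPolynomial
open scoped LinearAlgebra.Projectivization

/-- The tuple `φ = (φ₀ : … : φₘ)` represents a rational map from projective `m`-space to itself:
all `φᵢ` are homogeneous of one common degree and they are not all zero. -/
def RepresentsRationalMap {k : Type*} [Field k] {m : ℕ}
    (φ : Fin (m + 1) → MvPolynomial (Fin (m + 1)) k) : Prop :=
  (∃ d : ℕ, ∀ i, (φ i).IsHomogeneous d) ∧ ∃ i, φ i ≠ 0

/-- The composite `ψ ∘ φ` is defined and is the identity as a rational map: the polynomials
`ψᵢ(φ₀, …, φₘ)` are `h · xᵢ` for one and the same nonzero polynomial `h`. -/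
def CompEqId {k : Type*} [Field k] {m : ℕ}
    (ψ φ : Fin (m + 1) → MvPolynomial (Fin (m + 1)) k) : Prop :=
  ∃ h : MvPolynomial (Fin (m + 1)) k, h ≠ 0 ∧ ∀ i, bind₁ φ (ψ i) = h * X i

/-- The rational map represented by `φ` is birational, i.e. it has a two-sided inverse among the
rational maps from projective `m`-space to itself. -/
def IsBirationalTuple {k : Type*} [Field k] {m : ℕ}
    (φ : Fin (m + 1) → MvPolynomial (Fin (m + 1)) k) : Prop :=
  RepresentsRationalMap φ ∧
    ∃ ψ : Fin (m + 1) → MvPolynomial (Fin (m + 1)) k,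
      RepresentsRationalMap ψ ∧ CompEqId ψ φ ∧ CompEqId φ ψ

/-- The tuple of partial derivatives of `f`, which represents the polar map of `f`. -/
noncomputable def polarTuple {k : Type*} [Field k] {m : ℕ}
    (f : MvPolynomial (Fin (m + 1)) k) : Fin (m + 1) → MvPolynomial (Fin (m + 1)) k :=
  fun i => pderiv i f

/-- The linear system spanned by the `φᵢ` has no fixed component: the `φᵢ` have no common
nonconstant factor (and are not all zero). -/
def NoFixedComponent {k : Type*} [Field k] {m : ℕ}
    (φ : Fin (m + 1) → MvPolynomial (Fin (m + 1)) k) : Prop :=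
  ∀ g : MvPolynomial (Fin (m + 1)) k, (∀ i, g ∣ φ i) → IsUnit g

/-- A homogeneous polynomial is homaloidal if the linear system of its partial derivatives has no
fixed component and its polar map is birational. -/
def IsHomaloidal {k : Type*} [Field k] {m : ℕ} (f : MvPolynomial (Fin (m + 1)) k) : Prop :=
  (∃ d : ℕ, f.IsHomogeneous d) ∧ NoFixedComponent (polarTuple f) ∧
    IsBirationalTuple (polarTuple f)

/-- The linear form `a₀ x₀ + a₁ x₁ + a₂ x₂`. -/
noncomputable def linearForm {k : Type*} [Field k] (a : Fin 3 → k) : MvPolynomial (Fin 3) k :=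
  ∑ i, C (a i) * X i

/-- A line of the projective plane is given by its coefficient vector `(a₀ : a₁ : a₂)`, and a line
arrangement by the finite set `A` of its (distinct) lines. `f` is an equation of the arrangement
(as a reduced curve) if it is, up to a nonzero constant, the product of the corresponding linear
forms. -/
def IsEquationOf {k : Type*} [Field k] (f : MvPolynomial (Fin 3) k)
    (A : Finset (ℙ k (Fin 3 → k))) : Prop :=
  ∃ c : k, c ≠ 0 ∧ f = C c * ∏ L ∈ A, linearForm L.rep

/-- The point `z = (z₀ : z₁ : z₂)` lies on the line `L = (a₀ : a₁ : a₂)`, i.e. `∑ zᵢ aᵢ = 0`. -/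
def LiesOn {k : Type*} [Field k] (z L : ℙ k (Fin 3 → k)) : Prop :=
  Projectivization.orthogonal z L

/-- Three lines in general position: three distinct lines without a common point. -/
def IsThreeGeneralLines {k : Type*} [Field k] (A : Finset (ℙ k (Fin 3 → k))) : Prop :=
  A.card = 3 ∧ ¬ ∃ z : ℙ k (Fin 3 → k), ∀ L ∈ A, LiesOn z L

/-- A near-pencil of `n + 1` lines: `n` distinct lines through a point `z` together with another
line that does not pass through `z`. -/
def IsNearPencil {k : Type*} [Field k] (n : ℕ) (A : Finset (ℙ k (Fin 3 → k))) : Prop :=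
  A.card = n + 1 ∧
    ∃ z : ℙ k (Fin 3 → k), ∃ L ∈ A, ¬ LiesOn z L ∧ ∀ M ∈ A, M ≠ L → LiesOn z M

/-!
Let `f` be a product of `d` pairwise non-proportional linear forms over an algebraically closed
field of characteristic `p`, let `φ` be its polar map, and suppose that `ψ` is inverse to `φ`.

*Local analysis.* Let `z` be a point of multiplicity `m ≥ 2` of the arrangement, say
`z = (1 : 0 : 0)`, and let `G` be the product of the `m` forms through it. Along the generic formal
branch `(1 : t s : t)` at `z`, the polar map tends to the point of the dual line `x₀ = 0` with
coordinate `u = (∂₁G / ∂₂G)(s, 1)`. Since `u` is transcendental, `ψ` contracts the dual line of `z`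
to `z`, so its equation divides `∑ xᵢ ψᵢ` (`linearForm_dvd_of_multiple_point`). Since `ψ` recovers
the direction `s` of the branch, `s` is a rational function of `u`; by degree reasons `u` is then a
fractional linear function of `s`, that is, a derivation with linear coefficients kills `G`. When
`G` has three factors, this derivation has to be a multiple of the Euler derivation
(`card_eq_zero_of_slopeRatio`). Thus `p` divides `m` as soon as `m ≥ 3`
(`multiplicityAt_eq_zero`). The same argument along the branches `(t : s : 1)` through the generic
point of a line `x₀ = 0` of the arrangement shows that `p` divides `d - 1` if the line contains
three multiple points whose multiplicities are not congruent to `1` modulo `p`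
(`card_erase_eq_zero_of_three_points`).

*The case `p ∣ d`.* No line contains three multiple points, and the arrangement, which is not
concurrent, is a triangle.

*The case `p ∤ d`.* The inverse may be chosen of degree at most `deg φ = d - 1`
(`exists_inverse_degree_le`), and `B = ∑ xᵢ ψᵢ` is not zero, as `h B = d f(ψ)` by Euler's identity.
The dual lines of all multiple points divide `B`, so there are at most `d` multiple points
(`card_multiple_points_le`). By the theorem of de Bruijn and Erdős any two multiple points are
therefore joined by a line of the arrangement. If there is a double point, such an arrangement is a
near-pencil (`exists_center_of_double_point`), and `p` divides the multiplicity of its centre unless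
this is two. Otherwise `p` divides the multiplicities of all multiple points. In affine coordinates
of the pencils with centres in three multiple points of one line, the lines of the arrangement then
form finite subsets `S₁, S₂, S₃` of `k` with `S₂ + α = S₃` for all `α ∈ S₁`. Hence `S₂` is invariant
under a nonzero translation, so `p` divides `|S₂|`, which is a multiplicity minus one: a
contradiction (`false_of_multiplicities`).

Conversely, the polar map of `x₀ x₁ x₂` is the standard quadratic involution. If `p ∣ n = deg g`,
Euler's identity gives `∂₁g = x₂ h`, `∂₂g = -x₁ h` for the binary form `g(x₁, x₂)`, and the polar
map `(g : x₀ x₂ h : -x₀ x₁ h)` of the near-pencil `x₀ g` has an explicit inverse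
(`isBirationalTuple_nearPencil`).
-/

/-! ### Homogeneous polynomials -/

/-- A homogeneous polynomial of degree `e` scales by `c ^ e` when its arguments scale by `c`. -/
theorem aeval_const_mul_of_isHomogeneous {σ k A : Type*} [CommSemiring k]
    [CommSemiring A] [Algebra k A] {Q : MvPolynomial σ k} {e : ℕ} (hQ : Q.IsHomogeneous e)
    (c : A) (y : σ → A) : aeval (fun i => c * y i) Q = c ^ e * aeval y Q := by
  rw [aeval_def, aeval_def, eval₂_eq, eval₂_eq, Finset.mul_sum]
  refine Finset.sum_congr rfl fun d hd => ?_
  have h : ∑ i ∈ d.support, d i = e := by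
    have := hQ (mem_support_iff.mp hd)
    rwa [show (Finsupp.weight 1) d = d.degree from
      (DFunLike.congr_fun (Finsupp.degree_eq_weight_one (R := ℕ)) d).symm,
      Finsupp.degree_apply] at this
  simp only [mul_pow, Finset.prod_mul_distrib, Finset.prod_pow_eq_pow_sum, h]
  ring

theorem exists_eval_ne_zero {σ k : Type*} [Field k] [Infinite k]
    {Q : MvPolynomial σ k} (hQ : Q ≠ 0) : ∃ v, eval v Q ≠ 0 := by
  by_contra! h
  exact hQ (MvPolynomial.funext fun v => by simp [h v])

/-- A polynomial is homogeneous once its scaling by a new variable is a monomial in that variable. -/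
theorem isHomogeneous_of_aeval_eq {σ k : Type*} [Field k] {Q R : MvPolynomial σ k} {e : ℕ}
    (h : aeval (fun i => (Polynomial.X * Polynomial.C (X i) : Polynomial (MvPolynomial σ k))) Q
      = Polynomial.C R * Polynomial.X ^ e) : Q.IsHomogeneous e := by
  have key : ∀ P : MvPolynomial σ k, ∀ n,
      (aeval (fun i => (Polynomial.X * Polynomial.C (X i) :
        Polynomial (MvPolynomial σ k))) P).coeff n = homogeneousComponent n P := by
    intro P n
    conv_lhs => rw [← sum_homogeneousComponent P, map_sum]
    rw [Polynomial.finsetSum_coeff]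
    have (i : ℕ) : (aeval (fun i => (Polynomial.X * Polynomial.C (X i) :
        Polynomial (MvPolynomial σ k))) (homogeneousComponent i P)).coeff n =
        if n = i then homogeneousComponent i P else 0 := by
      rw [aeval_const_mul_of_isHomogeneous (homogeneousComponent_isHomogeneous i P)]
      have : aeval (fun i => (Polynomial.C (X i) : Polynomial (MvPolynomial σ k)))
          (homogeneousComponent i P) = Polynomial.C (homogeneousComponent i P) := by
        have := MvPolynomial.aeval_algebraMap_apply (R := k) (Polynomial (MvPolynomial σ k))
          (X : σ → MvPolynomial σ k) (homogeneousComponent i P)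
        simpa [Function.comp_def] using this
      rw [this, mul_comm, Polynomial.coeff_C_mul, Polynomial.coeff_X_pow]
      split_ifs <;> simp
    simp only [this]
    rw [Finset.sum_ite_eq]
    split_ifs with hn
    · rfl
    · rw [homogeneousComponent_eq_zero]
      simpa using hn
  intro d hd
  by_contra hne
  have h1 := key Q (Finsupp.weight 1 d)
  rw [h, Polynomial.coeff_C_mul, Polynomial.coeff_X_pow, if_neg hne, mul_zero] at h1
  have h2 := congrArg (coeff d) h1
  rw [coeff_homogeneousComponent, if_pos (show Finsupp.degree d = Finsupp.weight 1 d from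
    DFunLike.congr_fun (Finsupp.degree_eq_weight_one (R := ℕ)) d)] at h2
  exact hd (by simpa using h2.symm)

theorem aeval_X_mul_C_of_isHomogeneous {σ k : Type*} [Field k] {Q : MvPolynomial σ k}
    {e : ℕ} (hQ : Q.IsHomogeneous e) :
    aeval (fun i => (Polynomial.X * Polynomial.C (X i) : Polynomial (MvPolynomial σ k))) Q
      = Polynomial.C Q * Polynomial.X ^ e := by
  rw [aeval_const_mul_of_isHomogeneous hQ]
  have := MvPolynomial.aeval_algebraMap_apply (R := k) (Polynomial (MvPolynomial σ k))
          (X : σ → MvPolynomial σ k) Q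
  rw [show (aeval fun i => (Polynomial.C (X i) : Polynomial (MvPolynomial σ k))) Q =
    Polynomial.C Q by simpa [Function.comp_def] using this]
  ring

/-- Factors of homogeneous polynomials are homogeneous. -/
theorem exists_isHomogeneous_of_mul {σ k : Type*} [Field k] {P Q : MvPolynomial σ k}
    {e : ℕ} (h : (P * Q).IsHomogeneous e) (h0 : P * Q ≠ 0) : ∃ a, Q.IsHomogeneous a := by
  set θ : MvPolynomial σ k →ₐ[k] Polynomial (MvPolynomial σ k) :=
    aeval (fun i => (Polynomial.X * Polynomial.C (X i) : Polynomial (MvPolynomial σ k))) with hθ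
  have h1 : θ P * θ Q = Polynomial.C (P * Q) * Polynomial.X ^ e := by
    rw [← map_mul]; exact aeval_X_mul_C_of_isHomogeneous h
  have hne : θ P * θ Q ≠ 0 := by
    rw [h1]; simpa using h0
  have hP : θ P ≠ 0 := left_ne_zero_of_mul hne
  have hQ : θ Q ≠ 0 := right_ne_zero_of_mul hne
  have hdeg : (θ P).natDegree + (θ Q).natDegree = e := by
    rw [← Polynomial.natDegree_mul hP hQ, h1, Polynomial.natDegree_C_mul_X_pow _ _ h0]
  have htr : (θ P).natTrailingDegree + (θ Q).natTrailingDegree = e := by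
    rw [← Polynomial.natTrailingDegree_mul hP hQ, h1, Polynomial.C_mul_X_pow_eq_monomial,
      Polynomial.natTrailingDegree_monomial h0]
  have := Polynomial.natTrailingDegree_le_natDegree (θ P)
  have := Polynomial.natTrailingDegree_le_natDegree (θ Q)
  have heq : (θ Q).natTrailingDegree = (θ Q).natDegree := by omega
  refine ⟨(θ Q).natDegree, isHomogeneous_of_aeval_eq (R := (θ Q).coeff (θ Q).natDegree) ?_⟩
  change θ Q = _
  ext1 n
  rw [Polynomial.coeff_C_mul, Polynomial.coeff_X_pow]
  split_ifs with hn
  · rw [hn, mul_one]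
  · rw [mul_zero]
    rcases lt_or_gt_of_ne hn with h' | h'
    · exact Polynomial.coeff_eq_zero_of_lt_natTrailingDegree (by omega)
    · exact Polynomial.coeff_eq_zero_of_natDegree_lt h'

/-- If `D w = h (x₀, x₁, x₂)`, then `w` itself is a multiple of `(x₀, x₁, x₂)`. -/
theorem exists_eq_mul_X_of_mul {k : Type*} [Field k] {D h : MvPolynomial (Fin 3) k}
    {w : Fin 3 → MvPolynomial (Fin 3) k} (hD : D ≠ 0) (hh : h ≠ 0)
    (H : ∀ i, D * w i = h * X i) :
    ∃ h', h' ≠ 0 ∧ ∀ i, w i = h' * X i := by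
  have hcross : w 0 * X 1 = w 1 * X 0 := by
    apply mul_left_cancel₀ hD
    rw [← mul_assoc, ← mul_assoc, H, H]; ring
  have h0 : (X 0 : MvPolynomial (Fin 3) k) ∣ w 0 := by
    have : (X 0 : MvPolynomial (Fin 3) k) ∣ w 0 * X 1 := ⟨w 1, by rw [hcross]; ring⟩
    rcases (MvPolynomial.X_prime (R := k) (i := (0 : Fin 3))).dvd_or_dvd this with h | h
    · exact h
    · exact absurd (X_dvd_X.mp h) (by decide)
  obtain ⟨h', hh'⟩ := h0
  have hDh : D * h' = h := by
    apply mul_right_cancel₀ (X_ne_zero (R := k) (0 : Fin 3))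
    rw [← H 0, hh']; ring
  refine ⟨h', fun h0 => hh ?_, fun i => mul_left_cancel₀ hD ?_⟩
  · rw [← hDh, h0, mul_zero]
  · rw [H i, ← hDh, mul_assoc]

/-! ### Linear changes of coordinates -/

section LinearChange

variable {k : Type*} [Field k]

/-- The substitution `xᵢ ↦ ∑ⱼ Tᵢⱼ xⱼ`, i.e. composition of polynomials with the linear map `T`. -/
noncomputable def linSubst (T : Matrix (Fin 3) (Fin 3) k) :
    MvPolynomial (Fin 3) k →ₐ[k] MvPolynomial (Fin 3) k :=
  bind₁ fun i => linearForm (T i)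

theorem linSubst_X (T : Matrix (Fin 3) (Fin 3) k) (i : Fin 3) :
    linSubst T (X i) = ∑ j, C (T i j) * X j := by
  simp [linSubst, linearForm]

theorem map_linearForm {A : Type*} [CommRing A] [Algebra k A]
    (F : MvPolynomial (Fin 3) k →ₐ[k] A) (a : Fin 3 → k) :
    F (linearForm a) = ∑ i, algebraMap k A (a i) * F (X i) := by
  simp only [linearForm, map_sum, map_mul, ← algebraMap_eq, AlgHom.commutes]

theorem linSubst_linearForm (T : Matrix (Fin 3) (Fin 3) k) (a : Fin 3 → k) :
    linSubst T (linearForm a) = linearForm (Matrix.vecMul a T) := by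
  rw [map_linearForm]
  simp only [linSubst_X, linearForm, Matrix.vecMul, dotProduct, Finset.mul_sum, map_sum,
    Finset.sum_mul, map_mul, algebraMap_eq]
  rw [Finset.sum_comm]
  simp only [mul_assoc]

theorem linSubst_linSubst (S T : Matrix (Fin 3) (Fin 3) k) (q : MvPolynomial (Fin 3) k) :
    linSubst S (linSubst T q) = linSubst (T * S) q := by
  suffices h : (linSubst S).comp (linSubst T) = linSubst (T * S) from AlgHom.congr_fun h q
  apply MvPolynomial.algHom_ext
  intro i
  have h1 : linSubst T (X i) = linearForm (T i) := by simp [linSubst]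
  have h2 : linSubst (T * S) (X i) = linearForm ((T * S) i) := by simp [linSubst]
  rw [AlgHom.comp_apply, h1, h2, linSubst_linearForm]
  rfl

theorem linSubst_one (q : MvPolynomial (Fin 3) k) : linSubst 1 q = q := by
  have : linSubst (1 : Matrix (Fin 3) (Fin 3) k) = AlgHom.id k _ := by
    apply MvPolynomial.algHom_ext
    intro i
    simp [linSubst_X, Matrix.one_apply]
  simp [this]

theorem linSubst_cancel {T T' : Matrix (Fin 3) (Fin 3) k} (h : T * T' = 1)
    (q : MvPolynomial (Fin 3) k) : linSubst T' (linSubst T q) = q := by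
  rw [linSubst_linSubst, h, linSubst_one]

theorem linearForm_isHomogeneous (a : Fin 3 → k) : (linearForm a).IsHomogeneous 1 :=
  IsHomogeneous.sum _ _ _ fun _ _ => isHomogeneous_C_mul_X _ _

theorem linSubst_isHomogeneous {T : Matrix (Fin 3) (Fin 3) k} {q : MvPolynomial (Fin 3) k} {e : ℕ}
    (h : q.IsHomogeneous e) : (linSubst T q).IsHomogeneous e := by
  have := h.aeval (fun i => linearForm (T i)) (n := 1) fun _ => linearForm_isHomogeneous _
  rwa [one_mul] at this

/-- The tuple `S ∘ φ ∘ T` for linear maps `S` and `T`. -/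
noncomputable def transformTuple (S T : Matrix (Fin 3) (Fin 3) k)
    (φ : Fin 3 → MvPolynomial (Fin 3) k) : Fin 3 → MvPolynomial (Fin 3) k :=
  fun i => ∑ j, C (S i j) * linSubst T (φ j)

theorem transformTuple_isHomogeneous {S T : Matrix (Fin 3) (Fin 3) k}
    {φ : Fin 3 → MvPolynomial (Fin 3) k} {e : ℕ} (h : ∀ i, (φ i).IsHomogeneous e) (i : Fin 3) :
    (transformTuple S T φ i).IsHomogeneous e :=
  IsHomogeneous.sum _ _ _ fun j _ => (linSubst_isHomogeneous (h j)).C_mul _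

theorem sum_C_mul_transformTuple {S S' T : Matrix (Fin 3) (Fin 3) k} (hS : S' * S = 1)
    (φ : Fin 3 → MvPolynomial (Fin 3) k) (j : Fin 3) :
    ∑ l, C (S' j l) * transformTuple S T φ l = linSubst T (φ j) := by
  simp only [transformTuple, Finset.mul_sum]
  rw [Finset.sum_comm]
  have : ∀ m, ∑ l, C (S' j l) * (C (S l m) * linSubst T (φ m)) =
      C ((S' * S) j m) * linSubst T (φ m) := by
    intro m
    rw [Matrix.mul_apply, map_sum, Finset.sum_mul]
    simp only [map_mul, mul_assoc]
  simp only [this, hS, Matrix.one_apply]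
  simp

theorem transformTuple_cancel {S S' T T' : Matrix (Fin 3) (Fin 3) k} (hS : S' * S = 1)
    (hT : T * T' = 1) (φ : Fin 3 → MvPolynomial (Fin 3) k) :
    transformTuple S' T' (transformTuple S T φ) = φ := by
  funext i
  have := congrArg (linSubst T') (sum_C_mul_transformTuple (T := T) hS φ i)
  rw [linSubst_cancel hT, map_sum] at this
  rw [← this, transformTuple]
  simp [linSubst]

theorem bind₁_transformTuple {S S' T : Matrix (Fin 3) (Fin 3) k} (hS : S' * S = 1)
    (φ : Fin 3 → MvPolynomial (Fin 3) k) (q : MvPolynomial (Fin 3) k) :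
    bind₁ (transformTuple S T φ) (linSubst S' q) = linSubst T (bind₁ φ q) := by
  suffices h : (bind₁ (transformTuple S T φ)).comp (linSubst S') =
    (linSubst T).comp (bind₁ φ) from AlgHom.congr_fun h q
  apply MvPolynomial.algHom_ext
  intro j
  rw [AlgHom.comp_apply, AlgHom.comp_apply, bind₁_X_right, ← sum_C_mul_transformTuple hS φ j]
  simp [linSubst, linearForm]

/-- If `ψ ∘ φ` is the identity, then so is `(T⁻¹ ∘ ψ ∘ S⁻¹) ∘ (S ∘ φ ∘ T)`. -/
theorem CompEqId.transform {S S' T T' : Matrix (Fin 3) (Fin 3) k} (hS : S' * S = 1)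
    (hT : T' * T = 1) {φ ψ : Fin 3 → MvPolynomial (Fin 3) k} (h : CompEqId (m := 2) ψ φ) :
    CompEqId (m := 2) (transformTuple T' S' ψ) (transformTuple S T φ) := by
  obtain ⟨h, h0, H⟩ := h
  have hT' : T * T' = 1 := mul_eq_one_comm.mp hT
  refine ⟨linSubst T h, fun hz => h0 ?_, fun i => ?_⟩
  · rw [← linSubst_cancel hT' h, hz, map_zero]
  · conv_lhs => rw [transformTuple]
    simp only [map_sum, map_mul, bind₁_C_right]
    have : ∀ j, bind₁ (transformTuple S T φ) (linSubst S' (ψ j)) =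
        linSubst T h * linSubst T (X j) := by
      intro j
      rw [bind₁_transformTuple hS, ← map_mul]
      exact congrArg _ (H j)
    simp only [this]
    have h2 : ∑ j, C (T' i j) * linSubst T (X j) = X i := by
      have h3 := linSubst_cancel hT (X i)
      rw [linSubst_X T', map_sum] at h3
      rw [← h3]
      simp [linSubst]
    calc ∑ j, C (T' i j) * (linSubst T h * linSubst T (X j))
        = linSubst T h * ∑ j, C (T' i j) * linSubst T (X j) := by
          rw [Finset.mul_sum]; exact Finset.sum_congr rfl fun _ _ => by ring
      _ = _ := by rw [h2]

/-- Chain rule: the polar map of `f ∘ T` is `Tᵗ ∘ ∇f ∘ T`. -/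
theorem polarTuple_linSubst (T : Matrix (Fin 3) (Fin 3) k) (f : MvPolynomial (Fin 3) k) :
    polarTuple (m := 2) (linSubst T f) = transformTuple T.transpose T (polarTuple (m := 2) f) := by
  funext i
  simp only [polarTuple, transformTuple, Matrix.transpose_apply]
  change pderiv i (linSubst T f) = ∑ j, C (T j i) * linSubst T (pderiv j f)
  induction f using MvPolynomial.induction_on with
  | C a => simp [linSubst]
  | add p q hp hq => simp only [map_add, hp, hq, mul_add, Finset.sum_add_distrib]
  | mul_X p n hp =>
    have h1 : pderiv i (linSubst T (X n)) = C (T n i) := by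
      rw [linSubst_X, map_sum]
      simp [pderiv_X, Pi.single_apply]
    rw [map_mul, pderiv_mul, hp, h1]
    simp only [pderiv_mul, map_add, map_mul, mul_add, Finset.sum_add_distrib, pderiv_X]
    congr 1
    · rw [Finset.sum_mul]
      exact Finset.sum_congr rfl fun _ _ => by ring
    · rw [Finset.sum_eq_single n]
      · simp; ring
      · intro b _ hb
        simp [hb.symm]
      · simp

end LinearChange

/-! ### Products of linear forms through a point, and their logarithmic derivatives -/

section BinaryForms

variable {k : Type*} [Field k] {ι : Type*}

/-- The linear form `b x₁ + c x₂`. -/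
noncomputable def binForm (b c : k) : MvPolynomial (Fin 3) k := C b * X 1 + C c * X 2

theorem eval_binForm (b c : k) (v : Fin 3 → k) : eval v (binForm b c) = b * v 1 + c * v 2 := by
  simp [binForm]

theorem binForm_isHomogeneous (b c : k) : (binForm b c).IsHomogeneous 1 :=
  (isHomogeneous_C_mul_X _ _).add (isHomogeneous_C_mul_X _ _)

theorem prod_binForm_isHomogeneous (s : Finset ι) (b c : ι → k) :
    (∏ i ∈ s, binForm (b i) (c i)).IsHomogeneous s.card := by
  have := IsHomogeneous.prod s (fun i => binForm (b i) (c i)) (fun _ => 1)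
    fun i _ => binForm_isHomogeneous _ _
  simpa using this

/-- If a derivation kills a product of linear forms, then its value on a factor `l` vanishes where
`l` does, provided that the multiplicity of `l` in the product is nonzero in `k`. -/
theorem eval_derivation_binForm_eq_zero [DecidableEq ι] (s : Finset ι) (b c : ι → k)
    (hbc : ∀ i ∈ s, b i ≠ 0 ∨ c i ≠ 0)
    (D : Derivation k (MvPolynomial (Fin 3) k) (MvPolynomial (Fin 3) k))
    (hD : D (∏ i ∈ s, binForm (b i) (c i)) = 0) (i : ι) (hi : i ∈ s) [DecidableEq k]
    (hn : ((s.filter fun j => b i * c j = b j * c i).card : k) ≠ 0) :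
    eval ![0, c i, -b i] (D (binForm (b i) (c i))) = 0 := by
  set t := s.filter fun j => b i * c j = b j * c i with ht
  set u := s.filter fun j => ¬ b i * c j = b j * c i with hu
  -- every form of the class of `i` is a multiple of the `i`-th one
  have hprop : ∀ j ∈ t, ∃ r : k, r ≠ 0 ∧ binForm (b j) (c j) = C r * binForm (b i) (c i) := by
    intro j hj
    rw [ht, Finset.mem_filter] at hj
    have key : ∀ r : k, b j = r * b i → c j = r * c i →
        binForm (b j) (c j) = C r * binForm (b i) (c i) := by
      intro r h1 h2
      rw [h1, h2, binForm, binForm]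
      simp only [map_mul]; ring
    rcases hbc i hi with h | h
    · have h1 : b j = (b j / b i) * b i := by field_simp
      have h2 : c j = (b j / b i) * c i := by
        field_simp; linear_combination hj.2
      refine ⟨b j / b i, ?_, key _ h1 h2⟩
      intro h0
      rw [h0, zero_mul] at h1 h2
      rcases hbc j hj.1 with h | h <;> contradiction
    · have h1 : c j = (c j / c i) * c i := by field_simp
      have h2 : b j = (c j / c i) * b i := by
        field_simp; linear_combination -hj.2
      refine ⟨c j / c i, ?_, key _ h2 h1⟩
      intro h0
      rw [h0, zero_mul] at h1 h2
      rcases hbc j hj.1 with h | h <;> contradiction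
  choose! r hr0 hr using hprop
  have h1 : ∏ j ∈ s, binForm (b j) (c j) =
      C (∏ j ∈ t, r j) * (binForm (b i) (c i) ^ t.card * ∏ j ∈ u, binForm (b j) (c j)) := by
    rw [← Finset.prod_filter_mul_prod_filter_not s (fun j => b i * c j = b j * c i),
      Finset.prod_congr rfl hr, Finset.prod_mul_distrib, Finset.prod_const, map_prod, mul_assoc]
  have hit : i ∈ t := by simp [ht, hi]
  obtain ⟨n, hn'⟩ : ∃ n, t.card = n + 1 :=
    ⟨t.card - 1, (Nat.succ_pred_eq_of_pos (Finset.card_pos.mpr ⟨i, hit⟩)).symm⟩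
  set l := binForm (b i) (c i) with hl
  set W := ∏ j ∈ u, binForm (b j) (c j) with hW
  have hl0 : l ≠ 0 := by
    intro h0
    have h2 := eval_binForm (b i) (c i) ![0, 1, 0]
    have h3 := eval_binForm (b i) (c i) ![0, 0, 1]
    rw [← hl, h0] at h2 h3
    rcases hbc i hi with h | h
    · simp at h2; exact h h2.symm
    · simp at h3; exact h h3.symm
  have h2 : ((t.card : MvPolynomial (Fin 3) k)) * D l * W + l * D W = 0 := by
    rw [h1, D.leibniz, D.leibniz, D.leibniz_pow] at hD
    have hC : D (C (∏ j ∈ t, r j)) = 0 := by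
      have := D.map_algebraMap (∏ j ∈ t, r j)
      rwa [algebraMap_eq] at this
    rw [hC, hn'] at hD
    simp only [smul_eq_mul, mul_zero, add_zero, nsmul_eq_mul, Nat.add_sub_cancel] at hD
    have hne : (C (∏ j ∈ t, r j) * l ^ n : MvPolynomial (Fin 3) k) ≠ 0 := by
      refine mul_ne_zero ?_ (pow_ne_zero _ hl0)
      rw [Ne, C_eq_zero]
      exact Finset.prod_ne_zero_iff.mpr hr0
    apply mul_left_cancel₀ hne
    rw [mul_zero, ← hD, hn']
    ring
  have h3 := congrArg (eval ![0, c i, -b i]) h2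
  have h4 : eval ![0, c i, -b i] l = 0 := by rw [hl, eval_binForm]; simp; ring
  have h5 : eval ![0, c i, -b i] W ≠ 0 := by
    rw [hW, map_prod, Finset.prod_ne_zero_iff]
    intro j hj h
    rw [eval_binForm] at h
    rw [hu, Finset.mem_filter] at hj
    apply hj.2
    simp at h
    linear_combination -h
  simp only [map_add, map_mul, h4, zero_mul, add_zero, map_zero, map_natCast] at h3
  rcases mul_eq_zero.mp h3 with h | h
  · rcases mul_eq_zero.mp h with h | h
    · exact absurd h hn
    · exact h
  · exact absurd h h5

end BinaryForms

section RestrictedForms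

variable {k : Type*} [Field k] {ι : Type*}

/-- Restriction of a polynomial to the plane `x₀ = 0`. -/
noncomputable def restrict₀ : MvPolynomial (Fin 3) k →ₐ[k] MvPolynomial (Fin 3) k :=
  bind₁ ![0, X 1, X 2]

theorem eval_restrict₀ (Q : MvPolynomial (Fin 3) k) (v : Fin 3 → k) :
    eval v (restrict₀ Q) = eval ![0, v 1, v 2] Q := by
  have h := AlgHom.congr_fun (φ₁ := (aeval v).comp (restrict₀ (k := k)))
    (φ₂ := aeval ![0, v 1, v 2]) (by
      apply MvPolynomial.algHom_ext
      intro i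
      fin_cases i <;> simp [restrict₀]) Q
  simpa [coe_aeval_eq_eval] using h

theorem restrict₀_binForm (b c : k) : restrict₀ (binForm b c) = binForm b c := by
  simp [restrict₀, binForm]

theorem pderiv_zero_prod_binForm (s : Finset ι) (b c : ι → k) :
    pderiv 0 (∏ i ∈ s, binForm (b i) (c i)) = 0 := by
  refine Finset.prod_induction _ (fun Q => pderiv 0 Q = 0) (fun P Q hP hQ => ?_) (by simp)
    fun i _ => by simp [binForm, pderiv_X]
  rw [pderiv_mul, hP, hQ]; simp

theorem restrict₀_prod_binForm (s : Finset ι) (b c : ι → k) :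
    restrict₀ (∏ i ∈ s, binForm (b i) (c i)) = ∏ i ∈ s, binForm (b i) (c i) := by
  rw [map_prod]; exact Finset.prod_congr rfl fun _ _ => restrict₀_binForm _ _

theorem restrict₀_pderiv {j : Fin 3} (hj : j ≠ 0) (Q : MvPolynomial (Fin 3) k) :
    restrict₀ (pderiv j Q) = pderiv j (restrict₀ Q) := by
  induction Q using MvPolynomial.induction_on with
  | C a => simp [restrict₀]
  | add p q hp hq => simp only [map_add, hp, hq]
  | mul_X p n hp =>
    rw [pderiv_mul, map_add, map_mul, map_mul, hp, map_mul, pderiv_mul]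
    congr 2
    fin_cases j
    · simp at hj
    all_goals fin_cases n <;> simp [restrict₀, pderiv_X]

theorem X_dvd_of_restrict₀_eq_zero {Q : MvPolynomial (Fin 3) k} (h : restrict₀ Q = 0) :
    X 0 ∣ Q := by
  have key : ∀ Q : MvPolynomial (Fin 3) k, X 0 ∣ Q - restrict₀ Q := by
    intro Q
    induction Q using MvPolynomial.induction_on with
    | C a => simp [restrict₀]
    | add p q hp hq =>
      have := dvd_add hp hq
      rw [map_add]
      convert this using 1; ring
    | mul_X p n hp =>
      have h1 : X 0 ∣ (X n - restrict₀ (X n) : MvPolynomial (Fin 3) k) := by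
        fin_cases n <;> simp [restrict₀]
      have := dvd_add (Dvd.dvd.mul_right hp (X n)) (Dvd.dvd.mul_left h1 (restrict₀ p))
      rw [map_mul]
      convert this using 1; ring
  simpa [h] using key Q

/-- Evaluation of polynomials at the generic point `(0 : s : 1)` of the line `x₀ = 0`. -/
noncomputable def evalGeneric : MvPolynomial (Fin 3) k →ₐ[k] RatFunc k :=
  aeval ![0, RatFunc.X, 1]

theorem evalGeneric_eq (Q : MvPolynomial (Fin 3) k) : evalGeneric Q =
    algebraMap (Polynomial k) (RatFunc k) (aeval ![0, Polynomial.X, 1] Q) := by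
  have := AlgHom.congr_fun (φ₁ := evalGeneric (k := k))
    (φ₂ := (IsScalarTower.toAlgHom k (Polynomial k) (RatFunc k)).comp
      (aeval ![0, Polynomial.X, 1])) (by
      apply MvPolynomial.algHom_ext
      intro i
      fin_cases i <;> simp [evalGeneric]) Q
  simpa using this

theorem eval_aeval_pencil (Q : MvPolynomial (Fin 3) k) (r : k) :
    Polynomial.eval r (aeval ![0, Polynomial.X, 1] Q) = eval ![0, r, 1] Q := by
  have := AlgHom.congr_fun (φ₁ := aeval ![0, r, 1])
    (φ₂ := (Polynomial.aeval r).comp (aeval ![0, Polynomial.X, 1])) (by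
      apply MvPolynomial.algHom_ext
      intro i
      fin_cases i <;> simp) Q
  simpa [coe_aeval_eq_eval] using this.symm

/-- A homogeneous polynomial vanishing at the generic point of the line `x₀ = 0` vanishes on that
line. -/
theorem restrict₀_eq_zero_of_evalGeneric [Infinite k] {Q : MvPolynomial (Fin 3) k} {e : ℕ}
    (hQ : Q.IsHomogeneous e) (h : evalGeneric Q = 0) : restrict₀ Q = 0 := by
  rw [evalGeneric_eq] at h
  have h2 : aeval ![0, Polynomial.X, 1] Q = (0 : Polynomial k) :=
    RatFunc.algebraMap_injective k (by rw [h, map_zero])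
  have h3 : ∀ r : k, eval ![0, r, 1] Q = 0 := by
    intro r
    rw [← eval_aeval_pencil, h2, Polynomial.eval_zero]
  have h4 : X 2 * restrict₀ Q = 0 := by
    apply MvPolynomial.funext
    intro v
    rw [map_mul, eval_X, eval_restrict₀, map_zero]
    by_cases hv : v 2 = 0
    · rw [hv, zero_mul]
    · have h5 := aeval_const_mul_of_isHomogeneous hQ (v 2) ![0, v 1 / v 2, 1]
      have h6 : (fun i => v 2 * (![0, v 1 / v 2, 1] : Fin 3 → k) i) = ![0, v 1, v 2] := by
        funext i
        fin_cases i <;> simp; field_simp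
      rw [h6] at h5
      have h7 : eval ![0, v 1, v 2] Q = v 2 ^ e * eval ![0, v 1 / v 2, 1] Q := by
        simpa [coe_aeval_eq_eval] using h5
      rw [h7, h3, mul_zero, mul_zero]
  rcases mul_eq_zero.mp h4 with h | h
  · exact absurd h (X_ne_zero 2)
  · exact h

/-- The quotient `(∂G/∂x₁) / (∂G/∂x₂)` at the generic point of the line `x₀ = 0`. -/
noncomputable def slopeRatio (G : MvPolynomial (Fin 3) k) : RatFunc k :=
  evalGeneric (pderiv 1 G) / evalGeneric (pderiv 2 G)

variable [DecidableEq k] [DecidableEq ι]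

/-- The factors `i` and `j` define distinct points, and their multiplicities in the product over
`s` are nonzero in `k`. -/
def AreTameFactors (s : Finset ι) (b c : ι → k) (i j : ι) : Prop :=
  i ∈ s ∧ j ∈ s ∧ b i * c j ≠ b j * c i ∧
    ((s.filter fun l => b i * c l = b l * c i).card : k) ≠ 0 ∧
    ((s.filter fun l => b j * c l = b l * c j).card : k) ≠ 0

variable [Infinite k] {s : Finset ι} {b c : ι → k} (hbc : ∀ i ∈ s, b i ≠ 0 ∨ c i ≠ 0)

include hbc in
/-- The partial derivatives of a product with two distinct tame factors are linearly independent: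
the constant derivation belonging to a linear relation would vanish on both factors. -/
theorem eq_zero_of_evalGeneric_eq {i j : ι} (hij : AreTameFactors s b c i j) (α β : k)
    (h : algebraMap k _ α * evalGeneric (pderiv 1 (∏ i ∈ s, binForm (b i) (c i))) =
      algebraMap k _ β * evalGeneric (pderiv 2 (∏ i ∈ s, binForm (b i) (c i)))) :
    α = 0 ∧ β = 0 := by
  set G := ∏ i ∈ s, binForm (b i) (c i) with hG
  obtain ⟨hi, hj, hne, hci, hcj⟩ := hij
  have hGhom : G.IsHomogeneous s.card := prod_binForm_isHomogeneous s b c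
  have hGres : restrict₀ G = G := restrict₀_prod_binForm s b c
  set D : Derivation k (MvPolynomial (Fin 3) k) (MvPolynomial (Fin 3) k) :=
    α • pderiv 1 - β • pderiv 2 with hDdef
  have hDapp : ∀ Q, D Q = C α * pderiv 1 Q - C β * pderiv 2 Q := by
    intro Q
    simp [hDdef, smul_eq_C_mul]
  have hD : D G = 0 := by
    have h1 : evalGeneric (D G) = 0 := by
      rw [hDapp, map_sub, map_mul, map_mul, ← algebraMap_eq, AlgHom.commutes, AlgHom.commutes,
        h, sub_self]
    have h2 : (D G).IsHomogeneous (s.card - 1) := by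
      rw [hDapp]
      exact (hGhom.pderiv.C_mul _).sub (hGhom.pderiv.C_mul _)
    have h3 := restrict₀_eq_zero_of_evalGeneric h2 h1
    rw [hDapp, map_sub, map_mul, map_mul, restrict₀_pderiv (by decide),
      restrict₀_pderiv (by decide), hGres, ← algebraMap_eq, AlgHom.commutes, AlgHom.commutes,
      algebraMap_eq, ← hDapp] at h3
    exact h3
  have hDl : ∀ i v, eval v (D (binForm (b i) (c i))) = α * b i - β * c i := by
    intro i v
    rw [hDapp]
    simp [binForm, pderiv_X]
  have e1 := eval_derivation_binForm_eq_zero s b c hbc D hD i hi hci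
  have e2 := eval_derivation_binForm_eq_zero s b c hbc D hD j hj hcj
  rw [hDl] at e1 e2
  have hdet : b i * c j - b j * c i ≠ 0 := sub_ne_zero.mpr hne
  constructor
  · apply mul_right_cancel₀ hdet
    linear_combination c j * e1 - c i * e2
  · apply mul_right_cancel₀ hdet
    linear_combination b j * e1 - b i * e2

include hbc in
theorem evalGeneric_pderiv_two_ne_zero {i j : ι} (hij : AreTameFactors s b c i j) :
    evalGeneric (pderiv 2 (∏ i ∈ s, binForm (b i) (c i))) ≠ 0 := by
  intro h
  have := eq_zero_of_evalGeneric_eq hbc hij 0 1 (by rw [h]; simp)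
  exact one_ne_zero this.2

include hbc in
theorem transcendental_slopeRatio {i j : ι} (hij : AreTameFactors s b c i j) :
    Transcendental k (slopeRatio (∏ i ∈ s, binForm (b i) (c i))) := by
  apply RatFunc.transcendental_of_ne_C
  rintro ⟨r, hr⟩
  have h2 := evalGeneric_pderiv_two_ne_zero hbc hij
  rw [slopeRatio, div_eq_iff h2] at hr
  have := eq_zero_of_evalGeneric_eq hbc hij 1 r (by rw [hr, map_one, one_mul]; rfl)
  exact one_ne_zero this.1

include hbc in
/-- If the coordinate `s` of the line `x₀ = 0` is a rational function of the slope ratio of `G`,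
where `G` has three distinct tame factors, then the degree of `G` vanishes in `k`.

The slope ratio is then a fractional linear function of `s`, which says that a derivation
`D = (γ x₁ + δ x₂) ∂₁ - (α x₁ + β x₂) ∂₂` kills `G`. Each tame factor `b x₁ + c x₂` yields a zero
`(c : -b)` of the binary quadratic form `x₂ (γ x₁ + δ x₂) + x₁ (α x₁ + β x₂)`, which therefore
vanishes: `D` is a multiple of the Euler derivation. -/
theorem card_eq_zero_of_slopeRatio {i j l : ι} (hij : AreTameFactors s b c i j)
    (hjl : AreTameFactors s b c j l) (hil : AreTameFactors s b c i l) {c₁ c₂ : Polynomial k}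
    (hc : c₁ ≠ 0 ∨ c₂ ≠ 0)
    (h : Polynomial.aeval (slopeRatio (∏ i ∈ s, binForm (b i) (c i))) c₁ =
      RatFunc.X * Polynomial.aeval (slopeRatio (∏ i ∈ s, binForm (b i) (c i))) c₂) :
    (s.card : k) = 0 := by
  set G := ∏ i ∈ s, binForm (b i) (c i) with hG
  set u := slopeRatio G with hu
  have htr : Transcendental k u := transcendental_slopeRatio hbc hij
  rw [transcendental_iff] at htr
  have hc2 : Polynomial.aeval u c₂ ≠ 0 := by
    intro h0
    rw [h0, mul_zero] at h
    rcases hc with h' | h'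
    · exact h' (htr _ h)
    · exact h' (htr _ h0)
  have hXmem : (RatFunc.X : RatFunc k) ∈ IntermediateField.adjoin k {u} := by
    rw [IntermediateField.mem_adjoin_simple_iff]
    exact ⟨c₁, c₂, by rw [eq_div_iff hc2, h]⟩
  have htop : IntermediateField.adjoin k {u} = ⊤ := by
    rw [eq_top_iff, ← RatFunc.adjoin_X, IntermediateField.adjoin_simple_le_iff]
    exact hXmem
  have hfin := RatFunc.finrank_eq_max_natDegree u
  rw [htop, IntermediateField.finrank_top] at hfin
  obtain ⟨α, β, hnum⟩ := Polynomial.exists_eq_X_add_C_of_natDegree_le_one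
    (p := u.num) (by rw [hfin]; exact le_max_left _ _)
  obtain ⟨γ, δ, hden⟩ := Polynomial.exists_eq_X_add_C_of_natDegree_le_one
    (p := u.denom) (by rw [hfin]; exact le_max_right _ _)
  have hE2 : evalGeneric (pderiv 2 G) ≠ 0 := evalGeneric_pderiv_two_ne_zero hbc hij
  have hrel : algebraMap (Polynomial k) (RatFunc k) u.denom * evalGeneric (pderiv 1 G) =
      algebraMap (Polynomial k) (RatFunc k) u.num * evalGeneric (pderiv 2 G) := by
    have h1 : u = evalGeneric (pderiv 1 G) / evalGeneric (pderiv 2 G) := rfl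
    have h2 := RatFunc.num_div_denom u
    have h3 : algebraMap (Polynomial k) (RatFunc k) u.denom ≠ 0 :=
      RatFunc.algebraMap_ne_zero u.denom_ne_zero
    rw [h1, div_eq_div_iff (by rw [← h1]; exact h3) hE2, ← h1] at h2
    rw [h2]; ring
  have hGhom : G.IsHomogeneous s.card := prod_binForm_isHomogeneous s b c
  have hGres : restrict₀ G = G := restrict₀_prod_binForm s b c
  set D : Derivation k (MvPolynomial (Fin 3) k) (MvPolynomial (Fin 3) k) :=
    binForm γ δ • pderiv 1 - binForm α β • pderiv 2 with hDdef
  have hDapp : ∀ Q, D Q = binForm γ δ * pderiv 1 Q - binForm α β * pderiv 2 Q := by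
    intro Q
    simp [hDdef]
  have hgen : ∀ x y : k, evalGeneric (binForm x y) =
      algebraMap (Polynomial k) (RatFunc k) (Polynomial.C x * Polynomial.X + Polynomial.C y) := by
    intro x y
    simp [evalGeneric, binForm, RatFunc.algebraMap_eq_C]
  have hD : D G = 0 := by
    have h1 : evalGeneric (D G) = 0 := by
      rw [hDapp, map_sub, map_mul, map_mul, hgen, hgen, ← hden, ← hnum, hrel, sub_self]
    have h2 : (D G).IsHomogeneous (1 + (s.card - 1)) := by
      rw [hDapp]
      exact ((binForm_isHomogeneous _ _).mul hGhom.pderiv).sub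
        ((binForm_isHomogeneous _ _).mul hGhom.pderiv)
    have h3 := restrict₀_eq_zero_of_evalGeneric h2 h1
    rw [hDapp, map_sub, map_mul, map_mul, restrict₀_pderiv (by decide),
      restrict₀_pderiv (by decide), hGres, restrict₀_binForm, restrict₀_binForm, ← hDapp] at h3
    exact h3
  have hDl : ∀ i, eval ![0, c i, -b i] (D (binForm (b i) (c i))) =
      γ * b i * c i - δ * b i ^ 2 - α * c i ^ 2 + β * b i * c i := by
    intro i
    rw [hDapp]
    simp [binForm, pderiv_X]
    ring
  have e1 := eval_derivation_binForm_eq_zero s b c hbc D hD i hij.1 hij.2.2.2.1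
  have e2 := eval_derivation_binForm_eq_zero s b c hbc D hD j hij.2.1 hij.2.2.2.2
  have e3 := eval_derivation_binForm_eq_zero s b c hbc D hD l hjl.2.1 hjl.2.2.2.2
  rw [hDl] at e1 e2 e3
  have d1 : b i * c j - b j * c i ≠ 0 := sub_ne_zero.mpr hij.2.2.1
  have d2 : b j * c l - b l * c j ≠ 0 := sub_ne_zero.mpr hjl.2.2.1
  have d3 : b i * c l - b l * c i ≠ 0 := sub_ne_zero.mpr hil.2.2.1
  -- the three zeros are distinct, so the Vandermonde-like determinant of the system is nonzero
  have hdet := mul_ne_zero (mul_ne_zero d1 d2) d3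
  have hα : α = 0 := by
    apply mul_right_cancel₀ hdet
    linear_combination -((b j * c l - b l * c j) * (b j * b l) * e1 -
      (b i * c l - b l * c i) * (b i * b l) * e2 +
      (b i * c j - b j * c i) * (b i * b j) * e3)
  have hδ : δ = 0 := by
    apply mul_right_cancel₀ hdet
    linear_combination -((b j * c l - b l * c j) * (c j * c l) * e1 -
      (b i * c l - b l * c i) * (c i * c l) * e2 +
      (b i * c j - b j * c i) * (c i * c j) * e3)
  have hγ : γ + β = 0 := by
    apply mul_right_cancel₀ hdet
    linear_combination -((b j * c l - b l * c j) * (c j * b l + b j * c l) * e1 -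
      (b i * c l - b l * c i) * (c i * b l + b i * c l) * e2 +
      (b i * c j - b j * c i) * (c i * b j + b i * c j) * e3)
  have hγ0 : γ ≠ 0 := by
    rintro rfl
    exact u.denom_ne_zero (by rw [hden, hδ]; simp)
  have hβ : β = -γ := by linear_combination hγ
  have hEuler := hGhom.sum_X_mul_pderiv
  rw [Fin.sum_univ_three] at hEuler
  have h0 : pderiv 0 G = 0 := pderiv_zero_prod_binForm s b c
  rw [hDapp, hδ, hα, hβ] at hD
  have h5 : C γ * (X 1 * pderiv 1 G + X 2 * pderiv 2 G) = 0 := by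
    rw [← hD, binForm, binForm]; simp; ring
  have h6 : X 1 * pderiv 1 G + X 2 * pderiv 2 G = 0 := by
    rcases mul_eq_zero.mp h5 with h | h
    · exact absurd (C_eq_zero.mp h) hγ0
    · exact h
  rw [h0, mul_zero, zero_add, h6] at hEuler
  have hG0 : G ≠ 0 := by
    intro hz
    rw [hz] at hE2
    simp at hE2
  rw [nsmul_eq_mul, eq_comm, mul_eq_zero] at hEuler
  rcases hEuler with h | h
  · have h7 : (C (s.card : k) : MvPolynomial (Fin 3) k) = 0 := by rw [← h]; simp
    exact C_eq_zero.mp h7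
  · exact absurd h hG0

end RestrictedForms

/-! ### Birational maps near a contracted line or a base point -/

section Charts

variable {k : Type*} [Field k]

/-- Affine coordinates `(u, w)` on the projective plane, given by polynomials `p₀, p₁, p₂` in `w` over
`k[u]`: every point off the coordinate lines `x₀ = 0` and `x₂ = 0` is proportional to a value of
`p`. -/
def IsChart (p : Fin 3 → Polynomial (Polynomial k)) : Prop :=
  ∀ v : Fin 3 → k, v 0 ≠ 0 → v 2 ≠ 0 →
    ∃ u w c : k, ∀ i, v i = c * Polynomial.aevalAeval u w (p i)

/-- The chart `(w : u : 1)`. -/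
noncomputable def lineChart : Fin 3 → Polynomial (Polynomial k) :=
  ![Polynomial.X, Polynomial.C Polynomial.X, 1]

/-- The chart `(1 : w u : w)`, i.e. the blow-up of the point `(1 : 0 : 0)`. -/
noncomputable def blowupChart : Fin 3 → Polynomial (Polynomial k) :=
  ![1, Polynomial.X * Polynomial.C Polynomial.X, Polynomial.X]

theorem aevalAeval_lineChart {A : Type*} [CommRing A] [Algebra k A] (u w : A) :
    (fun i => Polynomial.aevalAeval u w (lineChart (k := k) i)) = ![w, u, 1] := by
  funext i
  fin_cases i <;> simp [lineChart]

theorem aevalAeval_blowupChart {A : Type*} [CommRing A] [Algebra k A] (u w : A) :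
    (fun i => Polynomial.aevalAeval u w (blowupChart (k := k) i)) = ![1, w * u, w] := by
  funext i
  fin_cases i <;> simp [blowupChart]

theorem isChart_lineChart : IsChart (lineChart (k := k)) := by
  intro v h0 h2
  refine ⟨v 1 / v 2, v 0 / v 2, v 2, fun i => ?_⟩
  fin_cases i <;> simp [lineChart, Polynomial.aevalAeval] <;> field_simp

theorem isChart_blowupChart : IsChart (blowupChart (k := k)) := by
  intro v h0 h2
  refine ⟨v 1 / v 2, v 2 / v 0, v 0, fun i => ?_⟩
  fin_cases i <;> simp [blowupChart, Polynomial.aevalAeval] <;> field_simp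

theorem aevalAeval_aeval {A : Type*} [CommRing A] [Algebra k A] (u w : A)
    (p : Fin 3 → Polynomial (Polynomial k)) (Q : MvPolynomial (Fin 3) k) :
    Polynomial.aevalAeval u w (aeval p Q) = aeval (fun i => Polynomial.aevalAeval u w (p i)) Q := by
  have := AlgHom.congr_fun (φ₁ := (Polynomial.aevalAeval (R := k) u w).comp (aeval p))
      (φ₂ := aeval (fun i => Polynomial.aevalAeval u w (p i))) (by
        apply MvPolynomial.algHom_ext
        intro i
        simp) Q
  exact this

theorem IsChart.aeval_ne_zero [Infinite k] {p : Fin 3 → Polynomial (Polynomial k)}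
    (hp : IsChart p) {Q : MvPolynomial (Fin 3) k} {e : ℕ} (hQ : Q.IsHomogeneous e) (h0 : Q ≠ 0) :
    aeval p Q ≠ 0 := by
  intro h
  obtain ⟨v, hv⟩ := exists_eval_ne_zero
    (mul_ne_zero (mul_ne_zero h0 (X_ne_zero (R := k) (0 : Fin 3))) (X_ne_zero 2))
  simp only [map_mul, eval_X] at hv
  obtain ⟨u, w, c, huv⟩ := hp v (right_ne_zero_of_mul (left_ne_zero_of_mul hv))
    (right_ne_zero_of_mul hv)
  apply left_ne_zero_of_mul (left_ne_zero_of_mul hv)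
  have h1 := aeval_const_mul_of_isHomogeneous hQ c (fun i => Polynomial.aevalAeval u w (p i))
  rw [← aevalAeval_aeval, h, map_zero, mul_zero, ← funext huv] at h1
  simpa [coe_aeval_eq_eval] using h1

variable {K : Type*} [Field K] [Algebra k K]

theorem constantCoeff_aevalAeval {u w : PowerSeries K} (hw : PowerSeries.constantCoeff w = 0)
    (a : Polynomial (Polynomial k)) :
    PowerSeries.constantCoeff (Polynomial.aevalAeval u w a) =
      Polynomial.aeval (PowerSeries.constantCoeff u) (a.coeff 0) := by
  induction a using Polynomial.induction_on' with
  | add p q hp hq => simp only [map_add, hp, hq, Polynomial.coeff_add]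
  | monomial n q =>
    have h1 : PowerSeries.constantCoeff (Polynomial.aeval u q) =
        Polynomial.aeval (PowerSeries.constantCoeff u) q := by
      induction q using Polynomial.induction_on' with
      | add p q hp hq => simp only [map_add, hp, hq]
      | monomial n r =>
        simp [PowerSeries.algebraMap_apply]
    simp only [Polynomial.aevalAeval, Polynomial.aevalAevalEquiv, Equiv.coe_fn_mk,
      AlgHom.coe_comp, AlgHom.coe_restrictScalars', Function.comp_apply] at *
    rcases n with _ | n
    · simpa using h1
    · simp [Polynomial.coeff_monomial, hw]

/-- A relation `a₁ = s a₂` along a formal branch `(u, w)` that meets `w = 0` but is not contained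
in it gives such a relation, not identically zero, at the point `w = 0` of the branch. -/
theorem exists_relation_constantCoeff {u w : PowerSeries K} (hw : PowerSeries.constantCoeff w = 0)
    (hw0 : w ≠ 0) (s : K) (n : ℕ) :
    ∀ a₁ a₂ : Polynomial (Polynomial k), a₁.natDegree = n → a₁ ≠ 0 →
    Polynomial.aevalAeval u w a₁ = PowerSeries.C s * Polynomial.aevalAeval u w a₂ →
    ∃ c₁ c₂ : Polynomial k, (c₁ ≠ 0 ∨ c₂ ≠ 0) ∧
      Polynomial.aeval (PowerSeries.constantCoeff u) c₁ =
        s * Polynomial.aeval (PowerSeries.constantCoeff u) c₂ := by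
  induction n using Nat.strong_induction_on with
  | _ n ih =>
    intro a₁ a₂ hn h1 h
    by_cases hX : a₁.coeff 0 = 0 ∧ a₂.coeff 0 = 0
    · obtain ⟨b₁, rfl⟩ := Polynomial.X_dvd_iff.mpr hX.1
      obtain ⟨b₂, rfl⟩ := Polynomial.X_dvd_iff.mpr hX.2
      have hb1 : b₁ ≠ 0 := right_ne_zero_of_mul h1
      rw [Polynomial.natDegree_X_mul hb1] at hn
      refine ih b₁.natDegree (by omega) b₁ b₂ rfl hb1 ?_
      have hX' : Polynomial.aevalAeval u w (Polynomial.X : Polynomial (Polynomial k)) = w := by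
        simp [Polynomial.aevalAeval]
      apply mul_left_cancel₀ hw0
      rw [map_mul, map_mul, hX'] at h
      rw [h]; ring
    · refine ⟨a₁.coeff 0, a₂.coeff 0, by tauto, ?_⟩
      have := congrArg PowerSeries.constantCoeff h
      rw [map_mul, constantCoeff_aevalAeval hw, constantCoeff_aevalAeval hw,
        PowerSeries.constantCoeff_C] at this
      exact this

theorem aeval_mul_eq_of_comp {φ ψ : Fin 3 → MvPolynomial (Fin 3) k} {h : MvPolynomial (Fin 3) k}
    (H : ∀ i, bind₁ φ (ψ i) = h * X i) {e' : ℕ} (hψ : ∀ i, (ψ i).IsHomogeneous e')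
    {p : Fin 3 → Polynomial (Polynomial k)} {x : Fin 3 → PowerSeries K} {c u w : PowerSeries K}
    (hφ : ∀ i, aeval x (φ i) = c * Polynomial.aevalAeval u w (p i)) (i : Fin 3) :
    aeval x h * x i = c ^ e' * Polynomial.aevalAeval u w (aeval p (ψ i)) := by
  have h1 := congrArg (aeval x) (H i)
  rw [map_mul, aeval_X, aeval_bind₁, funext hφ, aeval_const_mul_of_isHomogeneous (hψ i),
    ← aevalAeval_aeval] at h1
  exact h1.symm

/-- Let `ψ ∘ φ` be the identity, and let `x` be a formal branch along which `x₁ = s x₂`, such that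
`φ(x)` has the coordinates `(u, w)` in a chart of the target. Then `s` and the value of `u` at the
origin satisfy a nontrivial relation that is linear in `s`. -/
theorem exists_relation_of_compEqId [Infinite k] {φ ψ : Fin 3 → MvPolynomial (Fin 3) k}
    (hψφ : CompEqId (m := 2) ψ φ) {e' : ℕ} (hψ : ∀ i, (ψ i).IsHomogeneous e')
    {p : Fin 3 → Polynomial (Polynomial k)} (hp : IsChart p) {x : Fin 3 → PowerSeries K} {s : K}
    (hx : x 1 = PowerSeries.C s * x 2) {c u w : PowerSeries K} (hc : c ≠ 0)
    (hw : PowerSeries.constantCoeff w = 0) (hw0 : w ≠ 0)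
    (hφ : ∀ i, aeval x (φ i) = c * Polynomial.aevalAeval u w (p i)) :
    ∃ c₁ c₂ : Polynomial k, (c₁ ≠ 0 ∨ c₂ ≠ 0) ∧
      Polynomial.aeval (PowerSeries.constantCoeff u) c₁ =
        s * Polynomial.aeval (PowerSeries.constantCoeff u) c₂ := by
  obtain ⟨h, h0, H⟩ := hψφ
  have key := aeval_mul_eq_of_comp H hψ hφ
  have hψ1 : ψ 1 ≠ 0 := by
    intro hz
    have := H 1
    rw [hz, map_zero] at this
    exact mul_ne_zero h0 (X_ne_zero 1) this.symm
  refine exists_relation_constantCoeff hw hw0 s _ (aeval p (ψ 1)) (aeval p (ψ 2)) rfl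
    (hp.aeval_ne_zero (hψ 1) hψ1) ?_
  apply mul_left_cancel₀ (pow_ne_zero e' hc)
  have h1 := key 1
  have h2 := key 2
  rw [hx] at h1
  linear_combination PowerSeries.C s * h2 - h1

end Charts

section Branches

variable {k : Type*} [Field k]

/-- The formal branch `(1 : t s : t)` through `(1 : 0 : 0)` in the generic direction `s`. -/
noncomputable def pointBranch : Fin 3 → PowerSeries (RatFunc k) :=
  ![1, PowerSeries.X * PowerSeries.C RatFunc.X, PowerSeries.X]

/-- The formal branch `(t : s : 1)` through the generic point `(0 : s : 1)` of the line
`x₀ = 0`. -/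
noncomputable def lineBranch : Fin 3 → PowerSeries (RatFunc k) :=
  ![PowerSeries.X, PowerSeries.C RatFunc.X, 1]

theorem aevalAeval_generic_injective :
    Function.Injective (Polynomial.aevalAeval (R := k) (A := PowerSeries (RatFunc k))
      (PowerSeries.C RatFunc.X) PowerSeries.X) := by
  rw [injective_iff_map_eq_zero]
  intro a ha
  have key : ∀ a : Polynomial (Polynomial k), Polynomial.aevalAeval
      (A := PowerSeries (RatFunc k)) (PowerSeries.C RatFunc.X) PowerSeries.X a =
      ((a.map (algebraMap (Polynomial k) (RatFunc k)) : Polynomial (RatFunc k)) :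
        PowerSeries (RatFunc k)) := by
    intro a
    have hC : ∀ q : Polynomial k, Polynomial.aeval (PowerSeries.C (RatFunc.X (K := k))) q =
        PowerSeries.C (algebraMap (Polynomial k) (RatFunc k) q) := by
      intro q
      induction q using Polynomial.induction_on' with
      | add p q hp hq => simp only [map_add, hp, hq]
      | monomial n r =>
        simp [PowerSeries.algebraMap_apply, ← Polynomial.C_mul_X_pow_eq_monomial]
    induction a using Polynomial.induction_on' with
    | add p q hp hq => simp only [map_add, hp, hq, Polynomial.map_add, Polynomial.coe_add]
    | monomial n q =>
      rw [← Polynomial.C_mul_X_pow_eq_monomial, Polynomial.map_mul, Polynomial.map_C,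
        Polynomial.map_pow, Polynomial.map_X, Polynomial.coe_mul, Polynomial.coe_C,
        Polynomial.coe_pow, Polynomial.coe_X, ← hC, map_mul, map_pow,
        Polynomial.aevalAeval_C, Polynomial.aevalAeval_Y]
  rw [key] at ha
  have h1 := Polynomial.coe_eq_zero_iff.mp ha
  exact (Polynomial.map_eq_zero_iff (RatFunc.algebraMap_injective k)).mp h1

theorem aeval_pointBranch_ne_zero [Infinite k] {Q : MvPolynomial (Fin 3) k} {e : ℕ}
    (hQ : Q.IsHomogeneous e) (h0 : Q ≠ 0) : aeval (pointBranch (k := k)) Q ≠ 0 := by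
  have h1 := isChart_blowupChart.aeval_ne_zero hQ h0
  have h2 : (fun i => Polynomial.aevalAeval (A := PowerSeries (RatFunc k))
      (PowerSeries.C RatFunc.X) PowerSeries.X (blowupChart (k := k) i)) = pointBranch := by
    funext i
    fin_cases i <;> simp [blowupChart, pointBranch, Polynomial.aevalAeval]
  rw [← h2, ← aevalAeval_aeval]
  exact fun h => h1 (aevalAeval_generic_injective (by rw [h, map_zero]))

theorem constantCoeff_aeval {K : Type*} [Field K] [Algebra k K] (x : Fin 3 → PowerSeries K)
    (Q : MvPolynomial (Fin 3) k) : PowerSeries.constantCoeff (aeval x Q) =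
      aeval (fun i => PowerSeries.constantCoeff (x i)) Q := by
  induction Q using MvPolynomial.induction_on with
  | C a => simp [PowerSeries.algebraMap_apply]
  | add p q hp hq => simp only [map_add, hp, hq]
  | mul_X p n hp => simp only [map_mul, hp, aeval_X]

theorem constantCoeff_aeval_lineBranch (Q : MvPolynomial (Fin 3) k) :
    PowerSeries.constantCoeff (aeval lineBranch Q) = evalGeneric Q := by
  rw [constantCoeff_aeval, evalGeneric]
  congr 2
  funext i
  fin_cases i <;> simp [lineBranch]

theorem constantCoeff_aeval_pointBranch (Q : MvPolynomial (Fin 3) k) :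
    PowerSeries.constantCoeff (aeval pointBranch Q) =
      algebraMap k (RatFunc k) (eval ![1, 0, 0] Q) := by
  rw [constantCoeff_aeval]
  have h1 : (fun i => PowerSeries.constantCoeff (pointBranch (k := k) i)) =
      fun i => algebraMap k (RatFunc k) ((![1, 0, 0] : Fin 3 → k) i) := by
    funext i
    fin_cases i <;> simp [pointBranch]
  rw [h1]
  simpa [Function.comp_def, coe_aeval_eq_eval] using
    aeval_algebraMap_apply (RatFunc k) (![1, 0, 0] : Fin 3 → k) Q

theorem aeval_pointBranch {Q : MvPolynomial (Fin 3) k} {e : ℕ} (hQ : Q.IsHomogeneous e)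
    (hr : restrict₀ Q = Q) :
    aeval pointBranch Q = PowerSeries.X ^ e * PowerSeries.C (evalGeneric Q) := by
  have hC : PowerSeries.C (evalGeneric Q) =
      aeval ![0, PowerSeries.C (RatFunc.X (K := k)), 1] Q := by
    clear hQ hr
    induction Q using MvPolynomial.induction_on with
    | C a => simp [evalGeneric, PowerSeries.algebraMap_apply]
    | add p q hp hq => simp only [map_add, hp, hq]
    | mul_X p n hp =>
      rw [map_mul, map_mul, hp, map_mul]
      congr 1
      fin_cases n <;> simp [evalGeneric]
  conv_lhs => rw [← hr, restrict₀, aeval_bind₁]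
  rw [hC, ← aeval_const_mul_of_isHomogeneous hQ]
  congr 2
  funext i
  fin_cases i <;> simp [pointBranch]

end Branches

section LocalAnalysis

variable {k : Type*} [Field k] {ι : Type*}

theorem evalGeneric_restrict₀ (Q : MvPolynomial (Fin 3) k) :
    evalGeneric (restrict₀ Q) = evalGeneric Q := by
  rw [restrict₀, evalGeneric, aeval_bind₁]
  congr 2
  funext i
  fin_cases i <;> simp

theorem algebraMap_coeff_zero_aeval_lineChart (Q : MvPolynomial (Fin 3) k) :
    algebraMap (Polynomial k) (RatFunc k) ((aeval lineChart Q).coeff 0) = evalGeneric Q := by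
  induction Q using MvPolynomial.induction_on with
  | C a => simp [evalGeneric]
  | add p q hp hq => simp only [map_add, Polynomial.coeff_add, hp, hq]
  | mul_X p n hp =>
    rw [map_mul, map_mul, Polynomial.mul_coeff_zero, map_mul, hp]
    congr 1
    fin_cases n <;> simp [evalGeneric, lineChart]

section Point

variable {s : Finset ι} {b c : ι → k} {U : MvPolynomial (Fin 3) k} {e : ℕ}

/-- Near a multiple point `(1 : 0 : 0)`, at which the tangent cone of the curve is `∏ᵢ lᵢ = 0`, the
polar map sends the generic branch to a branch that meets the line `x₀ = 0` in the point given by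
the slope ratio of `∏ᵢ lᵢ`. -/
theorem exists_polar_pointBranch (hs : s.Nonempty) (hU : eval ![1, 0, 0] U ≠ 0)
    (h2 : evalGeneric (pderiv 2 (∏ i ∈ s, binForm (b i) (c i))) ≠ 0) :
    ∃ A u w : PowerSeries (RatFunc k), A ≠ 0 ∧ PowerSeries.constantCoeff w = 0 ∧
      PowerSeries.constantCoeff u = slopeRatio (∏ i ∈ s, binForm (b i) (c i)) ∧
      ∀ i, aeval pointBranch (pderiv i ((∏ i ∈ s, binForm (b i) (c i)) * U)) =
        A * Polynomial.aevalAeval u w (lineChart (k := k) i) := by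
  set P := ∏ i ∈ s, binForm (b i) (c i) with hP
  obtain ⟨n, hn⟩ : ∃ n, s.card = n + 1 :=
    ⟨s.card - 1, (Nat.succ_pred_eq_of_pos (Finset.card_pos.mpr hs)).symm⟩
  have hPhom : P.IsHomogeneous (n + 1) := hn ▸ prod_binForm_isHomogeneous s b c
  have hPres : restrict₀ P = P := restrict₀_prod_binForm s b c
  set x := pointBranch (k := k)
  have hxP : aeval x P = PowerSeries.X ^ (n + 1) * PowerSeries.C (evalGeneric P) :=
    aeval_pointBranch hPhom hPres
  have hxPj : ∀ j : Fin 3, j ≠ 0 → aeval x (pderiv j P) =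
      PowerSeries.X ^ n * PowerSeries.C (evalGeneric (pderiv j P)) := by
    intro j hj
    apply aeval_pointBranch
    · simpa using hPhom.pderiv (i := j)
    · rw [restrict₀_pderiv hj, hPres]
  have hP0 : pderiv 0 P = 0 := pderiv_zero_prod_binForm s b c
  set ρ : Fin 3 → PowerSeries (RatFunc k) := fun j =>
    PowerSeries.C (evalGeneric (pderiv j P)) * aeval x U +
      PowerSeries.X * PowerSeries.C (evalGeneric P) * aeval x (pderiv j U) with hρ
  have hφ : ∀ j, aeval x (pderiv j (P * U)) = PowerSeries.X ^ n * ρ j := by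
    intro j
    rw [pderiv_mul, map_add, map_mul, map_mul, hxP]
    by_cases hj : j = 0
    · subst hj
      simp only [hρ, hP0, map_zero]
      ring
    · rw [hxPj j hj]
      simp only [hρ]
      ring
  have hρc : ∀ j, PowerSeries.constantCoeff (ρ j) =
      evalGeneric (pderiv j P) * algebraMap k (RatFunc k) (eval ![1, 0, 0] U) := by
    intro j
    simp only [hρ, map_add, map_mul, PowerSeries.constantCoeff_C, PowerSeries.constantCoeff_X,
      zero_mul, add_zero, x, constantCoeff_aeval_pointBranch]
  have hUne : algebraMap k (RatFunc k) (eval ![1, 0, 0] U) ≠ 0 := by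
    simpa using hU
  have hρ2 : PowerSeries.constantCoeff (ρ 2) ≠ 0 := by
    rw [hρc]; exact mul_ne_zero h2 hUne
  have hinv : ρ 2 * (ρ 2)⁻¹ = 1 := PowerSeries.mul_inv_cancel _ hρ2
  refine ⟨PowerSeries.X ^ n * ρ 2, ρ 1 * (ρ 2)⁻¹, ρ 0 * (ρ 2)⁻¹, ?_, ?_, ?_, ?_⟩
  · refine mul_ne_zero (pow_ne_zero _ PowerSeries.X_ne_zero) fun h => hρ2 (by rw [h, map_zero])
  · rw [map_mul, hρc, hP0, map_zero, zero_mul, zero_mul]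
  · rw [map_mul, PowerSeries.constantCoeff_inv, hρc, hρc, slopeRatio]
    field_simp
  · intro j
    rw [hφ, congrFun (aevalAeval_lineChart (k := k) (ρ 1 * (ρ 2)⁻¹) (ρ 0 * (ρ 2)⁻¹)) j]
    fin_cases j
    · simp; linear_combination (-PowerSeries.X ^ n * ρ 0) * hinv
    · simp; linear_combination (-PowerSeries.X ^ n * ρ 1) * hinv
    · simp

variable [DecidableEq k] [DecidableEq ι]

theorem areTameFactors_of_pairwise
    (hne : ∀ i ∈ s, ∀ j ∈ s, i ≠ j → b i * c j ≠ b j * c i) {i j : ι} (hi : i ∈ s) (hj : j ∈ s)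
    (hij : i ≠ j) : AreTameFactors s b c i j := by
  have key : ∀ i ∈ s, (s.filter fun l => b i * c l = b l * c i) = {i} := by
    intro i hi
    ext l
    simp only [Finset.mem_filter, Finset.mem_singleton]
    constructor
    · rintro ⟨hl, h⟩
      by_contra hli
      exact hne i hi l hl (fun h => hli h.symm) h
    · rintro rfl
      exact ⟨hi, rfl⟩
  refine ⟨hi, hj, hne i hi j hj hij, ?_, ?_⟩
  · rw [key i hi]; simp
  · rw [key j hj]; simp

omit [DecidableEq k] [DecidableEq ι] in
theorem ne_zero_of_pairwise (hs : 2 ≤ s.card)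
    (hne : ∀ i ∈ s, ∀ j ∈ s, i ≠ j → b i * c j ≠ b j * c i) : ∀ i ∈ s, b i ≠ 0 ∨ c i ≠ 0 := by
  intro i hi
  by_contra! h
  obtain ⟨j, hj, hji⟩ := Finset.exists_mem_ne (show 1 < s.card by omega) i
  exact hne i hi j hj hji.symm (by rw [h.1, h.2]; ring)

variable [Infinite k] {ψ : Fin 3 → MvPolynomial (Fin 3) k} {e' : ℕ}

/-- The line dual to a multiple point is contracted to that point by the inverse `ψ` of the polar
map, so that its equation divides `∑ᵢ xᵢ ψᵢ`. -/
theorem X_dvd_sum_of_multiple_point (hs : 2 ≤ s.card)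
    (hne : ∀ i ∈ s, ∀ j ∈ s, i ≠ j → b i * c j ≠ b j * c i) (hU : eval ![1, 0, 0] U ≠ 0)
    (hψφ : CompEqId (m := 2) ψ (polarTuple (m := 2) ((∏ i ∈ s, binForm (b i) (c i)) * U)))
    (hψ : ∀ i, (ψ i).IsHomogeneous e') : X 0 ∣ ∑ i, X i * ψ i := by
  obtain ⟨i, hi, j, hj, hij⟩ := Finset.one_lt_card.mp (show 1 < s.card by omega)
  have hbc := ne_zero_of_pairwise hs hne
  have htame := areTameFactors_of_pairwise hne hi hj hij
  obtain ⟨A, u, w, hA, hw, hu, hφ⟩ := exists_polar_pointBranch ⟨i, hi⟩ hU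
    (evalGeneric_pderiv_two_ne_zero hbc htame)
  have htr := transcendental_iff.mp (transcendental_slopeRatio hbc htame)
  obtain ⟨h, h0, H⟩ := hψφ
  have key := aeval_mul_eq_of_comp H hψ hφ
  have hdvd : ∀ j : Fin 3, j ≠ 0 → X 0 ∣ ψ j := by
    intro j hj
    have h1 : Polynomial.aevalAeval u w (aeval (lineChart (k := k)) (ψ j)) =
        pointBranch j * Polynomial.aevalAeval u w (aeval (lineChart (k := k)) (ψ 0)) := by
      apply mul_left_cancel₀ (pow_ne_zero e' hA)
      have e0 := key 0
      have ej := key j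
      have hx0 : pointBranch (k := k) 0 = 1 := rfl
      rw [hx0] at e0
      linear_combination pointBranch j * e0 - ej
    have h2 := congrArg PowerSeries.constantCoeff h1
    have hxj : PowerSeries.constantCoeff (pointBranch (k := k) j) = 0 := by
      fin_cases j
      · simp at hj
      all_goals simp [pointBranch]
    rw [map_mul, hxj, zero_mul, constantCoeff_aevalAeval hw, hu] at h2
    have h3 := htr _ h2
    have h4 := algebraMap_coeff_zero_aeval_lineChart (ψ j)
    rw [h3, map_zero] at h4
    exact X_dvd_of_restrict₀_eq_zero (restrict₀_eq_zero_of_evalGeneric (hψ j) h4.symm)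
  rw [Fin.sum_univ_three]
  exact dvd_add (dvd_add (dvd_mul_right _ _) ((hdvd 1 (by decide)).mul_left _))
    ((hdvd 2 (by decide)).mul_left _)

/-- If the polar map is birational, the multiplicity of a point of multiplicity at least `3`
vanishes in `k`. -/
theorem card_eq_zero_of_multiple_point (hs : 3 ≤ s.card)
    (hne : ∀ i ∈ s, ∀ j ∈ s, i ≠ j → b i * c j ≠ b j * c i) (hU : eval ![1, 0, 0] U ≠ 0)
    (hUhom : U.IsHomogeneous e)
    (h0 : pderiv 0 ((∏ i ∈ s, binForm (b i) (c i)) * U) ≠ 0)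
    (hψφ : CompEqId (m := 2) ψ (polarTuple (m := 2) ((∏ i ∈ s, binForm (b i) (c i)) * U)))
    (hψ : ∀ i, (ψ i).IsHomogeneous e') : (s.card : k) = 0 := by
  obtain ⟨i, hi, j, hj, l, hl, hij, hil, hjl⟩ := Finset.two_lt_card.mp (show 2 < s.card by omega)
  have hbc := ne_zero_of_pairwise (by omega) hne
  have htame := areTameFactors_of_pairwise hne hi hj hij
  obtain ⟨A, u, w, hA, hw, hu, hφ⟩ := exists_polar_pointBranch ⟨i, hi⟩ hU
    (evalGeneric_pderiv_two_ne_zero hbc htame)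
  have hw0 : w ≠ 0 := by
    rintro rfl
    have h1 := hφ 0
    have h2 : Polynomial.aevalAeval u (0 : PowerSeries (RatFunc k)) (lineChart (k := k) 0) = 0 := by
      simp [lineChart]
    rw [h2, mul_zero] at h1
    exact aeval_pointBranch_ne_zero
      (((prod_binForm_isHomogeneous s b c).mul hUhom).pderiv (i := 0)) h0 h1
  obtain ⟨c₁, c₂, hc, hrel⟩ := exists_relation_of_compEqId hψφ hψ isChart_lineChart
    (x := pointBranch) (s := RatFunc.X) (by simp [pointBranch, mul_comm]) hA hw hw0 hφ
  rw [hu] at hrel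
  exact card_eq_zero_of_slopeRatio hbc htame (areTameFactors_of_pairwise hne hj hl hjl)
    (areTameFactors_of_pairwise hne hi hl hil) hc hrel

end Point

/-- If the polar map is birational and a line of the arrangement, say `x₀ = 0`, contains three
multiple points, all of which have multiplicity different from `1` in `k`, then the number of the
remaining lines vanishes in `k`. -/
theorem card_eq_zero_of_line [DecidableEq k] [DecidableEq ι] [Infinite k] {s : Finset ι}
    {a : ι → Fin 3 → k} (ha : ∀ i ∈ s, a i 1 ≠ 0 ∨ a i 2 ≠ 0) {i j l : ι}
    (hij : AreTameFactors s (fun i => a i 1) (fun i => a i 2) i j)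
    (hjl : AreTameFactors s (fun i => a i 1) (fun i => a i 2) j l)
    (hil : AreTameFactors s (fun i => a i 1) (fun i => a i 2) i l)
    {ψ : Fin 3 → MvPolynomial (Fin 3) k} {e' : ℕ}
    (hψφ : CompEqId (m := 2) ψ (polarTuple (m := 2) (X 0 * ∏ i ∈ s, linearForm (a i))))
    (hψ : ∀ i, (ψ i).IsHomogeneous e') : (s.card : k) = 0 := by
  set g := ∏ i ∈ s, linearForm (a i) with hg
  set G := ∏ i ∈ s, binForm (a i 1) (a i 2) with hG
  have hgG : restrict₀ g = G := by
    rw [hg, map_prod]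
    refine Finset.prod_congr rfl fun i _ => ?_
    rw [map_linearForm, Fin.sum_univ_three]
    simp [restrict₀, binForm]
  set x := lineBranch (k := k)
  have hE2 : evalGeneric (pderiv 2 G) ≠ 0 :=
    evalGeneric_pderiv_two_ne_zero (b := fun i => a i 1) (c := fun i => a i 2) ha hij
  have hG0 : evalGeneric G ≠ 0 := by
    intro h
    have h1 := restrict₀_eq_zero_of_evalGeneric (prod_binForm_isHomogeneous s _ _) h
    rw [restrict₀_prod_binForm] at h1
    rw [hG, h1] at hE2
    simp at hE2
  have hgj : ∀ j : Fin 3, j ≠ 0 → PowerSeries.constantCoeff (aeval x (pderiv j g)) =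
      evalGeneric (pderiv j G) := by
    intro j hj
    rw [constantCoeff_aeval_lineBranch, ← evalGeneric_restrict₀, restrict₀_pderiv hj, hgG]
  have hx0 : x 0 = PowerSeries.X := rfl
  have hφ0 : PowerSeries.constantCoeff (aeval x (pderiv 0 (X 0 * g))) = evalGeneric G := by
    rw [pderiv_mul, pderiv_X_self, one_mul, map_add, map_mul, aeval_X, hx0, map_add, map_mul,
      PowerSeries.constantCoeff_X, zero_mul, add_zero, constantCoeff_aeval_lineBranch,
      ← evalGeneric_restrict₀, hgG]
  have hφj : ∀ j : Fin 3, j ≠ 0 → aeval x (pderiv j (X 0 * g)) =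
      PowerSeries.X * aeval x (pderiv j g) := by
    intro j hj
    rw [pderiv_mul, pderiv_X_of_ne hj.symm, zero_mul, zero_add, map_mul, aeval_X, hx0]
  set φ₀ := aeval x (pderiv 0 (X 0 * g)) with hφ₀
  have hinv0 : φ₀ * φ₀⁻¹ = 1 := PowerSeries.mul_inv_cancel _ (by rw [hφ0]; exact hG0)
  have hc2 : PowerSeries.constantCoeff (aeval x (pderiv 2 g)) ≠ 0 := by
    rw [hgj 2 (by decide)]; exact hE2
  have hinv2 : aeval x (pderiv 2 g) * (aeval x (pderiv 2 g))⁻¹ = 1 :=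
    PowerSeries.mul_inv_cancel _ hc2
  obtain ⟨c₁, c₂, hc, hrel⟩ := exists_relation_of_compEqId hψφ hψ isChart_blowupChart
    (x := x) (s := RatFunc.X) (c := φ₀)
    (u := aeval x (pderiv 1 g) * (aeval x (pderiv 2 g))⁻¹)
    (w := PowerSeries.X * aeval x (pderiv 2 g) * φ₀⁻¹)
    (by simp [x, lineBranch])
    (fun h => hG0 (by rw [← hφ0, h, map_zero])) (by simp)
    (by
      refine mul_ne_zero (mul_ne_zero PowerSeries.X_ne_zero fun h => hc2 (by rw [h, map_zero]))
        fun h => ?_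
      rw [h, mul_zero] at hinv0
      exact zero_ne_one hinv0)
    (by
      intro j
      rw [congrFun (aevalAeval_blowupChart (k := k) _ _) j]
      change aeval x (pderiv j (X 0 * g)) = _
      fin_cases j
      · simp [hφ₀]
      · change aeval x (pderiv 1 (X 0 * g)) = _
        rw [hφj 1 (by decide)]
        simp
        linear_combination (-PowerSeries.X * aeval x (pderiv 1 g)) * (hinv0 + φ₀ * φ₀⁻¹ * hinv2)
      · change aeval x (pderiv 2 (X 0 * g)) = _
        rw [hφj 2 (by decide)]
        simp
        linear_combination (-PowerSeries.X * aeval x (pderiv 2 g)) * hinv0)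
  have hu : PowerSeries.constantCoeff (aeval x (pderiv 1 g) * (aeval x (pderiv 2 g))⁻¹) =
      slopeRatio G := by
    rw [map_mul, PowerSeries.constantCoeff_inv, hgj 1 (by decide), hgj 2 (by decide), slopeRatio,
      div_eq_mul_inv]
  rw [hu] at hrel
  exact card_eq_zero_of_slopeRatio (b := fun i => a i 1) (c := fun i => a i 2) ha hij hjl hil hc
    hrel

end LocalAnalysis

/-! ### The degree of the inverse of a plane birational map -/

section InverseDegree

variable {k : Type*} [Field k]

theorem natDegree_finSuccEquiv_le {Q : MvPolynomial (Fin 3) k} {e : ℕ} (hQ : Q.IsHomogeneous e) :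
    (finSuccEquiv k 2 Q).natDegree ≤ e := by
  rw [natDegree_finSuccEquiv]
  exact (degreeOf_le_totalDegree Q 0).trans hQ.totalDegree_le

theorem coeff_finSuccEquiv_of_isHomogeneous {Q : MvPolynomial (Fin 3) k} {e : ℕ}
    (hQ : Q.IsHomogeneous e) : (finSuccEquiv k 2 Q).coeff e = C (eval ![1, 0, 0] Q) := by
  have hhom : ∀ i j, i + j = e → ((finSuccEquiv k 2 Q).coeff i).IsHomogeneous j :=
    fun i j h => hQ.finSuccEquiv_coeff_isHomogeneous i j h
  obtain ⟨c, hc⟩ : ∃ c, (finSuccEquiv k 2 Q).coeff e = C c :=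
    ⟨_, totalDegree_eq_zero_iff_eq_C.mp
      (Nat.le_zero.mp ((hhom e 0 (add_zero e)).totalDegree_le))⟩
  have h1 := eval_eq_eval_mv_eval' (0 : Fin 2 → k) 1 Q
  have h2 : (Fin.cons 1 (0 : Fin 2 → k) : Fin 3 → k) = ![1, 0, 0] := by
    funext i; fin_cases i <;> rfl
  rw [h2, Polynomial.eval_map, Polynomial.eval₂_eq_sum_range' _
    (Nat.lt_succ_of_le (natDegree_finSuccEquiv_le hQ)), Finset.sum_eq_single e] at h1
  · rw [hc, h1, hc]; simp
  · intro i hi hie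
    have hlt : i < e := by simp at hi; omega
    have h3 := aeval_const_mul_of_isHomogeneous (hhom i (e - i) (by omega)) (0 : k) 0
    rw [zero_pow (by omega), zero_mul] at h3
    have h4 : eval (0 : Fin 2 → k) ((finSuccEquiv k 2 Q).coeff i) = 0 := by
      simpa [coe_aeval_eq_eval] using h3
    rw [one_pow, mul_one]; exact h4
  · intro h; simp at h

/-- Two relatively prime homogeneous polynomials, one of which does not vanish at `(1 : 0 : 0)`,
remain coprime as polynomials in `x₀` over the field `k(x₁, x₂)`. -/
theorem isCoprime_map_finSuccEquiv {P Q : MvPolynomial (Fin 3) k} {e : ℕ}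
    (hP : P.IsHomogeneous e) (hP0 : eval ![1, 0, 0] P ≠ 0) (hPQ : IsRelPrime P Q)
    (F : Type*) [Field F] [Algebra (MvPolynomial (Fin 2) k) F]
    [IsFractionRing (MvPolynomial (Fin 2) k) F] :
    IsCoprime ((finSuccEquiv k 2 P).map (algebraMap _ F))
      ((finSuccEquiv k 2 Q).map (algebraMap _ F)) := by
  set r := eval ![1, 0, 0] P with hr
  set p := finSuccEquiv k 2 (C r⁻¹ * P) with hp
  have hrP : (C r⁻¹ * P).IsHomogeneous e := hP.C_mul _
  have hmonic : p.Monic := by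
    refine Polynomial.monic_of_natDegree_le_of_coeff_eq_one e (natDegree_finSuccEquiv_le hrP) ?_
    rw [hp, coeff_finSuccEquiv_of_isHomogeneous hrP, map_mul, eval_C, ← hr,
      inv_mul_cancel₀ hP0, C_1]
  have hp' : finSuccEquiv k 2 P = Polynomial.C (C r) * p := by
    rw [hp, map_mul, ← mul_assoc, finSuccEquiv_apply, finSuccEquiv_apply]
    simp [← map_mul, mul_inv_cancel₀ hP0]
  have hunit : IsUnit (Polynomial.C (C r : MvPolynomial (Fin 2) k)) :=
    Polynomial.isUnit_C.mpr ((isUnit_iff_ne_zero.mpr hP0).map C)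
  have hpQ : IsRelPrime p (finSuccEquiv k 2 Q) := by
    intro d hd1 hd2
    have := hPQ (d := (finSuccEquiv k 2).symm d)
      ((map_dvd_iff (finSuccEquiv k 2)).mp (by simpa [hp'] using hd1.mul_left _))
      ((map_dvd_iff (finSuccEquiv k 2)).mp (by simpa using hd2))
    simpa using this.map (finSuccEquiv k 2)
  rw [hp', Polynomial.map_mul]
  refine (isCoprime_mul_unit_left_left
    (hunit.map (Polynomial.mapRingHom (algebraMap _ F))) _ _).mpr ?_
  rw [← isRelPrime_iff_isCoprime]
  intro d hd1 hd2
  obtain ⟨d', hd'⟩ := IsIntegrallyClosed.eq_map_mul_C_of_dvd F hmonic hd1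
  have hd0 : d ≠ 0 := ne_zero_of_dvd_ne_zero (hmonic.map _).ne_zero hd1
  have hlc : IsUnit (Polynomial.C d.leadingCoeff) :=
    Polynomial.isUnit_C.mpr (isUnit_iff_ne_zero.mpr (Polynomial.leadingCoeff_ne_zero.mpr hd0))
  have hd'' : d'.map (algebraMap _ F) ∣ d := ⟨_, hd'.symm⟩
  have hinj := IsFractionRing.injective (MvPolynomial (Fin 2) k) F
  have hmonic' : d'.Monic := by
    apply Polynomial.monic_of_injective hinj
    have := congrArg Polynomial.leadingCoeff hd'
    rw [Polynomial.leadingCoeff_mul, Polynomial.leadingCoeff_C] at this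
    exact mul_right_cancel₀ (Polynomial.leadingCoeff_ne_zero.mpr hd0) (by rw [this, one_mul])
  have h1 : d' ∣ p := (Polynomial.map_dvd_map _ hinj hmonic').mp (hd''.trans hd1)
  have h2 : d' ∣ finSuccEquiv k 2 Q := (Polynomial.map_dvd_map _ hinj hmonic').mp (hd''.trans hd2)
  rw [← hd']
  exact ((hpQ h1 h2).map (Polynomial.mapRingHom (algebraMap _ F))).mul hlc

theorem aeval_map_finSuccEquiv {E K : Type*} [CommRing E] [CommRing K] [Algebra E K] (ε : k →+* E)
    (t : K) (τ : E) (Q : MvPolynomial (Fin 3) k) :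
    Polynomial.aeval t ((finSuccEquiv k 2 Q).map (eval₂Hom ε ![1, τ])) =
      eval₂Hom ((algebraMap E K).comp ε) ![t, 1, algebraMap E K τ] Q := by
  induction Q using MvPolynomial.induction_on with
  | C a => simp [finSuccEquiv_apply]
  | add P Q hP hQ => simp only [map_add, Polynomial.map_add, hP, hQ]
  | mul_X P n hP =>
    rw [map_mul, Polynomial.map_mul, map_mul, map_mul, hP]
    congr 1
    refine Fin.cases ?_ (fun j => ?_) n
    · simp [finSuccEquiv_X_zero]
    · rw [finSuccEquiv_X_succ]
      fin_cases j <;> simp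

open IntermediateField in
/-- Let `E` contain `τ`, and let `(t : 1 : τ)` be mapped by `φ` to `(V : y₁ : y₂)`, where `V` is the
variable of `F(V)` and `y₁, y₂ ∈ F`. Then `t` generates `F(V)` over `E` and is a zero of a polynomial
of degree at most `deg φ`. -/
theorem finrank_le_degree {F : Type*} [Field F] (E : IntermediateField F (RatFunc F)) (ε : k →+* F)
    {y₁ y₂ : F} (hy : ∀ a b : k, y₂ * ε a = y₁ * ε b → a = 0 ∧ b = 0) (τ : E) (t : RatFunc F)
    {φ : Fin 3 → MvPolynomial (Fin 3) k} {e : ℕ} (hφ : ∀ i, (φ i).IsHomogeneous e)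
    (hφ0 : eval ![1, 0, 0] (φ 1) ≠ 0 ∨ eval ![1, 0, 0] (φ 2) ≠ 0)
    {ev : MvPolynomial (Fin 3) k →+* RatFunc F}
    (hev : ev = eval₂Hom ((algebraMap F (RatFunc F)).comp ε) ![t, 1, (τ : RatFunc F)])
    (hne : ev (φ 1) ≠ 0)
    (h01 : ev (φ 0) * algebraMap F (RatFunc F) y₁ = ev (φ 1) * RatFunc.X)
    (h12 : ev (φ 1) * algebraMap F (RatFunc F) y₂ = ev (φ 2) * algebraMap F (RatFunc F) y₁) :
    Module.finrank E (RatFunc F) ≤ e := by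
  set ε' : k →+* E := (algebraMap F E).comp ε with hε'
  set q : MvPolynomial (Fin 3) k → Polynomial E := fun Q =>
    (finSuccEquiv k 2 Q).map (eval₂Hom ε' ![1, τ]) with hq
  have hqev : ∀ Q, Polynomial.aeval t (q Q) = ev Q := by
    intro Q
    rw [hev]
    exact aeval_map_finSuccEquiv ε' t τ Q
  set N : Polynomial E := Polynomial.C (algebraMap F E y₂) * q (φ 1) -
    Polynomial.C (algebraMap F E y₁) * q (φ 2) with hN
  have hNt : Polynomial.aeval t N = 0 := by
    rw [hN, map_sub, map_mul, map_mul, hqev, hqev, Polynomial.aeval_C, Polynomial.aeval_C,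
      ← IsScalarTower.algebraMap_apply, ← IsScalarTower.algebraMap_apply]
    linear_combination h12
  have hNdeg : N.natDegree ≤ e := by
    refine (Polynomial.natDegree_sub_le _ _).trans (max_le ?_ ?_) <;>
    exact (Polynomial.natDegree_C_mul_le _ _).trans
      ((Polynomial.natDegree_map_le).trans (natDegree_finSuccEquiv_le (hφ _)))
  have hN0 : N ≠ 0 := by
    intro hz
    have hqc : ∀ i, (q (φ i)).coeff e = algebraMap F E (ε (eval ![1, 0, 0] (φ i))) := by
      intro i
      rw [hq, Polynomial.coeff_map, coeff_finSuccEquiv_of_isHomogeneous (hφ i), coe_eval₂Hom,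
        eval₂_C]
      rfl
    have h1 := congrArg (fun P => Polynomial.coeff P e) hz
    simp only [hN, Polynomial.coeff_sub, Polynomial.coeff_C_mul, hqc, Polynomial.coeff_zero] at h1
    rw [← map_mul, ← map_mul, sub_eq_zero] at h1
    have h2 := hy _ _ ((algebraMap F E).injective h1)
    rcases hφ0 with h | h
    · exact h h2.1
    · exact h h2.2
  have hy1 : y₁ ≠ 0 := by
    rintro rfl
    have := hy 0 1 (by simp)
    exact one_ne_zero this.2
  have htop : E⟮t⟯ = ⊤ := by
    rw [eq_top_iff, ← RatFunc.IntermediateField.adjoin_X E, adjoin_simple_le_iff]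
    have hmem : ∀ Q, ev Q ∈ E⟮t⟯ := by
      intro Q
      rw [← hqev]
      exact algebra_adjoin_le_adjoin E {t} (Polynomial.aeval_mem_adjoin_singleton E t)
    have hX : (RatFunc.X : RatFunc F) =
        ev (φ 0) * algebraMap E (RatFunc F) (algebraMap F E y₁) / ev (φ 1) := by
      rw [eq_div_iff hne, ← IsScalarTower.algebraMap_apply, h01]; ring
    rw [hX]
    exact div_mem (mul_mem (hmem _) (IntermediateField.algebraMap_mem _ _)) (hmem _)
  have hint : IsIntegral E t := isAlgebraic_iff_isIntegral.mp ⟨N, hN0, hNt⟩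
  have hfin := adjoin.finrank hint
  rw [htop, finrank_top'] at hfin
  rw [hfin]
  exact (Polynomial.natDegree_le_of_dvd (minpoly.dvd E t hNt) hN0).trans hNdeg

/-- Polynomials in `x₀, x₁, x₂` as rational functions of `x₀` over a field containing
`k[x₁, x₂]`. -/
noncomputable def toRatFunc (F : Type*) [Field F] [Algebra (MvPolynomial (Fin 2) k) F] :
    MvPolynomial (Fin 3) k →+* RatFunc F :=
  ((algebraMap (Polynomial F) (RatFunc F)).comp
    (Polynomial.mapRingHom (algebraMap (MvPolynomial (Fin 2) k) F))).comp
      (finSuccEquiv k 2 : MvPolynomial (Fin 3) k →+* _)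

section

variable (F : Type*) [Field F] [Algebra (MvPolynomial (Fin 2) k) F]

theorem toRatFunc_apply (Q : MvPolynomial (Fin 3) k) : toRatFunc F Q =
    algebraMap (Polynomial F) (RatFunc F)
      ((finSuccEquiv k 2 Q).map (algebraMap (MvPolynomial (Fin 2) k) F)) := rfl

theorem toRatFunc_X_zero : toRatFunc F (X 0 : MvPolynomial (Fin 3) k) = RatFunc.X := by
  simp [toRatFunc_apply, finSuccEquiv_X_zero]

theorem toRatFunc_X_succ (j : Fin 2) : toRatFunc F (X j.succ : MvPolynomial (Fin 3) k) =
    algebraMap F (RatFunc F) (algebraMap (MvPolynomial (Fin 2) k) F (X j)) := by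
  simp [toRatFunc_apply, finSuccEquiv_X_succ]

theorem toRatFunc_C (a : k) : toRatFunc F (C a : MvPolynomial (Fin 3) k) =
    algebraMap F (RatFunc F) (algebraMap (MvPolynomial (Fin 2) k) F (C a)) := by
  simp [toRatFunc_apply, finSuccEquiv_apply]

theorem toRatFunc_injective [IsFractionRing (MvPolynomial (Fin 2) k) F] :
    Function.Injective (toRatFunc (k := k) F) :=
  (RatFunc.algebraMap_injective F).comp
    ((Polynomial.map_injective _ (IsFractionRing.injective _ F)).comp (finSuccEquiv k 2).injective)

open IntermediateField in
/-- The degree of `Q / P` as a rational function of `x₀` is at least `deg P`. -/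
theorem le_finrank_adjoin [IsFractionRing (MvPolynomial (Fin 2) k) F] {P Q : MvPolynomial (Fin 3) k}
    {e : ℕ} (hP : P.IsHomogeneous e) (hP0 : eval ![1, 0, 0] P ≠ 0) (hPQ : IsRelPrime P Q) :
    e ≤ Module.finrank F⟮toRatFunc F Q / toRatFunc F P⟯ (RatFunc F) := by
  rw [RatFunc.finrank_eq_max_natDegree]
  refine le_trans ?_ (le_max_right _ _)
  set τ := toRatFunc F Q / toRatFunc F P with hτ
  set p := (finSuccEquiv k 2 P).map (algebraMap _ F) with hp
  set q := (finSuccEquiv k 2 Q).map (algebraMap _ F) with hq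
  have hcop : IsCoprime p q := isCoprime_map_finSuccEquiv hP hP0 hPQ F
  have hp0 : toRatFunc F P ≠ 0 := by
    intro h
    rw [toRatFunc_injective F (h.trans (map_zero _).symm)] at hP0
    simp at hP0
  have h1 := RatFunc.num_div_denom τ
  rw [hτ, div_eq_div_iff (by rw [← hτ]; exact RatFunc.algebraMap_ne_zero τ.denom_ne_zero)
    hp0, ← hτ, toRatFunc_apply, toRatFunc_apply, ← map_mul, ← map_mul] at h1
  have h2 : τ.num * p = q * τ.denom := RatFunc.algebraMap_injective F h1
  have h3 : p ∣ τ.denom := hcop.dvd_of_dvd_mul_left ⟨τ.num, by rw [← h2]; ring⟩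
  refine le_trans ?_ (Polynomial.natDegree_le_of_dvd h3 τ.denom_ne_zero)
  apply Polynomial.le_natDegree_of_ne_zero
  rw [hp, Polynomial.coeff_map, coeff_finSuccEquiv_of_isHomogeneous hP]
  have := IsFractionRing.injective (MvPolynomial (Fin 2) k) F
  rw [Ne, map_eq_zero_iff _ this, C_eq_zero]
  exact hP0

end

open IntermediateField in
/-- The degree of the inverse is at most the degree of the map, in coordinates in which the
relevant points and lines are in general position.

Let `K = F(V)` with `F = k(x₁, x₂)` be the function field of the cone over the target, let
`τ = ψ₂ / ψ₁` and `t = ψ₀ / ψ₁`. Then `K` has degree `e'` over `F(τ)`. It is generated over `F(τ)`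
by `t`, which is a zero of a polynomial of degree `e`, as `(t : 1 : τ)` is mapped by `φ` to
`(V : x₁ : x₂)`. -/
theorem degree_le_degree_of_general {φ ψ : Fin 3 → MvPolynomial (Fin 3) k} {e e' : ℕ}
    (hφ : ∀ i, (φ i).IsHomogeneous e) (hψ : ∀ i, (ψ i).IsHomogeneous e')
    (hφψ : CompEqId (m := 2) φ ψ)
    (hφ0 : eval ![1, 0, 0] (φ 1) ≠ 0 ∨ eval ![1, 0, 0] (φ 2) ≠ 0)
    (hψ1 : eval ![1, 0, 0] (ψ 1) ≠ 0) (hrel : IsRelPrime (ψ 1) (ψ 2)) : e' ≤ e := by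
  let F := FractionRing (MvPolynomial (Fin 2) k)
  have hinj : Function.Injective (algebraMap (MvPolynomial (Fin 2) k) F) :=
    IsFractionRing.injective _ F
  refine (le_finrank_adjoin F (hψ 1) hψ1 hrel).trans ?_
  obtain ⟨η, hη⟩ : ∃ η, η = toRatFunc (k := k) F := ⟨_, rfl⟩
  have hηinj : Function.Injective η := hη ▸ toRatFunc_injective F
  rw [← hη]
  have hψ1ne : η (ψ 1) ≠ 0 := by
    intro h
    rw [hηinj (h.trans (map_zero η).symm)] at hψ1
    simp at hψ1
  have hηC : η.comp C = (algebraMap F (RatFunc F)).comp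
      ((algebraMap (MvPolynomial (Fin 2) k) F).comp C) := by
    ext1 a
    rw [hη]
    exact toRatFunc_C F a
  obtain ⟨ev, hev⟩ : ∃ ev : MvPolynomial (Fin 3) k →+* RatFunc F,
    ev = eval₂Hom (η.comp C) ![η (ψ 0) / η (ψ 1), 1, η (ψ 2) / η (ψ 1)] := ⟨_, rfl⟩
  -- the relation `φ(ψ) = h x`, divided by a power of `ψ₁`
  obtain ⟨h, h0, H⟩ := hφψ
  have hscale : ∀ i, η h * η (X i) = η (ψ 1) ^ e * ev (φ i) := by
    intro i
    have h0 : η h * η (X i) = η (bind₁ ψ (φ i)) := by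
      rw [← map_mul]; exact congrArg η (H i).symm
    let _ : Algebra k (RatFunc F) := (η.comp C).toAlgebra
    have h1 := aeval_const_mul_of_isHomogeneous (hφ i) (η (ψ 1))
      (![η (ψ 0) / η (ψ 1), 1, η (ψ 2) / η (ψ 1)] : Fin 3 → RatFunc F)
    have h2 : (fun j => η (ψ 1) * (![η (ψ 0) / η (ψ 1), 1, η (ψ 2) / η (ψ 1)] :
        Fin 3 → RatFunc F) j) = fun j => η (ψ j) := by
      funext j
      fin_cases j
      · simp; field_simp
      · simp
      · simp; field_simp
    have h3 : aeval (![η (ψ 0) / η (ψ 1), 1, η (ψ 2) / η (ψ 1)] : Fin 3 → RatFunc F) (φ i) =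
        ev (φ i) := by rw [hev]; rfl
    rw [h2, h3] at h1
    rw [h0, ← h1]
    change η (eval₂ C ψ (φ i)) = eval₂ (η.comp C) _ (φ i)
    rw [hom_eval₂]
  have hηh : η h ≠ 0 := fun hz => h0 (hηinj (hz.trans (map_zero η).symm))
  have hevne : ∀ i, ev (φ i) ≠ 0 := by
    intro i hz
    have h1 := hscale i
    rw [hz, mul_zero, mul_eq_zero] at h1
    rcases h1 with h1 | h1
    · exact hηh h1
    · exact X_ne_zero (R := k) i (hηinj (h1.trans (map_zero η).symm))
  have hcross : ∀ i j, ev (φ i) * η (X j) = ev (φ j) * η (X i) := by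
    intro i j
    apply mul_left_cancel₀ (mul_ne_zero (pow_ne_zero e hψ1ne) hηh)
    have h1 := hscale i
    have h2 := hscale j
    linear_combination η h * η (X i) * h2 - η h * η (X j) * h1
  have hX0 : η (X 0) = RatFunc.X := by rw [hη]; exact toRatFunc_X_zero F
  have hX1 : η (X 1) = algebraMap F (RatFunc F) (algebraMap (MvPolynomial (Fin 2) k) F (X 0)) := by
    rw [hη]; exact toRatFunc_X_succ F 0
  have hX2 : η (X 2) = algebraMap F (RatFunc F) (algebraMap (MvPolynomial (Fin 2) k) F (X 1)) := by
    rw [hη]; exact toRatFunc_X_succ F 1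
  refine finrank_le_degree _ ((algebraMap (MvPolynomial (Fin 2) k) F).comp C)
    (y₁ := algebraMap (MvPolynomial (Fin 2) k) F (X 0))
    (y₂ := algebraMap (MvPolynomial (Fin 2) k) F (X 1)) ?_
    ⟨η (ψ 2) / η (ψ 1), mem_adjoin_simple_self F _⟩ (η (ψ 0) / η (ψ 1)) hφ hφ0
    (by rw [hev, hηC]) (hevne 1) ?_ ?_
  · intro a b hab
    rw [RingHom.comp_apply, RingHom.comp_apply, ← map_mul, ← map_mul] at hab
    have h3 := hinj hab
    have e1 := congrArg (eval ![0, 1]) h3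
    have e2 := congrArg (eval ![1, 0]) h3
    simp at e1 e2
    exact ⟨e1, e2.symm⟩
  · rw [← hX0, ← hX1]; exact hcross 0 1
  · rw [← hX1, ← hX2]; exact hcross 1 2

end InverseDegree

section InverseDegreeGeneral

variable {k : Type*} [Field k]

theorem eval_linSubst (T : Matrix (Fin 3) (Fin 3) k) (v : Fin 3 → k) (Q : MvPolynomial (Fin 3) k) :
    eval v (linSubst T Q) = eval (T.mulVec v) Q := by
  have h := AlgHom.congr_fun (φ₁ := (aeval v).comp (linSubst T))
    (φ₂ := aeval (T.mulVec v)) (by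
      apply MvPolynomial.algHom_ext
      intro i
      simp [linSubst_X, Matrix.mulVec, dotProduct]) Q
  simpa [coe_aeval_eq_eval] using h

theorem isRelPrime_linSubst {T T' : Matrix (Fin 3) (Fin 3) k} (hT : T' * T = 1)
    {P Q : MvPolynomial (Fin 3) k} (h : IsRelPrime P Q) :
    IsRelPrime (linSubst T P) (linSubst T Q) := by
  have hT' : T * T' = 1 := mul_eq_one_comm.mp hT
  intro d h1 h2
  have h3 := map_dvd (linSubst T') h1
  have h4 := map_dvd (linSubst T') h2
  rw [linSubst_cancel hT'] at h3 h4
  have h5 := (h h3 h4).map (linSubst T)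
  rwa [linSubst_cancel hT] at h5

/-- Dividing an inverse by the greatest common divisor of its components. -/
theorem exists_primitive_inverse {φ ψ : Fin 3 → MvPolynomial (Fin 3) k} {e d : ℕ}
    (hφ : ∀ i, (φ i).IsHomogeneous e) (hψ : ∀ i, (ψ i).IsHomogeneous d)
    (hψφ : CompEqId (m := 2) ψ φ) (hφψ : CompEqId (m := 2) φ ψ) :
    ∃ (Ψ : Fin 3 → MvPolynomial (Fin 3) k) (e' : ℕ), (∀ i, (Ψ i).IsHomogeneous e') ∧
      CompEqId (m := 2) Ψ φ ∧ CompEqId (m := 2) φ Ψ ∧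
      ∀ g, (∀ i, g ∣ Ψ i) → IsUnit g := by
  let _ : StrongNormalizationMonoid (MvPolynomial (Fin 3) k) :=
    UniqueFactorizationMonoid.strongNormalizationMonoid
  let _ : NormalizedGCDMonoid (MvPolynomial (Fin 3) k) :=
    UniqueFactorizationMonoid.toNormalizedGCDMonoid _
  obtain ⟨Ψ, hΨ, hgcd⟩ := Finset.extract_gcd ψ (Finset.univ_nonempty (α := Fin 3))
  set D := Finset.univ.gcd ψ
  obtain ⟨h, h0, H⟩ := hψφ
  obtain ⟨h', h0', H'⟩ := hφψ
  have hψ0 : ∀ i, ψ i ≠ 0 := by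
    intro i hz
    have := H i
    rw [hz, map_zero] at this
    exact mul_ne_zero h0 (X_ne_zero i) this.symm
  have hDΨ : ∀ i, D * Ψ i ≠ 0 := fun i => by rw [← hΨ i (Finset.mem_univ i)]; exact hψ0 i
  have hD0 : D ≠ 0 := left_ne_zero_of_mul (hDΨ 0)
  have hhom : ∀ i, ∃ a, (Ψ i).IsHomogeneous a := fun i =>
    exists_isHomogeneous_of_mul (hΨ i (Finset.mem_univ i) ▸ hψ i) (hDΨ i)
  have hdeg : ∀ i, (Ψ i).IsHomogeneous (d - D.totalDegree) := by
    intro i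
    obtain ⟨a, ha⟩ := hhom i
    have h1 := totalDegree_mul_of_isDomain hD0 (right_ne_zero_of_mul (hDΨ i))
    rw [← hΨ i (Finset.mem_univ i), (hψ i).totalDegree (hψ0 i),
      ha.totalDegree (right_ne_zero_of_mul (hDΨ i))] at h1
    rwa [h1, Nat.add_sub_cancel_left]
  refine ⟨Ψ, d - D.totalDegree, hdeg, ?_, ?_, ?_⟩
  · have h1 : ∀ i, bind₁ φ D * bind₁ φ (Ψ i) = h * X i := by
      intro i
      rw [← map_mul, ← hΨ i (Finset.mem_univ i)]
      exact H i
    have h2 : bind₁ φ D ≠ 0 := by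
      intro hz
      have := h1 0
      rw [hz, zero_mul] at this
      exact mul_ne_zero h0 (X_ne_zero 0) this.symm
    exact exists_eq_mul_X_of_mul h2 h0 h1
  · have h1 : ∀ i, D ^ e * bind₁ Ψ (φ i) = h' * X i := by
      intro i
      have h2 := aeval_const_mul_of_isHomogeneous (hφ i) D Ψ
      have h3 : (fun i => D * Ψ i) = ψ := by
        funext i
        exact (hΨ i (Finset.mem_univ i)).symm
      rw [h3] at h2
      exact h2.symm.trans (H' i)
    exact exists_eq_mul_X_of_mul (pow_ne_zero e hD0) h0' h1
  · intro g hg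
    have : g ∣ Finset.univ.gcd Ψ := Finset.dvd_gcd fun i _ => hg i
    rw [hgcd] at this
    exact isUnit_of_dvd_one this

/-- A rational map without fixed component is defined at all but finitely many points
`(0 : c : 1)`. -/
theorem finite_setOf_forall_eval_eq_zero [Infinite k] {φ : Fin 3 → MvPolynomial (Fin 3) k} {e : ℕ}
    (hφ : ∀ i, (φ i).IsHomogeneous e) (hfix : NoFixedComponent (m := 2) φ) :
    {c : k | ∀ i, eval ![0, c, 1] (φ i) = 0}.Finite := by
  obtain ⟨i, hi⟩ : ∃ i, evalGeneric (φ i) ≠ 0 := by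
    by_contra! h
    have h1 := hfix (X 0) fun i => X_dvd_of_restrict₀_eq_zero
      (restrict₀_eq_zero_of_evalGeneric (hφ i) (h i))
    exact (X_prime (R := k) (i := (0 : Fin 3))).not_isUnit h1
  rw [evalGeneric_eq] at hi
  have h0 : aeval ![0, Polynomial.X, 1] (φ i) ≠ (0 : Polynomial k) := by
    intro h
    rw [h, map_zero] at hi
    exact hi rfl
  refine (Polynomial.finite_setOfPred_isRoot h0).subset fun c hc => ?_
  change Polynomial.eval c _ = 0
  rw [eval_aeval_pencil]
  exact hc i

/-- If `A, B, C` have no common factor, then `A` and `B - c C` are relatively prime for all but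
finitely many constants `c`. -/
theorem finite_setOf_not_isRelPrime {A B D : MvPolynomial (Fin 3) k} (hA : A ≠ 0)
    (h : ∀ g, g ∣ A → g ∣ B → g ∣ D → IsUnit g) :
    {c : k | ¬ IsRelPrime A (B - C c * D)}.Finite := by
  classical
  have hfin : (⋃ P ∈ (UniqueFactorizationMonoid.factors A).toFinset,
      {c : k | P ∣ B - C c * D}).Finite := by
    apply Set.Finite.biUnion (Finset.finite_toSet _)
    intro P hP
    have hP' : P ∈ UniqueFactorizationMonoid.factors A := by simpa using hP
    have hPprime := UniqueFactorizationMonoid.prime_of_factor P hP'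
    have hPA := UniqueFactorizationMonoid.dvd_of_mem_factors hP'
    apply Set.Subsingleton.finite
    intro c hc c' hc'
    by_contra hne
    have h1 : P ∣ C (c' - c) * D := by
      have := dvd_sub hc hc'
      have h2 : B - C c * D - (B - C c' * D) = C (c' - c) * D := by rw [map_sub]; ring
      rwa [h2] at this
    have hu : IsUnit (C (c' - c) : MvPolynomial (Fin 3) k) :=
      (isUnit_iff_ne_zero.mpr (sub_ne_zero.mpr (Ne.symm hne))).map C
    have h3 : P ∣ D := (hu.dvd_mul_left).mp h1
    have h4 : P ∣ B := by
      have := dvd_add hc (h3.mul_left (C c))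
      rwa [sub_add_cancel] at this
    exact hPprime.not_isUnit (h P hPA h4 h3)
  refine hfin.subset fun c hc => ?_
  rw [Set.mem_ofPred_eq, IsRelPrime] at hc
  push Not at hc
  obtain ⟨g, hgA, hgB, hg⟩ := hc
  have hg0 : g ≠ 0 := ne_zero_of_dvd_ne_zero hA hgA
  obtain ⟨P, hP, hPg⟩ := WfDvdMonoid.exists_irreducible_factor hg hg0
  obtain ⟨P', hP', hPP'⟩ := UniqueFactorizationMonoid.exists_mem_factors_of_dvd hA hP
    (hPg.trans hgA)
  rw [Set.mem_iUnion₂]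
  exact ⟨P', by simpa using hP', hPP'.dvd_iff_dvd_left.mp (hPg.trans hgB)⟩

/-- A birational map of degree `e` without fixed component has an inverse of degree at most `e`.

The inverse without fixed component has this property. Linear changes of coordinates make the lines
and points that enter into `degree_le_degree_of_general` general. -/
theorem exists_inverse_degree_le [Infinite k] {φ ψ : Fin 3 → MvPolynomial (Fin 3) k} {e d : ℕ}
    (hφ : ∀ i, (φ i).IsHomogeneous e) (hfix : NoFixedComponent (m := 2) φ)
    (hψ : ∀ i, (ψ i).IsHomogeneous d)
    (hψφ : CompEqId (m := 2) ψ φ) (hφψ : CompEqId (m := 2) φ ψ) :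
    ∃ (Ψ : Fin 3 → MvPolynomial (Fin 3) k) (e' : ℕ), e' ≤ e ∧ (∀ i, (Ψ i).IsHomogeneous e') ∧
      CompEqId (m := 2) Ψ φ ∧ CompEqId (m := 2) φ Ψ := by
  obtain ⟨Ψ, e', hΨ, hΨφ, hφΨ, hprim⟩ := exists_primitive_inverse hφ hψ hψφ hφψ
  refine ⟨Ψ, e', ?_, hΨ, hΨφ, hφΨ⟩
  have hΨ0 : Ψ 0 ≠ 0 := by
    obtain ⟨h, h0, H⟩ := hΨφ
    intro hz
    have := H 0
    rw [hz, map_zero] at this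
    exact mul_ne_zero h0 (X_ne_zero 0) this.symm
  -- a general pencil of lines in the source, with centre `(0 : c : 1)`
  obtain ⟨c, hc⟩ := (((finite_setOf_forall_eval_eq_zero hφ hfix).union
    (finite_setOf_not_isRelPrime (B := Ψ 1) (D := Ψ 2) hΨ0 fun g h0 h1 h2 =>
      hprim g fun i => by fin_cases i <;> assumption))).exists_notMem
  simp only [Set.mem_union, Set.mem_ofPred_eq, not_or, not_not, not_forall] at hc
  obtain ⟨⟨i, hi⟩, hrel⟩ := hc
  set v : Fin 3 → k := fun i => eval ![0, c, 1] (φ i) with hv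
  -- a general pencil of lines in the target, with centre `b`
  obtain ⟨l, hl0, hl⟩ : ∃ l : MvPolynomial (Fin 3) k, l ≠ 0 ∧ ∀ b, eval b l ≠ 0 →
      v 1 * b 0 - b 1 * v 0 ≠ 0 ∨ v 2 * b 0 - b 2 * v 0 ≠ 0 := by
    by_cases h01 : v 1 = 0 ∧ v 0 = 0
    · have h2 : v 2 ≠ 0 := by
        intro h2
        apply hi
        fin_cases i
        · exact h01.2
        · exact h01.1
        · exact h2
      refine ⟨X 0, X_ne_zero 0, fun b hb => Or.inr ?_⟩
      rw [h01.2, mul_zero, sub_zero]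
      exact mul_ne_zero h2 (by simpa using hb)
    · refine ⟨C (v 1) * X 0 - X 1 * C (v 0), fun h => h01 ?_, fun b hb => Or.inl ?_⟩
      · have e1 := congrArg (eval ![1, 0, 0]) h
        have e2 := congrArg (eval ![0, 1, 0]) h
        simpa using And.intro e1 e2
      · simpa using hb
  obtain ⟨b, hb⟩ := exists_eval_ne_zero
    (mul_ne_zero (mul_ne_zero hl0 hΨ0) (X_ne_zero (R := k) (0 : Fin 3)))
  simp only [map_mul, eval_X] at hb
  have hb0 : b 0 ≠ 0 := right_ne_zero_of_mul hb
  have hbΨ := right_ne_zero_of_mul (left_ne_zero_of_mul hb)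
  have hbl := hl b (left_ne_zero_of_mul (left_ne_zero_of_mul hb))
  set T : Matrix (Fin 3) (Fin 3) k := !![0, 1, 0; c, 0, 1; 1, 0, 0] with hT
  set T' : Matrix (Fin 3) (Fin 3) k := !![0, 0, 1; 1, 0, 0; 0, 1, -c] with hT'
  set S' : Matrix (Fin 3) (Fin 3) k := !![b 0, 0, 0; b 1, 1, 0; b 2, 0, 1] with hS'
  set S : Matrix (Fin 3) (Fin 3) k :=
    !![(b 0)⁻¹, 0, 0; -(b 1) * (b 0)⁻¹, 1, 0; -(b 2) * (b 0)⁻¹, 0, 1] with hS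
  have hTT : T * T' = 1 := by
    ext i j
    fin_cases i <;> fin_cases j <;> simp [hT, hT', Matrix.mul_apply, Fin.sum_univ_three]
  have hSS : S * S' = 1 := by
    ext i j
    fin_cases i <;> fin_cases j <;>
      simp [hS, hS', Matrix.mul_apply, Fin.sum_univ_three, hb0]
  have hTe : T.mulVec ![1, 0, 0] = ![0, c, 1] := by
    funext i
    fin_cases i <;> simp [hT, Matrix.mulVec, dotProduct, Fin.sum_univ_three]
  have hSe : S'.mulVec ![1, 0, 0] = b := by
    funext i
    fin_cases i <;> simp [hS', Matrix.mulVec, dotProduct, Fin.sum_univ_three]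
  have hcomp : CompEqId (m := 2) (transformTuple S T φ) (transformTuple T' S' Ψ) :=
    hφΨ.transform hTT hSS
  have hΨ1 : transformTuple T' S' Ψ 1 = linSubst S' (Ψ 0) := by
    simp [transformTuple, hT', Fin.sum_univ_three]
  have hΨ2 : transformTuple T' S' Ψ 2 = linSubst S' (Ψ 1 - C c * Ψ 2) := by
    simp only [transformTuple, hT', Fin.sum_univ_three, map_sub, map_mul]
    simp [linSubst]
    ring
  refine degree_le_degree_of_general (transformTuple_isHomogeneous hφ)
    (transformTuple_isHomogeneous hΨ) hcomp ?_ ?_ ?_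
  · have hev : ∀ i, eval ![1, 0, 0] (transformTuple S T φ i) = ∑ j, S i j * v j := by
      intro i
      simp only [transformTuple, map_sum, map_mul, eval_C, eval_linSubst, hTe, hv]
    rw [hev, hev]
    simp only [hS, Fin.sum_univ_three]
    rcases hbl with h | h
    · left
      intro hz
      apply h
      simp at hz
      field_simp at hz
      linear_combination hz
    · right
      intro hz
      apply h
      simp at hz
      field_simp at hz
      linear_combination hz
  · rw [hΨ1, eval_linSubst, hSe]
    exact hbΨ
  · rw [hΨ1, hΨ2]
    exact isRelPrime_linSubst hSS hrel

end InverseDegreeGeneral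

/-! ### Multiple points and lines of an arrangement in adapted coordinates -/

section CoordinateAdaptation

variable {k : Type*} [Field k]

/-- An invertible matrix with a prescribed nonzero first column. -/
theorem exists_matrix_first_column {z : Fin 3 → k} (hz : z ≠ 0) :
    ∃ T T' : Matrix (Fin 3) (Fin 3) k, T * T' = 1 ∧ T' * T = 1 ∧ ∀ i, T i 0 = z i := by
  obtain ⟨T, hT, h⟩ : ∃ T : Matrix (Fin 3) (Fin 3) k, T.det ≠ 0 ∧ ∀ i, T i 0 = z i := by
    obtain ⟨i, hi⟩ := Function.ne_iff.mp hz
    fin_cases i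
    · refine ⟨!![z 0, 0, 0; z 1, 1, 0; z 2, 0, 1], ?_, ?_⟩
      · rw [Matrix.det_fin_three]
        simpa using hi
      · intro i
        fin_cases i <;> simp
    · refine ⟨!![z 0, 1, 0; z 1, 0, 0; z 2, 0, 1], ?_, ?_⟩
      · rw [Matrix.det_fin_three]
        simpa using hi
      · intro i
        fin_cases i <;> simp
    · refine ⟨!![z 0, 1, 0; z 1, 0, 1; z 2, 0, 0], ?_, ?_⟩
      · rw [Matrix.det_fin_three]
        simpa using hi
      · intro i
        fin_cases i <;> simp
  have hu := isUnit_iff_ne_zero.mpr hT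
  exact ⟨T, T⁻¹, T.mul_nonsing_inv hu, T.nonsing_inv_mul hu, h⟩

/-- An invertible matrix transforming a prescribed nonzero linear form into the first
coordinate. -/
theorem exists_matrix_vecMul_eq {a : Fin 3 → k} (ha : a ≠ 0) :
    ∃ T T' : Matrix (Fin 3) (Fin 3) k, T * T' = 1 ∧ T' * T = 1 ∧
      Matrix.vecMul a T = ![1, 0, 0] := by
  obtain ⟨T, T', h1, h2, h⟩ := exists_matrix_first_column ha
  refine ⟨T'.transpose, T.transpose, ?_, ?_, ?_⟩
  · rw [← Matrix.transpose_mul, h1, Matrix.transpose_one]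
  · rw [← Matrix.transpose_mul, h2, Matrix.transpose_one]
  · have h3 : a = T.mulVec ![1, 0, 0] := by
      funext i
      simp [Matrix.mulVec, dotProduct, Fin.sum_univ_three, h]
    rw [Matrix.vecMul_transpose, h3, Matrix.mulVec_mulVec, h2, Matrix.one_mulVec]

theorem CompEqId.ne_zero {ψ φ : Fin 3 → MvPolynomial (Fin 3) k} (h : CompEqId (m := 2) ψ φ)
    (i : Fin 3) : ψ i ≠ 0 := by
  obtain ⟨D, hD, H⟩ := h
  intro hz
  have := H i
  rw [hz, map_zero] at this
  exact mul_ne_zero hD (X_ne_zero i) this.symm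

theorem eval_linearForm (z a : Fin 3 → k) : eval z (linearForm a) = a ⬝ᵥ z := by
  simp [linearForm, dotProduct]

theorem linearForm_eq_binForm {a : Fin 3 → k} (ha : a 0 = 0) :
    linearForm a = binForm (a 1) (a 2) := by
  simp [linearForm, binForm, Fin.sum_univ_three, ha]

/-- The polar map of `f`, expressed in coordinates transformed by `T`. -/
theorem CompEqId.polarTuple_linSubst {T T' : Matrix (Fin 3) (Fin 3) k} (hT : T * T' = 1)
    (hT' : T' * T = 1) {f : MvPolynomial (Fin 3) k} {ψ : Fin 3 → MvPolynomial (Fin 3) k}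
    (h : CompEqId (m := 2) ψ (polarTuple (m := 2) f)) :
    CompEqId (m := 2) (transformTuple T' T'.transpose ψ)
      (polarTuple (m := 2) (linSubst T f)) := by
  rw [_root_.polarTuple_linSubst]
  refine CompEqId.transform ?_ hT' h
  rw [← Matrix.transpose_mul, hT, Matrix.transpose_one]

theorem CompEqId.polarTuple_linSubst_right {T T' : Matrix (Fin 3) (Fin 3) k} (hT : T * T' = 1)
    (hT' : T' * T = 1) {f : MvPolynomial (Fin 3) k} {ψ : Fin 3 → MvPolynomial (Fin 3) k}
    (h : CompEqId (m := 2) (polarTuple (m := 2) f) ψ) :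
    CompEqId (m := 2) (polarTuple (m := 2) (linSubst T f))
      (transformTuple T' T'.transpose ψ) := by
  rw [_root_.polarTuple_linSubst]
  refine CompEqId.transform hT ?_ h
  rw [← Matrix.transpose_mul, hT', Matrix.transpose_one]

theorem sum_X_mul_transformTuple (T' : Matrix (Fin 3) (Fin 3) k)
    (ψ : Fin 3 → MvPolynomial (Fin 3) k) :
    ∑ i, X i * transformTuple T' T'.transpose ψ i =
      linSubst T'.transpose (∑ i, X i * ψ i) := by
  simp only [transformTuple, map_add, map_mul, linSubst_X, Fin.sum_univ_three,
    Matrix.transpose_apply]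
  ring

end CoordinateAdaptation

section ArrangementLemmas

variable {k ι : Type*} [Field k]

/-- The number of lines `a i`, `i ∈ A`, through the point `z`. -/
noncomputable def multiplicityAt [DecidableEq k] (A : Finset ι) (a : ι → Fin 3 → k)
    (z : Fin 3 → k) : ℕ :=
  (A.filter fun i => a i ⬝ᵥ z = 0).card

theorem linSubst_prod_linearForm (T : Matrix (Fin 3) (Fin 3) k) (A : Finset ι)
    (a : ι → Fin 3 → k) : linSubst T (∏ i ∈ A, linearForm (a i)) =
      ∏ i ∈ A, linearForm (Matrix.vecMul (a i) T) := by
  rw [map_prod]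
  exact Finset.prod_congr rfl fun i _ => linSubst_linearForm T (a i)

theorem vecMul_injective {T T' : Matrix (Fin 3) (Fin 3) k} (hT : T * T' = 1) {v : Fin 3 → k}
    (h : Matrix.vecMul v T = 0) : v = 0 := by
  have := congrArg (fun w => Matrix.vecMul w T') h
  simpa [Matrix.vecMul_vecMul, hT] using this

theorem LinearIndependent.vecMul_pair {T T' : Matrix (Fin 3) (Fin 3) k} (hT : T * T' = 1)
    {v w : Fin 3 → k} (h : LinearIndependent k ![v, w]) :
    LinearIndependent k ![Matrix.vecMul v T, Matrix.vecMul w T] := by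
  rw [LinearIndependent.pair_iff] at h ⊢
  intro s t hst
  apply h
  apply vecMul_injective hT
  rwa [Matrix.add_vecMul, Matrix.smul_vecMul, Matrix.smul_vecMul]

theorem mul_ne_mul_of_linearIndependent {v w : Fin 3 → k} (h : LinearIndependent k ![v, w])
    (hv : v 0 = 0) (hw : w 0 = 0) : v 1 * w 2 ≠ w 1 * v 2 := by
  rw [LinearIndependent.pair_iff] at h
  intro he
  have h1 := h (w 2) (-v 2) (by
    funext i
    fin_cases i
    · simp [hv, hw]
    · simp
      linear_combination he
    · simp
      ring)
  have h2 := h (w 1) (-v 1) (by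
    funext i
    fin_cases i
    · simp [hv, hw]
    · simp
      ring
    · simp
      linear_combination -he)
  have h3 := h 1 0 (by
    funext i
    fin_cases i
    · simp [hv]
    · simpa using h2.2
    · simpa using h1.2)
  exact one_ne_zero h3.1

/-- Coordinates in which a given point is `(1 : 0 : 0)`. -/
theorem exists_coordinates_at_point [DecidableEq k] {A : Finset ι} {a : ι → Fin 3 → k}
    (ha : ∀ i ∈ A, ∀ j ∈ A, i ≠ j → LinearIndependent k ![a i, a j]) {z : Fin 3 → k} (hz : z ≠ 0) :
    ∃ (T T' : Matrix (Fin 3) (Fin 3) k) (b c : ι → k) (U : MvPolynomial (Fin 3) k) (e : ℕ),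
      T * T' = 1 ∧ T' * T = 1 ∧ (∀ i, T i 0 = z i) ∧
      (∀ i ∈ A.filter fun i => a i ⬝ᵥ z = 0, ∀ j ∈ A.filter fun i => a i ⬝ᵥ z = 0, i ≠ j →
        b i * c j ≠ b j * c i) ∧
      eval ![1, 0, 0] U ≠ 0 ∧ U.IsHomogeneous e ∧
      linSubst T (∏ i ∈ A, linearForm (a i)) =
        (∏ i ∈ A.filter fun i => a i ⬝ᵥ z = 0, binForm (b i) (c i)) * U := by
  obtain ⟨T, T', hT, hT', hTz⟩ := exists_matrix_first_column hz
  have h0 : ∀ i, Matrix.vecMul (a i) T 0 = a i ⬝ᵥ z := by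
    intro i
    simp [Matrix.vecMul, dotProduct, hTz]
  refine ⟨T, T', fun i => Matrix.vecMul (a i) T 1, fun i => Matrix.vecMul (a i) T 2,
    ∏ i ∈ A.filter fun i => ¬ a i ⬝ᵥ z = 0, linearForm (Matrix.vecMul (a i) T),
    ∑ i ∈ A.filter fun i => ¬ a i ⬝ᵥ z = 0, 1, hT, hT', hTz, ?_, ?_, ?_, ?_⟩
  · intro i hi j hj hij
    rw [Finset.mem_filter] at hi hj
    exact mul_ne_mul_of_linearIndependent ((ha i hi.1 j hj.1 hij).vecMul_pair hT)
      ((h0 i).trans hi.2) ((h0 j).trans hj.2)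
  · rw [map_prod, Finset.prod_ne_zero_iff]
    intro i hi
    rw [eval_linearForm]
    have : Matrix.vecMul (a i) T ⬝ᵥ ![1, 0, 0] = a i ⬝ᵥ z := by
      rw [← h0]
      simp [dotProduct, Fin.sum_univ_three]
    rw [this]
    exact (Finset.mem_filter.mp hi).2
  · exact IsHomogeneous.prod _ _ _ fun i _ => linearForm_isHomogeneous _
  · rw [linSubst_prod_linearForm, ← Finset.prod_filter_mul_prod_filter_not A
      (fun i => a i ⬝ᵥ z = 0)]
    congr 1
    refine Finset.prod_congr rfl fun i hi => ?_
    exact linearForm_eq_binForm ((h0 i).trans (Finset.mem_filter.mp hi).2)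

theorem mul_eq_mul_iff_of_orthogonal {b c b' c' y y' : k} (hbc : b ≠ 0 ∨ c ≠ 0)
    (hy : y ≠ 0 ∨ y' ≠ 0) (h : b * y + c * y' = 0) :
    b * c' = b' * c ↔ b' * y + c' * y' = 0 := by
  constructor
  · intro he
    rcases hbc with hb | hc
    · apply mul_left_cancel₀ hb
      linear_combination b' * h + y' * he
    · apply mul_left_cancel₀ hc
      linear_combination c' * h - y * he
  · intro he
    rcases hy with hy | hy
    · apply mul_left_cancel₀ hy
      linear_combination c' * h - c * he
    · apply mul_left_cancel₀ hy
      linear_combination b * he - b' * h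

variable [DecidableEq k] [DecidableEq ι] [Infinite k]

/-- The polynomial `∑ Xᵢ ψᵢ` of an inverse `ψ` of the polar map vanishes on the line dual to any
multiple point of the arrangement. -/
theorem linearForm_dvd_of_multiple_point {A : Finset ι} {a : ι → Fin 3 → k}
    (ha : ∀ i ∈ A, ∀ j ∈ A, i ≠ j → LinearIndependent k ![a i, a j]) {z : Fin 3 → k} (hz : z ≠ 0)
    (hm : 2 ≤ multiplicityAt A a z) {ψ : Fin 3 → MvPolynomial (Fin 3) k} {e : ℕ}
    (hψ : ∀ i, (ψ i).IsHomogeneous e)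
    (hψφ : CompEqId (m := 2) ψ (polarTuple (m := 2) (∏ i ∈ A, linearForm (a i)))) :
    linearForm z ∣ ∑ i, X i * ψ i := by
  obtain ⟨T, T', b, c, U, e', hT, hT', hTz, hne, hU, -, hf⟩ := exists_coordinates_at_point ha hz
  have h1 := hψφ.polarTuple_linSubst hT hT'
  rw [hf] at h1
  have h2 := X_dvd_sum_of_multiple_point hm hne hU h1 (transformTuple_isHomogeneous hψ)
  rw [sum_X_mul_transformTuple] at h2
  have h3 := map_dvd (linSubst T.transpose) h2
  rw [linSubst_cancel (by rw [← Matrix.transpose_mul, hT, Matrix.transpose_one]),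
    linSubst_X] at h3
  have h4 : T.transpose 0 = z := by
    funext i
    rw [Matrix.transpose_apply, hTz]
  rwa [h4] at h3

/-- The multiplicity of a point of multiplicity at least three is divisible by the
characteristic. -/
theorem multiplicityAt_eq_zero {A : Finset ι} {a : ι → Fin 3 → k}
    (ha : ∀ i ∈ A, ∀ j ∈ A, i ≠ j → LinearIndependent k ![a i, a j]) {z : Fin 3 → k} (hz : z ≠ 0)
    (hm : 3 ≤ multiplicityAt A a z) {ψ : Fin 3 → MvPolynomial (Fin 3) k} {e : ℕ}
    (hψ : ∀ i, (ψ i).IsHomogeneous e)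
    (hψφ : CompEqId (m := 2) ψ (polarTuple (m := 2) (∏ i ∈ A, linearForm (a i))))
    (hφψ : CompEqId (m := 2) (polarTuple (m := 2) (∏ i ∈ A, linearForm (a i))) ψ) :
    (multiplicityAt A a z : k) = 0 := by
  obtain ⟨T, T', b, c, U, e', hT, hT', hTz, hne, hU, hUe, hf⟩ := exists_coordinates_at_point ha hz
  have h1 := hψφ.polarTuple_linSubst hT hT'
  have h2 := (hφψ.polarTuple_linSubst_right hT hT').ne_zero 0
  rw [hf] at h1 h2
  exact card_eq_zero_of_multiple_point hm hne hU hUe h2 h1 (transformTuple_isHomogeneous hψ)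

/-- If a line contains three multiple points whose multiplicities are different from `1` modulo the
characteristic, then the number of the remaining lines is divisible by the characteristic. -/
theorem card_erase_eq_zero_of_three_points {A : Finset ι} {a : ι → Fin 3 → k}
    (ha : ∀ i ∈ A, ∀ j ∈ A, i ≠ j → LinearIndependent k ![a i, a j]) {o : ι} (ho : o ∈ A)
    {z : Fin 3 → Fin 3 → k} (hz : ∀ t, z t ≠ 0) (hoz : ∀ t, a o ⬝ᵥ z t = 0)
    (hm : ∀ t, ((multiplicityAt A a (z t) : k) ≠ 1))
    {l : Fin 3 → ι} (hlA : ∀ t, l t ∈ A) (hlo : ∀ t, l t ≠ o) (hlz : ∀ t, a (l t) ⬝ᵥ z t = 0)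
    (hlz' : ∀ t t', t ≠ t' → a (l t') ⬝ᵥ z t ≠ 0)
    {ψ : Fin 3 → MvPolynomial (Fin 3) k} {e : ℕ} (hψ : ∀ i, (ψ i).IsHomogeneous e)
    (hψφ : CompEqId (m := 2) ψ (polarTuple (m := 2) (∏ i ∈ A, linearForm (a i)))) :
    ((A.erase o).card : k) = 0 := by
  have hao : a o ≠ 0 := by
    have := ha o ho (l 0) (hlA 0) (hlo 0).symm
    exact this.ne_zero 0
  obtain ⟨T, T', hT, hT', hTo⟩ := exists_matrix_vecMul_eq hao
  set v : ι → Fin 3 → k := fun i => Matrix.vecMul (a i) T with hv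
  set y : Fin 3 → Fin 3 → k := fun t => T'.mulVec (z t) with hy
  have hvy : ∀ i t, v i ⬝ᵥ y t = a i ⬝ᵥ z t := by
    intro i t
    rw [hv, hy, ← Matrix.dotProduct_mulVec, Matrix.mulVec_mulVec, hT, Matrix.one_mulVec]
  have hy0 : ∀ t, y t 0 = 0 := by
    intro t
    have := hvy o t
    rw [hoz, hv] at this
    simpa [hTo, dotProduct, Fin.sum_univ_three] using this
  have hyne : ∀ t, y t 1 ≠ 0 ∨ y t 2 ≠ 0 := by
    intro t
    by_contra! hcon
    apply hz t
    have h1 : y t = 0 := by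
      funext i
      fin_cases i
      · exact hy0 t
      · exact hcon.1
      · exact hcon.2
    have h2 := congrArg T.mulVec h1
    simpa [hy, Matrix.mulVec_mulVec, hT] using h2
  have hvne : ∀ i ∈ A.erase o, v i 1 ≠ 0 ∨ v i 2 ≠ 0 := by
    intro i hi
    rw [Finset.mem_erase] at hi
    by_contra! hcon
    have h1 := (ha i hi.2 o ho hi.1).vecMul_pair hT
    rw [hTo, LinearIndependent.pair_iff] at h1
    have h2 := h1 1 (-(v i 0)) (by
      funext j
      fin_cases j
      · simp [hv]
      · simpa using hcon.1
      · simpa using hcon.2)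
    exact one_ne_zero h2.1
  have hmem : ∀ t, l t ∈ A.erase o := fun t => Finset.mem_erase.mpr ⟨hlo t, hlA t⟩
  have hiff : ∀ t i, v (l t) 1 * v i 2 = v i 1 * v (l t) 2 ↔ a i ⬝ᵥ z t = 0 := by
    intro t i
    have hdot : ∀ i, v i ⬝ᵥ y t = v i 1 * y t 1 + v i 2 * y t 2 := by
      intro i
      rw [dotProduct, Fin.sum_univ_three, hy0, mul_zero, zero_add]
    rw [mul_eq_mul_iff_of_orthogonal (hvne _ (hmem t)) (hyne t)
      (by rw [← hdot, hvy, hlz]), ← hdot, hvy]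
  have hcount : ∀ t, ((((A.erase o).filter fun i =>
      v (l t) 1 * v i 2 = v i 1 * v (l t) 2).card : k)) ≠ 0 := by
    intro t
    have h1 : ((A.erase o).filter fun i => v (l t) 1 * v i 2 = v i 1 * v (l t) 2) =
        (A.filter fun i => a i ⬝ᵥ z t = 0).erase o := by
      ext i
      simp only [Finset.mem_filter, Finset.mem_erase, hiff]
      tauto
    have h2 : o ∈ A.filter fun i => a i ⬝ᵥ z t = 0 := Finset.mem_filter.mpr ⟨ho, hoz t⟩
    have h3 := Finset.card_erase_add_one h2
    intro h4
    apply hm t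
    rw [multiplicityAt, ← h3, ← h1]
    push_cast
    rw [h4, zero_add]
  have htame : ∀ t t', t ≠ t' → AreTameFactors (A.erase o) (fun i => v i 1) (fun i => v i 2)
      (l t) (l t') := fun t t' htt =>
    ⟨hmem t, hmem t', fun h => hlz' t t' htt ((hiff t (l t')).mp h), hcount t, hcount t'⟩
  have h1 := hψφ.polarTuple_linSubst hT hT'
  rw [linSubst_prod_linearForm, ← Finset.mul_prod_erase A _ ho, hTo] at h1
  have h2 : linearForm ![(1 : k), 0, 0] = X 0 := by
    simp [linearForm, Fin.sum_univ_three]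
  rw [h2] at h1
  exact card_eq_zero_of_line hvne (htame 0 1 (by decide)) (htame 1 2 (by decide))
    (htame 0 2 (by decide)) h1 (transformTuple_isHomogeneous hψ)

end ArrangementLemmas

/-! ### Incidences in arrangements of lines -/

section PlaneGeometry

variable {k : Type*} [Field k]

theorem mem_iff_dotProduct_rep (z L : ℙ k (Fin 3 → k)) : z ∈ L ↔ L.rep ⬝ᵥ z.rep = 0 := by
  rw [Configuration.ofField.mem_iff, Projectivization.orthogonal_comm]
  conv_lhs => rw [← L.mk_rep, ← z.mk_rep]
  exact Projectivization.orthogonal_mk _ _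

theorem exists_mem_mem {L M : ℙ k (Fin 3 → k)} (h : L ≠ M) :
    ∃ z : ℙ k (Fin 3 → k), z ∈ L ∧ z ∈ M := by
  classical
  exact ⟨Projectivization.cross L M, Projectivization.cross_orthogonal_left h,
    Projectivization.cross_orthogonal_right h⟩

theorem exists_mem_line (L : ℙ k (Fin 3 → k)) : ∃ z : ℙ k (Fin 3 → k), z ∈ L := by
  obtain ⟨M, hM⟩ : ∃ M, M ≠ L := by
    by_contra! h
    have h1 : (![1, 0, 0] : Fin 3 → k) ≠ 0 := fun h => by simpa using congrFun h 0
    have h2 : (![0, 1, 0] : Fin 3 → k) ≠ 0 := fun h => by simpa using congrFun h 1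
    have h3 := (h (Projectivization.mk k _ h1)).trans (h (Projectivization.mk k _ h2)).symm
    obtain ⟨a, ha⟩ := (Projectivization.mk_eq_mk_iff' k _ _ h1 h2).mp h3
    simpa using congrFun ha 0
  obtain ⟨z, hz, -⟩ := exists_mem_mem hM.symm
  exact ⟨z, hz⟩

theorem point_eq_of_mem {L M z w : ℙ k (Fin 3 → k)} (h : L ≠ M) (hzL : z ∈ L) (hwL : w ∈ L)
    (hzM : z ∈ M) (hwM : w ∈ M) : z = w :=
  (Configuration.ofField.eq_or_eq_of_orthogonal hzL hwL hzM hwM).resolve_right h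

theorem line_eq_of_mem {L M z w : ℙ k (Fin 3 → k)} (h : z ≠ w) (hzL : z ∈ L) (hwL : w ∈ L)
    (hzM : z ∈ M) (hwM : w ∈ M) : L = M :=
  (Configuration.ofField.eq_or_eq_of_orthogonal hzL hwL hzM hwM).resolve_left h

theorem linearIndependent_rep_pair {L M : ℙ k (Fin 3 → k)} (h : L ≠ M) :
    LinearIndependent k ![L.rep, M.rep] := by
  have := Projectivization.independent_iff.mp
    ((Projectivization.independent_pair_iff_ne L M).mpr h)
  have h2 : Projectivization.rep ∘ ![L, M] = ![L.rep, M.rep] := by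
    funext i
    fin_cases i <;> rfl
  rwa [h2] at this

open Classical in
/-- The lines of the arrangement `A` through the point `z`. -/
noncomputable def linesThrough (A : Finset (ℙ k (Fin 3 → k))) (z : ℙ k (Fin 3 → k)) :
    Finset (ℙ k (Fin 3 → k)) :=
  A.filter fun L => z ∈ L

variable {A : Finset (ℙ k (Fin 3 → k))}

theorem mem_linesThrough {z L : ℙ k (Fin 3 → k)} : L ∈ linesThrough A z ↔ L ∈ A ∧ z ∈ L := by
  simp [linesThrough]

theorem two_le_card_linesThrough {z L M : ℙ k (Fin 3 → k)} (hL : L ∈ A) (hM : M ∈ A) (h : L ≠ M)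
    (hzL : z ∈ L) (hzM : z ∈ M) : 2 ≤ (linesThrough A z).card :=
  Finset.one_lt_card.mpr ⟨L, mem_linesThrough.mpr ⟨hL, hzL⟩, M, mem_linesThrough.mpr ⟨hM, hzM⟩, h⟩

/-- The lines of a non-concurrent arrangement include the sides of a triangle; the first side may
be prescribed. -/
theorem exists_triangle (hA : ∀ z, ∃ L ∈ A, z ∉ L) (L : ℙ k (Fin 3 → k)) :
    ∃ M ∈ A, ∃ N ∈ A, ∃ z w : ℙ k (Fin 3 → k), z ∈ L ∧ z ∈ M ∧ z ∉ N ∧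
      w ∈ M ∧ w ∈ N ∧ w ∉ L := by
  obtain ⟨y, hy⟩ := exists_mem_line L
  obtain ⟨M, hM, hyM⟩ := hA y
  have hLM : L ≠ M := by
    rintro rfl
    exact hyM hy
  obtain ⟨z, hzL, hzM⟩ := exists_mem_mem hLM
  obtain ⟨N, hN, hzN⟩ := hA z
  have hMN : M ≠ N := by
    rintro rfl
    exact hzN hzM
  obtain ⟨w, hwM, hwN⟩ := exists_mem_mem hMN
  refine ⟨M, hM, N, hN, z, w, hzL, hzM, hzN, hwM, hwN, fun hwL => ?_⟩
  rw [point_eq_of_mem hLM hwL hzL hwM hzM] at hwN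
  exact hzN hwN

/-- A non-concurrent arrangement with at most two multiple points on each line is a triangle. -/
theorem card_eq_three_of_two_points (hA : ∀ z, ∃ L ∈ A, z ∉ L)
    (hr : ∀ L ∈ A, ∀ z : Fin 3 → ℙ k (Fin 3 → k), (∀ t, z t ∈ L) →
      (∀ t, 2 ≤ (linesThrough A (z t)).card) → ¬ Function.Injective z) : A.card = 3 := by
  classical
  have hr' : ∀ L ∈ A, ∀ x y z : ℙ k (Fin 3 → k), x ∈ L → y ∈ L → z ∈ L →
      2 ≤ (linesThrough A x).card → 2 ≤ (linesThrough A y).card →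
      2 ≤ (linesThrough A z).card → x ≠ y → z = x ∨ z = y := by
    intro L hL x y z hx hy hz h2x h2y h2z hxy
    by_contra! hcon
    refine hr L hL ![x, y, z] ?_ ?_ ?_
    · intro t; fin_cases t <;> assumption
    · intro t; fin_cases t <;> assumption
    · intro s t hst
      fin_cases s <;> fin_cases t <;> simp_all
  obtain ⟨L, hL, -⟩ := hA (Classical.arbitrary _)
  obtain ⟨M, hM, N, hN, z, w, hzL, hzM, hzN, hwM, hwN, hwL⟩ := exists_triangle hA L
  have hLM : L ≠ M := fun h => hwL (h ▸ hwM)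
  have hMN : M ≠ N := fun h => hzN (h ▸ hzM)
  have hLN : L ≠ N := fun h => hwL (h ▸ hwN)
  obtain ⟨y, hyL, hyN⟩ := exists_mem_mem hLN
  have hyM : y ∉ M := fun h => hzN (point_eq_of_mem hLM hyL hzL h hzM ▸ hyN)
  have hzy : z ≠ y := fun h => hzN (h ▸ hyN)
  have hzw : z ≠ w := fun h => hzN (h ▸ hwN)
  have hyw : y ≠ w := fun h => hyM (h ▸ hwM)
  have h2z := two_le_card_linesThrough hL hM hLM hzL hzM
  have h2y := two_le_card_linesThrough hL hN hLN hyL hyN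
  have h2w := two_le_card_linesThrough hM hN hMN hwM hwN
  have hAeq : A = {L, M, N} := by
    apply Finset.Subset.antisymm
    · intro K hK
      simp only [Finset.mem_insert, Finset.mem_singleton]
      by_contra! hcon
      obtain ⟨hKL, hKM, hKN⟩ := hcon
      obtain ⟨x, hxK, hxL⟩ := exists_mem_mem hKL
      obtain ⟨x', hxK', hxM'⟩ := exists_mem_mem hKM
      obtain ⟨x'', hxK'', hxN''⟩ := exists_mem_mem hKN
      have e1 := hr' L hL z y x hzL hyL hxL h2z h2y
        (two_le_card_linesThrough hK hL hKL hxK hxL) hzy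
      have e2 := hr' M hM z w x' hzM hwM hxM' h2z h2w
        (two_le_card_linesThrough hK hM hKM hxK' hxM') hzw
      have e3 := hr' N hN y w x'' hyN hwN hxN'' h2y h2w
        (two_le_card_linesThrough hK hN hKN hxK'' hxN'') hyw
      rcases e1 with rfl | rfl
      · rcases e3 with rfl | rfl
        · exact hKL (line_eq_of_mem hzy hxK hxK'' hzL hyL)
        · exact hKM (line_eq_of_mem hzw hxK hxK'' hzM hwM)
      · rcases e2 with rfl | rfl
        · exact hKL (line_eq_of_mem hzy hxK' hxK hzL hyL)
        · exact hKN (line_eq_of_mem hyw hxK hxK' hyN hwN)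
    · intro K hK
      simp only [Finset.mem_insert, Finset.mem_singleton] at hK
      rcases hK with rfl | rfl | rfl <;> assumption
  rw [hAeq]
  exact Finset.card_eq_three.mpr ⟨L, M, N, hLM, hLN, hMN, rfl⟩

/-- By the theorem of de Bruijn and Erdős, if a non-concurrent arrangement has at most as many
multiple points as lines, then any two multiple points are joined by a line of the arrangement. -/
theorem exists_line_through (hA : ∀ z, ∃ L ∈ A, z ∉ L)
    (hN : ∀ Z : Finset (ℙ k (Fin 3 → k)), (∀ z ∈ Z, 2 ≤ (linesThrough A z).card) →
      Z.card ≤ A.card) {z w : ℙ k (Fin 3 → k)} (hz : 2 ≤ (linesThrough A z).card)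
    (hw : 2 ≤ (linesThrough A w).card) (hzw : z ≠ w) : ∃ L ∈ A, z ∈ L ∧ w ∈ L := by
  classical
  set Z : Finset (ℙ k (Fin 3 → k)) :=
    A.offDiag.image fun q => Projectivization.cross q.1 q.2 with hZ
  have hmem : ∀ x, x ∈ Z ↔ 2 ≤ (linesThrough A x).card := by
    intro x
    constructor
    · intro hx
      obtain ⟨⟨L, M⟩, hq, rfl⟩ := Finset.mem_image.mp hx
      rw [Finset.mem_offDiag] at hq
      exact two_le_card_linesThrough hq.1 hq.2.1 hq.2.2
        (Projectivization.cross_orthogonal_left hq.2.2)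
        (Projectivization.cross_orthogonal_right hq.2.2)
    · intro hx
      obtain ⟨L, hL, M, hM, hLM⟩ := Finset.one_lt_card.mp hx
      rw [mem_linesThrough] at hL hM
      refine Finset.mem_image.mpr ⟨(L, M), Finset.mem_offDiag.mpr ⟨hL.1, hM.1, hLM⟩, ?_⟩
      exact point_eq_of_mem hLM (Projectivization.cross_orthogonal_left hLM) hL.2
        (Projectivization.cross_orthogonal_right hLM) hM.2
  let _ : Membership {x // x ∈ Z} {L // L ∈ A} := ⟨fun L x => x.1 ∈ L.1⟩
  let _ : Configuration.HasPoints {x // x ∈ Z} {L // L ∈ A} :=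
    { exists_point := by
        rintro ⟨L, hL⟩
        obtain ⟨M, hM, N, hN, x, w, hxL, hxM, hxN, hwM, hwN, hwL⟩ := exists_triangle hA L
        have hMN : M ≠ N := fun h => hxN (h ▸ hxM)
        exact ⟨⟨w, (hmem w).mpr (two_le_card_linesThrough hM hN hMN hwM hwN)⟩, hwL⟩
      exists_line := by
        rintro ⟨x, hx⟩
        obtain ⟨L, hL, hxL⟩ := hA x
        exact ⟨⟨L, hL⟩, hxL⟩
      eq_or_eq := by
        rintro ⟨x, hx⟩ ⟨y, hy⟩ ⟨L, hL⟩ ⟨M, hM⟩ h1 h2 h3 h4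
        rcases Configuration.ofField.eq_or_eq_of_orthogonal h1 h2 h3 h4 with h | h
        · exact Or.inl (Subtype.ext h)
        · exact Or.inr (Subtype.ext h)
      mkPoint := fun {L M} h => ⟨Projectivization.cross L.1 M.1,
        Finset.mem_image.mpr ⟨(L.1, M.1), Finset.mem_offDiag.mpr
          ⟨L.2, M.2, fun he => h (Subtype.ext he)⟩, rfl⟩⟩
      mkPoint_ax := fun {L M} h =>
        ⟨Projectivization.cross_orthogonal_left fun he => h (Subtype.ext he),
          Projectivization.cross_orthogonal_right fun he => h (Subtype.ext he)⟩ }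
  have hle := Configuration.HasPoints.card_le {x // x ∈ Z} {L // L ∈ A}
  have hge := hN Z fun x hx => (hmem x).mp hx
  have hcard : Fintype.card {x // x ∈ Z} = Fintype.card {L // L ∈ A} := by
    rw [Fintype.card_coe, Fintype.card_coe] at *
    omega
  let hlines := Configuration.HasPoints.hasLines hcard
  have hne : (⟨z, (hmem z).mpr hz⟩ : {x // x ∈ Z}) ≠ ⟨w, (hmem w).mpr hw⟩ :=
    fun h => hzw (congrArg Subtype.val h)
  have := hlines.mkLine_ax hne
  exact ⟨(hlines.mkLine hne).1, (hlines.mkLine hne).2, this.1, this.2⟩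

/-- If any two multiple points are joined by a line of the arrangement and there is a double point,
then the arrangement is a near-pencil. -/
theorem exists_center_of_double_point (hA : ∀ z, ∃ L ∈ A, z ∉ L)
    (hj : ∀ z w : ℙ k (Fin 3 → k), 2 ≤ (linesThrough A z).card → 2 ≤ (linesThrough A w).card →
      z ≠ w → ∃ L ∈ A, z ∈ L ∧ w ∈ L) {z : ℙ k (Fin 3 → k)} (hz : (linesThrough A z).card = 2) :
    ∃ w : ℙ k (Fin 3 → k), ∃ L ∈ A, w ∉ L ∧ ∀ M ∈ A, M ≠ L → w ∈ M := by
  classical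
  obtain ⟨L₁, L₂, h12, hzA⟩ := Finset.card_eq_two.mp hz
  have hmem : ∀ M, M ∈ A → z ∈ M → M = L₁ ∨ M = L₂ := by
    intro M hM hzM
    have : M ∈ linesThrough A z := mem_linesThrough.mpr ⟨hM, hzM⟩
    rw [hzA] at this
    simpa using this
  have hL1 : L₁ ∈ A ∧ z ∈ L₁ := mem_linesThrough.mp (by rw [hzA]; simp)
  have hL2 : L₂ ∈ A ∧ z ∈ L₂ := mem_linesThrough.mp (by rw [hzA]; simp)
  have hnez : ∀ M N : ℙ k (Fin 3 → k), z ∉ M → z ∈ N → M ≠ N := fun M N hM hN h => hM (h ▸ hN)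
  -- any two further lines meet on `L₁` or on `L₂`
  have hmeet : ∀ M ∈ A, ∀ N ∈ A, M ≠ N → z ∉ M → ∀ w, w ∈ M → w ∈ N → w ∈ L₁ ∨ w ∈ L₂ := by
    intro M hM N hN hMN hzM w hwM hwN
    have hzw : z ≠ w := fun h => hzM (h ▸ hwM)
    obtain ⟨K, hK, hzK, hwK⟩ := hj z w hz.ge (two_le_card_linesThrough hM hN hMN hwM hwN) hzw
    rcases hmem K hK hzK with rfl | rfl
    · exact Or.inl hwK
    · exact Or.inr hwK
  -- it suffices that the lines not through `z` meet one of `L₁`, `L₂` in one and the same point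
  suffices h : ∀ L₁ L₂ : ℙ k (Fin 3 → k), L₁ ≠ L₂ → L₁ ∈ A → L₂ ∈ A → z ∈ L₁ → z ∈ L₂ →
      (∀ M, M ∈ A → z ∈ M → M = L₁ ∨ M = L₂) →
      (∃ w, w ≠ z ∧ w ∈ L₁ ∧ ∀ M ∈ A, z ∉ M → w ∈ M) →
      ∃ w : ℙ k (Fin 3 → k), ∃ L ∈ A, w ∉ L ∧ ∀ M ∈ A, M ≠ L → w ∈ M by
    obtain ⟨M, hM, hzM⟩ := hA z
    obtain ⟨w₁, hw1M, hw1⟩ := exists_mem_mem (hnez M L₁ hzM hL1.2)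
    have hw1z : w₁ ≠ z := fun h => hzM (h ▸ hw1M)
    by_cases hall : ∀ N ∈ A, z ∉ N → w₁ ∈ N
    · exact h L₁ L₂ h12 hL1.1 hL2.1 hL1.2 hL2.2 hmem ⟨w₁, hw1z, hw1, hall⟩
    · push Not at hall
      obtain ⟨N, hN, hzN, hw1N⟩ := hall
      have hMN : M ≠ N := fun h => hw1N (h ▸ hw1M)
      obtain ⟨w, hwM, hwN⟩ := exists_mem_mem hMN
      have hwz : w ≠ z := fun h => hzM (h ▸ hwM)
      have hw1 : w ∉ L₁ := fun hw => hw1N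
        (point_eq_of_mem (hnez M L₁ hzM hL1.2) hwM hw1M hw hw1 ▸ hwN)
      have hw2 := (hmeet M hM N hN hMN hzM w hwM hwN).resolve_left hw1
      refine h L₂ L₁ h12.symm hL2.1 hL1.1 hL2.2 hL1.2 (fun K hK hzK => (hmem K hK hzK).symm)
        ⟨w, hwz, hw2, fun K hK hzK => ?_⟩
      by_contra hwK
      have hKM : K ≠ M := fun h => hwK (h ▸ hwM)
      have hKN : K ≠ N := fun h => hwK (h ▸ hwN)
      obtain ⟨x, hxK, hxM⟩ := exists_mem_mem hKM
      obtain ⟨y, hyK, hyN⟩ := exists_mem_mem hKN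
      have hxL2 : x ∉ L₂ := fun hx =>
        hwK (point_eq_of_mem (hnez M L₂ hzM hL2.2) hxM hwM hx hw2 ▸ hxK)
      have hyL2 : y ∉ L₂ := fun hy =>
        hwK (point_eq_of_mem (hnez N L₂ hzN hL2.2) hyN hwN hy hw2 ▸ hyK)
      have hx1 := (hmeet K hK M hM hKM hzK x hxK hxM).resolve_right hxL2
      have hy1 := (hmeet K hK N hN hKN hzK y hyK hyN).resolve_right hyL2
      have hxy := point_eq_of_mem (hnez K L₁ hzK hL1.2) hxK hyK hx1 hy1
      have hxw := point_eq_of_mem hMN hxM hwM (hxy ▸ hyN) hwN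
      exact hw1 (hxw ▸ hx1)
  intro L₁ L₂ h12 hL1 hL2 hz1 hz2 hmem ⟨w, hwz, hw1, hw⟩
  refine ⟨w, L₂, hL2, fun hw2 => hwz (point_eq_of_mem h12 hw1 hz1 hw2 hz2), fun M hM hM2 => ?_⟩
  by_cases hzM : z ∈ M
  · rwa [(hmem M hM hzM).resolve_right hM2]
  · exact hw M hM hzM

end PlaneGeometry

section Translation

variable {k : Type*} [Field k]

/-- A finite subset of a field which is invariant under a nonzero translation has a number of
elements divisible by the characteristic. -/
theorem card_eq_zero_of_translates {S₁ S₂ S₃ : Finset k} (h1 : 2 ≤ S₁.card)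
    (hadd : ∀ α ∈ S₁, ∀ β ∈ S₂, α + β ∈ S₃) (hsub : ∀ α ∈ S₁, ∀ γ ∈ S₃, γ - α ∈ S₂) :
    (S₂.card : k) = 0 := by
  have hsum : ∀ α ∈ S₁, ∑ γ ∈ S₃, γ = ∑ β ∈ S₂, β + S₂.card * α := by
    intro α hα
    have : ∑ γ ∈ S₃, γ = ∑ β ∈ S₂, (β + α) :=
      Finset.sum_nbij' (fun γ => γ - α) (fun β => β + α) (fun γ hγ => hsub α hα γ hγ)
        (fun β hβ => by simpa [add_comm] using hadd α hα β hβ) (fun γ _ => by ring)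
        (fun β _ => by ring) (fun γ _ => by ring)
    rw [this, Finset.sum_add_distrib, Finset.sum_const, nsmul_eq_mul]
  obtain ⟨α, hα, α', hα', hne⟩ := Finset.one_lt_card.mp h1
  have h2 : (S₂.card : k) * (α - α') = 0 := by
    have := (hsum α hα).symm.trans (hsum α' hα')
    linear_combination this
  exact (mul_eq_zero.mp h2).resolve_right (sub_ne_zero.mpr hne)

/-- The lines through a point `z` of `L`, other than `L`, have equations `μ + α ℓ`. -/
theorem exists_rep_eq_smul {L M z : ℙ k (Fin 3 → k)} {μ : Fin 3 → k}
    (hμ : LinearIndependent k ![μ, L.rep]) (hμz : μ ⬝ᵥ z.rep = 0) (hzL : z ∈ L) (hzM : z ∈ M)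
    (hML : M ≠ L) : ∃ α c : k, c ≠ 0 ∧ M.rep = c • (μ + α • L.rep) := by
  rw [mem_iff_dotProduct_rep] at hzL hzM
  set B : Matrix (Fin 3) (Fin 3) k := Matrix.of ![M.rep, μ, L.rep] with hB
  have hBz : B.mulVec z.rep = 0 := by
    funext i
    fin_cases i
    · exact hzM
    · exact hμz
    · exact hzL
  have hdet : B.det = 0 := Matrix.exists_mulVec_eq_zero_iff.mp ⟨z.rep, z.rep_nonzero, hBz⟩
  obtain ⟨v, hv, hvB⟩ := Matrix.exists_vecMul_eq_zero_iff.mpr hdet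
  have hrel : v 0 • M.rep + v 1 • μ + v 2 • L.rep = 0 := by
    funext j
    have := congrFun hvB j
    simpa [Matrix.vecMul, dotProduct, Fin.sum_univ_three, hB] using this
  rw [LinearIndependent.pair_iff] at hμ
  have hind := linearIndependent_rep_pair hML
  rw [LinearIndependent.pair_iff] at hind
  have hv0 : v 0 ≠ 0 := by
    intro h0
    have := hμ (v 1) (v 2) (by simpa [h0] using hrel)
    apply hv
    funext i
    fin_cases i
    · exact h0
    · exact this.1
    · exact this.2
  have hv1 : v 1 ≠ 0 := by
    intro h1
    exact hv0 (hind (v 0) (v 2) (by simpa [h1] using hrel)).1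
  refine ⟨v 2 / v 1, -(v 1 / v 0), neg_ne_zero.mpr (div_ne_zero hv1 hv0), ?_⟩
  funext j
  have := congrFun hrel j
  simp only [Pi.add_apply, Pi.smul_apply, smul_eq_mul, Pi.zero_apply] at this ⊢
  field_simp
  linear_combination this

variable {A : Finset (ℙ k (Fin 3 → k))}

/-- The affine coordinates `α` of the lines `μ + α ℓ` of the arrangement through a point of the
line `ℓ = 0`. -/
theorem exists_pencil_coordinates {L z : ℙ k (Fin 3 → k)} (hL : L ∈ A) {μ : Fin 3 → k}
    (hμ : LinearIndependent k ![μ, L.rep]) (hμz : μ ⬝ᵥ z.rep = 0) (hzL : z ∈ L) :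
    ∃ S : Finset k, S.card + 1 = (linesThrough A z).card ∧
      (∀ α ∈ S, ∃ M ∈ A, z ∈ M ∧ M ≠ L ∧ ∃ c : k, c ≠ 0 ∧ M.rep = c • (μ + α • L.rep)) ∧
      ∀ M ∈ A, z ∈ M → M ≠ L → ∃ α ∈ S, ∃ c : k, c ≠ 0 ∧ M.rep = c • (μ + α • L.rep) := by
  classical
  have h : ∀ M ∈ (linesThrough A z).erase L, ∃ α c : k, c ≠ 0 ∧ M.rep = c • (μ + α • L.rep) := by
    intro M hM
    rw [Finset.mem_erase, mem_linesThrough] at hM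
    exact exists_rep_eq_smul hμ hμz hzL hM.2.2 hM.1
  choose! α c hc hα using h
  refine ⟨((linesThrough A z).erase L).image α, ?_, ?_, ?_⟩
  · rw [Finset.card_image_of_injOn]
    · exact Finset.card_erase_add_one (mem_linesThrough.mpr ⟨hL, hzL⟩)
    · intro M hM N hN hMN
      by_contra hne
      have hind := linearIndependent_rep_pair hne
      rw [LinearIndependent.pair_iff] at hind
      refine hc M hM (neg_eq_zero.mp (hind (c N) (-c M) ?_).2)
      rw [hα M hM, hα N hN]
      rw [hMN, smul_smul, smul_smul, neg_mul, mul_comm (c N), neg_smul, add_neg_cancel]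
  · intro β hβ
    obtain ⟨M, hM, rfl⟩ := Finset.mem_image.mp hβ
    have hM' := hM
    rw [Finset.mem_erase, mem_linesThrough] at hM'
    exact ⟨M, hM'.2.1, hM'.2.2, hM'.1, c M, hc M hM, hα M hM⟩
  · intro M hMA hzM hML
    have hM : M ∈ (linesThrough A z).erase L :=
      Finset.mem_erase.mpr ⟨hML, mem_linesThrough.mpr ⟨hMA, hzM⟩⟩
    exact ⟨α M, Finset.mem_image_of_mem α hM, c M, hc M hM, hα M hM⟩

/-- A non-concurrent arrangement in which any two multiple points are joined has a multiple point
whose multiplicity is two or not divisible by the characteristic.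

Otherwise some line `L` contains three multiple points `z₁, z₂, z₃`. The lines through `z₁` and `z₂`
have equations `μ + α ℓ` and `ν + β ℓ`. Their intersection is joined to `z₃` by a line of the
arrangement, which can only be `μ + ν + (α + β) ℓ`. -/
theorem false_of_multiplicities (hA : ∀ z, ∃ L ∈ A, z ∉ L)
    (hj : ∀ z w : ℙ k (Fin 3 → k), 2 ≤ (linesThrough A z).card → 2 ≤ (linesThrough A w).card →
      z ≠ w → ∃ L ∈ A, z ∈ L ∧ w ∈ L)
    (hm : ∀ z : ℙ k (Fin 3 → k), 2 ≤ (linesThrough A z).card →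
      3 ≤ (linesThrough A z).card ∧ ((linesThrough A z).card : k) = 0) : False := by
  classical
  obtain ⟨L, hL, -⟩ := hA (Classical.arbitrary _)
  obtain ⟨M, hM, N, hN, x, q, hxL, hxM, hxN, hqM, hqN, hqL⟩ := exists_triangle hA L
  have hMN : M ≠ N := fun h => hxN (h ▸ hxM)
  have hq := (hm q (two_le_card_linesThrough hM hN hMN hqM hqN)).1
  obtain ⟨N₁, N₂, N₃, hN1, hN2, hN3, h12, h13, h23⟩ := Finset.two_lt_card_iff.mp hq
  rw [mem_linesThrough] at hN1 hN2 hN3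
  have hNL : ∀ K : ℙ k (Fin 3 → k), q ∈ K → K ≠ L := fun K hK h => hqL (h ▸ hK)
  obtain ⟨z₁, hz1, hz1L⟩ := exists_mem_mem (hNL N₁ hN1.2)
  obtain ⟨z₂, hz2, hz2L⟩ := exists_mem_mem (hNL N₂ hN2.2)
  obtain ⟨z₃, hz3, hz3L⟩ := exists_mem_mem (hNL N₃ hN3.2)
  have hqz : ∀ z : ℙ k (Fin 3 → k), z ∈ L → q ≠ z := fun z hz h => hqL (h ▸ hz)
  have hz12 : z₁ ≠ z₂ := fun h =>
    h12 (line_eq_of_mem (hqz z₁ hz1L) hN1.2 hz1 hN2.2 (h ▸ hz2))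
  have hz13 : z₁ ≠ z₃ := fun h =>
    h13 (line_eq_of_mem (hqz z₁ hz1L) hN1.2 hz1 hN3.2 (h ▸ hz3))
  have hz23 : z₂ ≠ z₃ := fun h =>
    h23 (line_eq_of_mem (hqz z₂ hz2L) hN2.2 hz2 hN3.2 (h ▸ hz3))
  have hm1 := hm z₁ (two_le_card_linesThrough hN1.1 hL (hNL N₁ hN1.2) hz1 hz1L)
  have hm2 := hm z₂ (two_le_card_linesThrough hN2.1 hL (hNL N₂ hN2.2) hz2 hz2L)
  have hm3 : 2 ≤ (linesThrough A z₃).card :=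
    two_le_card_linesThrough hN3.1 hL (hNL N₃ hN3.2) hz3 hz3L
  have hL1 := (mem_iff_dotProduct_rep z₁ L).mp hz1L
  have hL2 := (mem_iff_dotProduct_rep z₂ L).mp hz2L
  have hL3 := (mem_iff_dotProduct_rep z₃ L).mp hz3L
  -- equations `μ`, `ν` of lines through `z₁`, `z₂` such that `μ + ν` vanishes at `z₃`
  set s := N₂.rep ⬝ᵥ z₃.rep with hs
  set t := N₁.rep ⬝ᵥ z₃.rep with ht
  have hs0 : s ≠ 0 := fun h => hz23 (point_eq_of_mem (hNL N₂ hN2.2) hz2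
    ((mem_iff_dotProduct_rep z₃ N₂).mpr h) hz2L hz3L)
  have ht0 : t ≠ 0 := fun h => hz13 (point_eq_of_mem (hNL N₁ hN1.2) hz1
    ((mem_iff_dotProduct_rep z₃ N₁).mpr h) hz1L hz3L)
  set μ := s • N₁.rep with hμ
  set ν := -t • N₂.rep with hν
  have hμ1 : μ ⬝ᵥ z₁.rep = 0 := by
    rw [hμ, smul_dotProduct, (mem_iff_dotProduct_rep z₁ N₁).mp hz1, smul_zero]
  have hν2 : ν ⬝ᵥ z₂.rep = 0 := by
    rw [hν, smul_dotProduct, (mem_iff_dotProduct_rep z₂ N₂).mp hz2, smul_zero]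
  have hμ3 : μ ⬝ᵥ z₃.rep = s * t := by rw [hμ, smul_dotProduct, ← ht, smul_eq_mul]
  have hν3 : ν ⬝ᵥ z₃.rep = -t * s := by rw [hν, smul_dotProduct, ← hs, smul_eq_mul]
  have hμν3 : (μ + ν) ⬝ᵥ z₃.rep = 0 := by
    rw [add_dotProduct, hμ3, hν3]
    ring
  -- a form with a nonzero value on `L` is independent of `L`
  have hind : ∀ (v : Fin 3 → k) (z : ℙ k (Fin 3 → k)), z ∈ L → v ⬝ᵥ z.rep ≠ 0 →
      LinearIndependent k ![v, L.rep] := by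
    intro v z hz hv
    rw [LinearIndependent.pair_iff]
    intro a b hab
    have h1 := congrArg (fun w => w ⬝ᵥ z.rep) hab
    simp only [add_dotProduct, smul_dotProduct, (mem_iff_dotProduct_rep z L).mp hz, mul_zero,
      add_zero, zero_dotProduct, smul_eq_mul] at h1
    have ha := (mul_eq_zero.mp h1).resolve_right hv
    refine ⟨ha, ?_⟩
    rw [ha, zero_smul, zero_add] at hab
    exact (smul_eq_zero.mp hab).resolve_right L.rep_nonzero
  have hμν1 : (μ + ν) ⬝ᵥ z₁.rep ≠ 0 := by
    rw [add_dotProduct, hμ1, zero_add, hν, smul_dotProduct, smul_eq_mul]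
    refine mul_ne_zero (neg_ne_zero.mpr ht0) fun h => hz12 ?_
    exact point_eq_of_mem (hNL N₂ hN2.2) ((mem_iff_dotProduct_rep z₁ N₂).mpr h) hz2 hz1L hz2L
  have iμ := hind μ z₃ hz3L (by rw [hμ3]; exact mul_ne_zero hs0 ht0)
  have iν := hind ν z₃ hz3L (by rw [hν3]; exact mul_ne_zero (neg_ne_zero.mpr ht0) hs0)
  have iμν := hind (μ + ν) z₁ hz1L hμν1
  obtain ⟨S₁, hS1c, hS1, hS1'⟩ := exists_pencil_coordinates hL iμ hμ1 hz1L
  obtain ⟨S₂, hS2c, hS2, hS2'⟩ := exists_pencil_coordinates hL iν hν2 hz2L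
  obtain ⟨S₃, hS3c, hS3, hS3'⟩ := exists_pencil_coordinates hL iμν hμν3 hz3L
  -- the line joining `z` to the intersection of two lines through `x` and `y`
  have hjoin : ∀ x y z : ℙ k (Fin 3 → k), x ∈ L → y ∈ L → z ∈ L → x ≠ y →
      2 ≤ (linesThrough A z).card →
      ∀ K ∈ A, ∀ K' ∈ A, x ∈ K → y ∈ K' → K ≠ L → K' ≠ L →
      ∃ q : ℙ k (Fin 3 → k), q ∈ K ∧ q ∈ K' ∧ q ∉ L ∧ ∃ K'' ∈ A, z ∈ K'' ∧ q ∈ K'' ∧ K'' ≠ L := by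
    intro x y z hx hy hz hxy h2z K hK K' hK' hxK hyK' hKL hKL'
    have hne : K ≠ K' := fun h => hxy (point_eq_of_mem hKL hxK (h ▸ hyK') hx hy)
    obtain ⟨q, hqK, hqK'⟩ := exists_mem_mem hne
    have hqL : q ∉ L := by
      intro hqL
      apply hxy
      rw [← point_eq_of_mem hKL hqK hxK hqL hx, point_eq_of_mem hKL' hqK' hyK' hqL hy]
    have hqz : q ≠ z := fun h => hqL (h ▸ hz)
    obtain ⟨K'', hK'', hq'', hz''⟩ := hj q z (two_le_card_linesThrough hK hK' hne hqK hqK') h2z hqz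
    exact ⟨q, hqK, hqK', hqL, K'', hK'', hz'', hq'', fun h => hqL (h ▸ hq'')⟩
  have hval : ∀ (K q : ℙ k (Fin 3 → k)) (v : Fin 3 → k) (α c : k), c ≠ 0 →
      K.rep = c • (v + α • L.rep) → q ∈ K →
      v ⬝ᵥ q.rep + α * (L.rep ⬝ᵥ q.rep) = 0 := by
    intro K q v α c hc hK hq
    rw [mem_iff_dotProduct_rep, hK, smul_dotProduct, add_dotProduct, smul_dotProduct,
      smul_eq_mul, smul_eq_mul] at hq
    exact (mul_eq_zero.mp hq).resolve_left hc
  have hzero : (S₂.card : k) = 0 := by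
    refine card_eq_zero_of_translates (S₁ := S₁) (S₃ := S₃) (by omega) ?_ ?_
    · intro α hα β hβ
      obtain ⟨K, hK, hzK, hKL, c, hc, hcK⟩ := hS1 α hα
      obtain ⟨K', hK', hzK', hKL', c', hc', hcK'⟩ := hS2 β hβ
      obtain ⟨q, hqK, hqK', hqL, K'', hK'', hz'', hq'', hKL''⟩ :=
        hjoin z₁ z₂ z₃ hz1L hz2L hz3L hz12 hm3 K hK K' hK' hzK hzK' hKL hKL'
      obtain ⟨γ, hγ, c'', hc'', hcK''⟩ := hS3' K'' hK'' hz'' hKL''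
      have e1 := hval K q μ α c hc hcK hqK
      have e2 := hval K' q ν β c' hc' hcK' hqK'
      have e3 := hval K'' q (μ + ν) γ c'' hc'' hcK'' hq''
      rw [add_dotProduct] at e3
      have : α + β = γ := by
        apply mul_right_cancel₀ fun h => hqL ((mem_iff_dotProduct_rep q L).mpr h)
        linear_combination e1 + e2 - e3
      rwa [this]
    · intro α hα γ hγ
      obtain ⟨K, hK, hzK, hKL, c, hc, hcK⟩ := hS1 α hα
      obtain ⟨K', hK', hzK', hKL', c', hc', hcK'⟩ := hS3 γ hγ
      obtain ⟨q, hqK, hqK', hqL, K'', hK'', hz'', hq'', hKL''⟩ :=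
        hjoin z₁ z₃ z₂ hz1L hz3L hz2L hz13 (by omega) K hK K' hK' hzK hzK' hKL hKL'
      obtain ⟨β, hβ, c'', hc'', hcK''⟩ := hS2' K'' hK'' hz'' hKL''
      have e1 := hval K q μ α c hc hcK hqK
      have e2 := hval K' q (μ + ν) γ c' hc' hcK' hqK'
      have e3 := hval K'' q ν β c'' hc'' hcK'' hq''
      rw [add_dotProduct] at e2
      have : γ - α = β := by
        apply mul_right_cancel₀ fun h => hqL ((mem_iff_dotProduct_rep q L).mpr h)
        linear_combination e2 - e1 - e3
      rwa [this]
  have h1 := hm2.2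
  rw [← hS2c] at h1
  push_cast at h1
  rw [hzero, zero_add] at h1
  exact one_ne_zero h1

end Translation

/-! ### Homaloidal arrangements are triangles or near-pencils -/

section LinearFormFactors

variable {k ι : Type*} [Field k]

theorem linearForm_ne_zero {a : Fin 3 → k} (ha : a ≠ 0) : linearForm a ≠ 0 := by
  obtain ⟨i, hi⟩ := Function.ne_iff.mp ha
  intro h
  apply hi
  have h1 := congrArg (eval (Pi.single i 1)) h
  simpa [eval_linearForm] using h1

theorem irreducible_linearForm {a : Fin 3 → k} (ha : a ≠ 0) : Irreducible (linearForm a) := by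
  have h0 := linearForm_ne_zero ha
  refine irreducible_of_totalDegree_eq_one ((linearForm_isHomogeneous a).totalDegree h0) ?_
  intro x hx
  rw [isUnit_iff_ne_zero]
  rintro rfl
  apply h0
  ext i
  simpa using hx i

/-- Two different lines have a point which lies on the first one only. -/
theorem exists_dotProduct_eq_zero_ne_zero {v w : Fin 3 → k} (h : LinearIndependent k ![v, w]) :
    ∃ y : Fin 3 → k, v ⬝ᵥ y = 0 ∧ w ⬝ᵥ y ≠ 0 := by
  obtain ⟨T, T', hT, -, hv⟩ := exists_matrix_vecMul_eq (h.ne_zero 0)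
  have h1 := h.vecMul_pair hT
  simp only [Matrix.cons_val_zero] at hv
  rw [hv, LinearIndependent.pair_iff] at h1
  set w' := Matrix.vecMul w T with hw'
  have hdot : ∀ u x : Fin 3 → k, u ⬝ᵥ T.mulVec x = Matrix.vecMul u T ⬝ᵥ x :=
    fun u x => Matrix.dotProduct_mulVec u T x
  by_cases h2 : w' 1 = 0
  · refine ⟨T.mulVec ![0, 0, 1], ?_, ?_⟩
    · rw [hdot, hv]
      simp
    · rw [hdot, ← hw']
      intro h3
      have h4 := h1 (-(w' 0)) 1 (by
        funext i
        fin_cases i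
        · simp
        · simpa using h2
        · simpa [dotProduct, Fin.sum_univ_three] using h3)
      exact one_ne_zero h4.2
  · refine ⟨T.mulVec ![0, 1, 0], ?_, ?_⟩
    · rw [hdot, hv]
      simp
    · rw [hdot, ← hw']
      simpa [dotProduct, Fin.sum_univ_three] using h2

theorem isRelPrime_linearForm {v w : Fin 3 → k} (h : LinearIndependent k ![v, w]) :
    IsRelPrime (linearForm v) (linearForm w) := by
  have hv : v ≠ 0 := h.ne_zero 0
  rw [(irreducible_linearForm hv).isRelPrime_iff_not_dvd]
  rintro ⟨q, hq⟩
  obtain ⟨y, hy, hy'⟩ := exists_dotProduct_eq_zero_ne_zero h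
  have := congrArg (eval y) hq
  simp only [map_mul, eval_linearForm, hy, zero_mul] at this
  exact hy' this

theorem prod_linearForm_isHomogeneous (A : Finset ι) (a : ι → Fin 3 → k) :
    (∏ i ∈ A, linearForm (a i)).IsHomogeneous A.card := by
  have := IsHomogeneous.prod A (fun i => linearForm (a i)) (fun _ => 1)
    fun i _ => linearForm_isHomogeneous (a i)
  simpa using this

theorem bind₁_linearForm (φ : Fin 3 → MvPolynomial (Fin 3) k) (a : Fin 3 → k) :
    bind₁ φ (linearForm a) = ∑ i, C (a i) * φ i := by
  simp [linearForm]

/-- The polar map of a concurrent arrangement is not dominant. -/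
theorem exists_dotProduct_ne_zero_of_compEqId {A : Finset ι} {a : ι → Fin 3 → k}
    {ψ : Fin 3 → MvPolynomial (Fin 3) k}
    (hφψ : CompEqId (m := 2) (polarTuple (m := 2) (∏ i ∈ A, linearForm (a i))) ψ)
    {z : Fin 3 → k} (hz : z ≠ 0) : ∃ i ∈ A, a i ⬝ᵥ z ≠ 0 := by
  by_contra! hcon
  set D : Derivation k (MvPolynomial (Fin 3) k) (MvPolynomial (Fin 3) k) :=
    mkDerivation k fun i => C (z i) with hD
  have hDlin : ∀ i ∈ A, D (linearForm (a i)) = 0 := by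
    intro i hi
    rw [← map_zero C, ← hcon i hi]
    simp [linearForm, hD, dotProduct, Derivation.leibniz, Fin.sum_univ_three, mkDerivation_X]
  have hDf : D (∏ i ∈ A, linearForm (a i)) = 0 := by
    refine Finset.prod_induction _ (fun q => D q = 0) ?_ ?_ hDlin
    · intro p q hp hq
      simp [Derivation.leibniz, hp, hq]
    · simp
  have hDsum : ∀ q, D q = ∑ i, C (z i) * pderiv i q := by
    intro q
    have : D = (C (z 0) : MvPolynomial (Fin 3) k) • pderiv (R := k) 0 +
        (C (z 1) : MvPolynomial (Fin 3) k) • pderiv (R := k) 1 +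
        (C (z 2) : MvPolynomial (Fin 3) k) • pderiv (R := k) 2 := by
      apply derivation_ext
      intro j
      fin_cases j <;> simp [hD, mkDerivation_X, pderiv_X]
    rw [this, Fin.sum_univ_three]
    simp
  obtain ⟨h, h0, H⟩ := hφψ
  have h1 := congrArg (bind₁ ψ) (hDf.symm.trans (hDsum _))
  rw [map_zero, map_sum] at h1
  apply mul_ne_zero h0 (linearForm_ne_zero hz)
  rw [h1, linearForm, Finset.mul_sum]
  refine Finset.sum_congr rfl fun i _ => ?_
  rw [map_mul, show pderiv i (∏ i ∈ A, linearForm (a i)) =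
    polarTuple (m := 2) (∏ i ∈ A, linearForm (a i)) i from rfl, H i]
  simp
  ring

variable [DecidableEq k] [DecidableEq ι] [Infinite k]

/-- If the number of lines is not divisible by the characteristic, then the dual lines of the
multiple points divide the nonzero form `∑ Xᵢ ψᵢ`, so there are at most as many multiple points as
lines. -/
theorem card_multiple_points_le {A : Finset ι} {a : ι → Fin 3 → k} (ha0 : ∀ i ∈ A, a i ≠ 0)
    (ha : ∀ i ∈ A, ∀ j ∈ A, i ≠ j → LinearIndependent k ![a i, a j]) (hd : (A.card : k) ≠ 0)
    {Z : Finset (ℙ k (Fin 3 → k))} (hZ : ∀ z ∈ Z, 2 ≤ multiplicityAt A a z.rep)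
    {ψ : Fin 3 → MvPolynomial (Fin 3) k} {e : ℕ} (he : e ≤ A.card - 1)
    (hψ : ∀ i, (ψ i).IsHomogeneous e)
    (hψφ : CompEqId (m := 2) ψ (polarTuple (m := 2) (∏ i ∈ A, linearForm (a i))))
    (hφψ : CompEqId (m := 2) (polarTuple (m := 2) (∏ i ∈ A, linearForm (a i))) ψ) :
    Z.card ≤ A.card := by
  set f := ∏ i ∈ A, linearForm (a i) with hf
  set B := ∑ i, X i * ψ i with hB
  have hdvd : ∏ z ∈ Z, linearForm z.rep ∣ B := by
    refine Finset.prod_dvd_of_isRelPrime ?_ ?_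
    · intro z _ w _ hzw
      exact isRelPrime_linearForm (linearIndependent_rep_pair hzw)
    · intro z hz
      exact linearForm_dvd_of_multiple_point ha z.rep_nonzero (hZ z hz) hψ hψφ
  have hB0 : B ≠ 0 := by
    have hfψ : bind₁ ψ f ≠ 0 := by
      rw [hf, map_prod, Finset.prod_ne_zero_iff]
      intro i hi h0
      obtain ⟨h, hh, H⟩ := hψφ
      have h1 := congrArg (bind₁ (polarTuple (m := 2) f)) h0
      rw [bind₁_linearForm, map_zero, map_sum] at h1
      apply mul_ne_zero hh (linearForm_ne_zero (ha0 i hi))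
      rw [← h1, linearForm, Finset.mul_sum]
      refine Finset.sum_congr rfl fun j _ => ?_
      rw [map_mul, H j]
      simp
      ring
    obtain ⟨h', -, H'⟩ := hφψ
    have h1 := congrArg (bind₁ ψ) (prod_linearForm_isHomogeneous A a).sum_X_mul_pderiv
    rw [map_sum] at h1
    intro hB0
    have h2 : h' * B = C (A.card : k) * bind₁ ψ f := by
      rw [map_natCast, ← nsmul_eq_mul, ← map_nsmul, ← h1, hB, Finset.mul_sum]
      refine Finset.sum_congr rfl fun i _ => ?_
      rw [map_mul, show pderiv i (∏ i ∈ A, linearForm (a i)) = polarTuple (m := 2) f i from rfl,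
        H' i, bind₁_X_right]
      ring
    rw [hB0, mul_zero] at h2
    exact mul_ne_zero (C_ne_zero.mpr hd) hfψ h2.symm
  have hBhom : B.IsHomogeneous (1 + e) := IsHomogeneous.sum _ _ _ fun i _ =>
    (isHomogeneous_X k i).mul (hψ i)
  have h1 := totalDegree_le_of_dvd_of_isDomain hdvd hB0
  rw [hBhom.totalDegree hB0, (prod_linearForm_isHomogeneous Z fun z => z.rep).totalDegree
    (Finset.prod_ne_zero_iff.mpr fun z _ => linearForm_ne_zero z.rep_nonzero)] at h1
  have h2 : A.card ≠ 0 := by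
    intro h
    apply hd
    rw [h, Nat.cast_zero]
  omega

end LinearFormFactors

section Classification

variable {k : Type*} [Field k] {A : Finset (ℙ k (Fin 3 → k))}

theorem card_linesThrough_eq [DecidableEq k] (A : Finset (ℙ k (Fin 3 → k)))
    (z : ℙ k (Fin 3 → k)) :
    (linesThrough A z).card = multiplicityAt A (fun L => L.rep) z.rep := by
  rw [linesThrough, multiplicityAt]
  congr 1
  ext L
  simp [mem_iff_dotProduct_rep]

theorem three_le_card (hA : ∀ z, ∃ L ∈ A, z ∉ L) : 3 ≤ A.card := by
  obtain ⟨L, hL, -⟩ := hA (Classical.arbitrary _)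
  obtain ⟨M, hM, N, hN, z, w, hzL, hzM, hzN, hwM, hwN, hwL⟩ := exists_triangle hA L
  exact Finset.two_lt_card.mpr ⟨L, hL, M, hM, N, hN, fun h => hwL (h ▸ hwM),
    fun h => hwL (h ▸ hwN), fun h => hzN (h ▸ hzM)⟩

theorem isThreeGeneralLines_of_card (hA : ∀ z, ∃ L ∈ A, z ∉ L) (h3 : A.card = 3) :
    IsThreeGeneralLines A := by
  refine ⟨h3, ?_⟩
  rintro ⟨z, hz⟩
  obtain ⟨L, hL, hzL⟩ := hA z
  exact hzL (hz L hL)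

/-- A homaloidal arrangement is a triangle or a near-pencil, with centre of multiplicity divisible by
the characteristic. The two cases of the proof depend on whether the characteristic divides the
number of lines. -/
theorem classification_of_isHomaloidal [Infinite k] (p : ℕ) [CharP k p]
    (h : IsHomaloidal (m := 2) (∏ L ∈ A, linearForm L.rep)) :
    IsThreeGeneralLines A ∨ ∃ n : ℕ, 0 < n ∧ p ∣ n ∧ IsNearPencil n A := by
  classical
  obtain ⟨-, hfix, -, ψ₀, ⟨⟨e₀, hψ₀⟩, -⟩, hψφ₀, hφψ₀⟩ := h
  have hφ : ∀ i, (polarTuple (m := 2) (∏ L ∈ A, linearForm L.rep) i).IsHomogeneous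
      (A.card - 1) := fun i => (prod_linearForm_isHomogeneous A fun L => L.rep).pderiv
  obtain ⟨ψ, e, he, hψ, hψφ, hφψ⟩ := exists_inverse_degree_le hφ hfix hψ₀ hψφ₀ hφψ₀
  have hind : ∀ L ∈ A, ∀ M ∈ A, L ≠ M → LinearIndependent k ![L.rep, M.rep] :=
    fun L _ M _ hLM => linearIndependent_rep_pair hLM
  have hA : ∀ z : ℙ k (Fin 3 → k), ∃ L ∈ A, z ∉ L := by
    intro z
    obtain ⟨L, hL, hLz⟩ := exists_dotProduct_ne_zero_of_compEqId hφψ z.rep_nonzero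
    exact ⟨L, hL, fun hz => hLz ((mem_iff_dotProduct_rep z L).mp hz)⟩
  have hmult : ∀ z : ℙ k (Fin 3 → k), 3 ≤ (linesThrough A z).card →
      ((linesThrough A z).card : k) = 0 := by
    intro z hz
    rw [card_linesThrough_eq] at hz ⊢
    exact multiplicityAt_eq_zero hind z.rep_nonzero hz hψ hψφ hφψ
  by_cases hd : (A.card : k) = 0
  · left
    refine isThreeGeneralLines_of_card hA (card_eq_three_of_two_points hA ?_)
    intro L hL z hzL hz2 hinj
    have hM : ∀ t, ∃ M ∈ A, z t ∈ M ∧ M ≠ L := by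
      intro t
      obtain ⟨M, hM, hML⟩ := Finset.exists_mem_ne (hz2 t) L
      rw [mem_linesThrough] at hM
      exact ⟨M, hM.1, hM.2, hML⟩
    choose M hMA hzM hML using hM
    have h1 := card_erase_eq_zero_of_three_points (z := fun t => (z t).rep) hind hL
      (fun t => (z t).rep_nonzero) (fun t => (mem_iff_dotProduct_rep _ _).mp (hzL t)) ?_ hMA hML
      (fun t => (mem_iff_dotProduct_rep _ _).mp (hzM t)) ?_ hψ hψφ
    · have h2 := Finset.card_erase_add_one hL
      rw [← h2] at hd
      push_cast at hd
      rw [h1, zero_add] at hd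
      exact one_ne_zero hd
    · intro t ht
      rw [← card_linesThrough_eq] at ht
      rcases Nat.eq_or_lt_of_le (hz2 t) with h2 | h3
      · rw [← h2] at ht
        apply one_ne_zero (α := k)
        linear_combination ht
      · rw [hmult _ h3] at ht
        exact zero_ne_one ht
    · intro t t' htt h0
      exact hML t' (line_eq_of_mem (fun h => htt (hinj h)) ((mem_iff_dotProduct_rep _ _).mpr h0)
        (hzM t') (hzL t) (hzL t'))
  · have hj : ∀ z w : ℙ k (Fin 3 → k), 2 ≤ (linesThrough A z).card →
        2 ≤ (linesThrough A w).card → z ≠ w → ∃ L ∈ A, z ∈ L ∧ w ∈ L := by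
      intro z w hz hw hzw
      refine exists_line_through hA (fun Z hZ => ?_) hz hw hzw
      exact card_multiple_points_le (fun L _ => L.rep_nonzero) hind hd
        (fun z hz => card_linesThrough_eq A z ▸ hZ z hz) he hψ hψφ hφψ
    by_cases h2 : ∃ z : ℙ k (Fin 3 → k), (linesThrough A z).card = 2
    · obtain ⟨z, hz⟩ := h2
      obtain ⟨w, L, hL, hwL, hw⟩ := exists_center_of_double_point hA hj hz
      have hcard : (linesThrough A w).card + 1 = A.card := by
        rw [← Finset.card_erase_add_one hL]
        congr 2
        ext M
        rw [mem_linesThrough, Finset.mem_erase]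
        exact ⟨fun h => ⟨fun he => hwL (he ▸ h.2), h.1⟩, fun h => ⟨h.2, hw M h.2 h.1⟩⟩
      have h3 := three_le_card hA
      rcases Nat.eq_or_lt_of_le h3 with h3 | h3
      · exact Or.inl (isThreeGeneralLines_of_card hA h3.symm)
      · refine Or.inr ⟨(linesThrough A w).card, by omega, ?_, hcard.symm, w, L, hL, hwL, hw⟩
        exact (CharP.cast_eq_zero_iff k p _).mp (hmult w (by omega))
    · exfalso
      push Not at h2
      refine false_of_multiplicities hA hj fun z hz => ?_
      have h3 : 3 ≤ (linesThrough A z).card := Nat.lt_of_le_of_ne hz (h2 z).symm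
      exact ⟨h3, hmult z h3⟩

end Classification

/-! ### Triangles and near-pencils are homaloidal -/

section HomaloidalInvariance

variable {k : Type*} [Field k]

theorem isBirationalTuple_of_compEqId {φ ψ : Fin 3 → MvPolynomial (Fin 3) k} {d e : ℕ}
    (hφ : ∀ i, (φ i).IsHomogeneous d) (hψ : ∀ i, (ψ i).IsHomogeneous e)
    (hψφ : CompEqId (m := 2) ψ φ) (hφψ : CompEqId (m := 2) φ ψ) : IsBirationalTuple (m := 2) φ :=
  ⟨⟨⟨d, hφ⟩, 0, hφψ.ne_zero 0⟩, ψ, ⟨⟨e, hψ⟩, 0, hψφ.ne_zero 0⟩, hψφ, hφψ⟩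

theorem IsHomaloidal.linSubst {T T' : Matrix (Fin 3) (Fin 3) k} (hT : T * T' = 1)
    (hT' : T' * T = 1) {f : MvPolynomial (Fin 3) k} (h : IsHomaloidal (m := 2) f) :
    IsHomaloidal (m := 2) (linSubst T f) := by
  obtain ⟨⟨d, hd⟩, hfix, ⟨⟨e, hφ⟩, -⟩, ψ, ⟨⟨e', hψ⟩, -⟩, hψφ, hφψ⟩ := h
  refine ⟨⟨d, linSubst_isHomogeneous hd⟩, ?_, isBirationalTuple_of_compEqId (d := e) (e := e') ?_
    (transformTuple_isHomogeneous hψ) (hψφ.polarTuple_linSubst hT hT')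
    (hφψ.polarTuple_linSubst_right hT hT')⟩
  · intro g hg
    rw [polarTuple_linSubst] at hg
    have h1 : ∀ i, _root_.linSubst T' g ∣ polarTuple (m := 2) f i := by
      intro i
      rw [← transformTuple_cancel (S := T.transpose) (S' := T'.transpose)
        (by rw [← Matrix.transpose_mul, hT, Matrix.transpose_one]) hT (polarTuple (m := 2) f)]
      exact Finset.dvd_sum fun j _ => (map_dvd (_root_.linSubst T') (hg j)).mul_left _
    have h2 := (hfix _ h1).map (_root_.linSubst T)
    rwa [linSubst_cancel hT'] at h2
  · rw [polarTuple_linSubst]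
    exact transformTuple_isHomogeneous hφ

theorem IsHomaloidal.C_mul {c : k} (hc : c ≠ 0) {f : MvPolynomial (Fin 3) k}
    (h : IsHomaloidal (m := 2) f) : IsHomaloidal (m := 2) (C c * f) := by
  obtain ⟨⟨d, hd⟩, hfix, ⟨⟨e, hφ⟩, -⟩, ψ, ⟨⟨e', hψ⟩, -⟩, ⟨D, hD, H⟩, ⟨D', hD', H'⟩⟩ := h
  have hpol : polarTuple (m := 2) (C c * f) = fun i => C c * polarTuple (m := 2) f i := by
    funext i
    simp [polarTuple]
  have hC : C c ≠ (0 : MvPolynomial (Fin 3) k) := C_ne_zero.mpr hc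
  have hCu : IsUnit (C c : MvPolynomial (Fin 3) k) := (isUnit_iff_ne_zero.mpr hc).map C
  have hhom : ∀ {q : MvPolynomial (Fin 3) k} {e : ℕ}, q.IsHomogeneous e →
      (C c * q).IsHomogeneous e := fun hq => by
    simpa using (isHomogeneous_C (Fin 3) c).mul hq
  rw [IsHomaloidal, hpol]
  refine ⟨⟨d, hhom hd⟩, fun g hg => hfix g fun i => (hCu.dvd_mul_left).mp (hg i),
    isBirationalTuple_of_compEqId (fun i => hhom (hφ i)) hψ ⟨C c ^ e' * D, ?_, fun i => ?_⟩
    ⟨C c * D', mul_ne_zero hC hD', fun i => ?_⟩⟩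
  · exact mul_ne_zero (pow_ne_zero _ hC) hD
  · have h1 := aeval_const_mul_of_isHomogeneous (hψ i) (C c) (polarTuple (m := 2) f)
    rw [mul_assoc, ← H i]
    exact h1
  · rw [map_mul, H' i, bind₁_C_right, mul_assoc]

theorem isHomaloidal_C_mul_iff {c : k} (hc : c ≠ 0) {f : MvPolynomial (Fin 3) k} :
    IsHomaloidal (m := 2) (C c * f) ↔ IsHomaloidal (m := 2) f := by
  refine ⟨fun h => ?_, fun h => h.C_mul hc⟩
  have h1 := h.C_mul (inv_ne_zero hc)
  rwa [← mul_assoc, ← map_mul, inv_mul_cancel₀ hc, map_one, one_mul] at h1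

end HomaloidalInvariance

section NearPencils

variable {k ι : Type*} [Field k]

theorem linearForm_first : linearForm ![(1 : k), 0, 0] = X 0 := by
  simp [linearForm, Fin.sum_univ_three]

theorem pderiv_linearForm (a : Fin 3 → k) (j : Fin 3) : pderiv j (linearForm a) = C (a j) := by
  fin_cases j <;> simp [linearForm, Fin.sum_univ_three, pderiv_X, Derivation.leibniz]

/-- The partial derivative with respect to `x₀` is the product `∏ lᵢ` of distinct factors, and a
factor `lᵢ` dividing the other partial derivatives would have to divide the product of the `lⱼ`,
`j ≠ i`. -/
theorem noFixedComponent_nearPencil [DecidableEq ι] {s : Finset ι} {a : ι → Fin 3 → k}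
    (h0 : ∀ i ∈ s, a i 0 = 0) (hne : ∀ i ∈ s, a i ≠ 0)
    (ha : ∀ i ∈ s, ∀ j ∈ s, i ≠ j → LinearIndependent k ![a i, a j]) :
    NoFixedComponent (m := 2) (polarTuple (m := 2) (X 0 * ∏ i ∈ s, linearForm (a i))) := by
  intro g hg
  by_contra hgu
  set G := ∏ i ∈ s, linearForm (a i) with hG
  have hG0 : G ≠ 0 := Finset.prod_ne_zero_iff.mpr fun i hi => linearForm_ne_zero (hne i hi)
  have hpG : pderiv 0 G = 0 := by
    refine Finset.prod_induction _ (fun q => pderiv 0 q = 0) ?_ ?_ ?_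
    · intro p q hp hq
      simp [Derivation.leibniz, hp, hq]
    · simp
    · intro i hi
      rw [pderiv_linearForm, h0 i hi, map_zero]
  have hp0 : polarTuple (m := 2) (X 0 * G) 0 = G := by
    simp [polarTuple, Derivation.leibniz, hpG]
  have hpt : ∀ t : Fin 3, t ≠ 0 → polarTuple (m := 2) (X 0 * G) t = X 0 * pderiv t G := by
    intro t ht
    simp [polarTuple, Derivation.leibniz, pderiv_X_of_ne (Ne.symm ht)]
  have hg0 : g ≠ 0 := by
    rintro rfl
    have h1 := hg 0
    rw [hp0, zero_dvd_iff] at h1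
    exact hG0 h1
  obtain ⟨P, hP, hPg⟩ := WfDvdMonoid.exists_irreducible_factor hgu hg0
  have hPprime := hP.prime
  have hPG : P ∣ G := hPg.trans (hp0 ▸ hg 0)
  obtain ⟨i, hi, hPi⟩ := (hPprime.dvd_finsetProd_iff _).mp hPG
  have hPX : ¬ P ∣ X 0 := by
    intro hPX
    refine hP.not_isUnit (isRelPrime_linearForm (v := ![1, 0, 0]) (w := a i) ?_
      (linearForm_first (k := k) ▸ hPX) hPi)
    rw [LinearIndependent.pair_iff]
    intro s t hst
    have e0 := congrFun hst 0
    simp [h0 i hi] at e0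
    rw [e0, zero_smul, zero_add] at hst
    exact ⟨e0, (smul_eq_zero.mp hst).resolve_right (hne i hi)⟩
  obtain ⟨t, ht0, hat⟩ : ∃ t : Fin 3, t ≠ 0 ∧ a i t ≠ 0 := by
    obtain ⟨t, ht⟩ := Function.ne_iff.mp (hne i hi)
    refine ⟨t, ?_, ht⟩
    rintro rfl
    exact ht (h0 i hi)
  have hPt : P ∣ pderiv t G := by
    have h1 := hPg.trans (hg t)
    rw [hpt t ht0] at h1
    exact (hPprime.dvd_or_dvd h1).resolve_left hPX
  rw [hG, ← Finset.mul_prod_erase s _ hi, Derivation.leibniz, pderiv_linearForm, smul_eq_mul,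
    smul_eq_mul] at hPt
  have h2 := (Prime.dvd_or_dvd hPprime ((dvd_add_right (hPi.mul_right _)).mp hPt)).resolve_right
    fun h => hP.not_isUnit (isUnit_of_dvd_unit h ((isUnit_iff_ne_zero.mpr hat).map C))
  obtain ⟨j, hj, hPj⟩ := (hPprime.dvd_finsetProd_iff _).mp h2
  rw [Finset.mem_erase] at hj
  exact hP.not_isUnit (isRelPrime_linearForm (ha i hi j hj.2 hj.1.symm) hPi hPj)

/-- By Euler's identity, the partial derivatives of a binary form `g` of degree divisible by the
characteristic are `y h` and `-x h`. -/
theorem exists_pderiv_eq_of_degree_eq_zero {g : MvPolynomial (Fin 2) k} {n : ℕ}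
    (hg : g.IsHomogeneous n) (hn : (n : k) = 0) :
    ∃ h, pderiv 0 g = X 1 * h ∧ pderiv 1 g = -(X 0 * h) := by
  have heul := hg.sum_X_mul_pderiv
  rw [Fin.sum_univ_two, nsmul_eq_mul, ← map_natCast C, hn, map_zero, zero_mul] at heul
  have hdvd : X 1 ∣ X 0 * pderiv 0 g :=
    ⟨-pderiv 1 g, by linear_combination heul⟩
  have hX : ¬ (X 1 : MvPolynomial (Fin 2) k) ∣ X 0 := by
    intro h
    rw [X_dvd_X] at h
    simp at h
  obtain ⟨h, hh⟩ := ((X_prime (R := k) (i := (1 : Fin 2))).dvd_or_dvd hdvd).resolve_left hX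
  refine ⟨h, hh, mul_left_cancel₀ (X_ne_zero (R := k) (1 : Fin 2)) ?_⟩
  rw [hh] at heul
  linear_combination heul

theorem pderiv_zero_rename_succ (g : MvPolynomial (Fin 2) k) :
    pderiv 0 (rename (Fin.succ (n := 2)) g) = 0 := by
  classical
  apply pderiv_eq_zero_of_notMem_vars
  intro hmem
  obtain ⟨i, -, hi⟩ := Finset.mem_image.mp (vars_rename _ _ hmem)
  exact Fin.succ_ne_zero i hi

/-- If the degree of the binary form `g` is divisible by the characteristic, then the polar map of
`x₀ g(x₁, x₂)` is birational. With `h` as in `exists_pderiv_eq_of_degree_eq_zero`, and with `g'`,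
`h'` the values of `g`, `h` at `(-x₂, x₁)`, its inverse is `(g' : -x₀ x₂ h' : x₀ x₁ h')`. -/
theorem isBirationalTuple_nearPencil {g : MvPolynomial (Fin 2) k} {n : ℕ}
    (hg : g.IsHomogeneous n) (hn : (n : k) = 0) (hd : ∃ i, pderiv i g ≠ 0) :
    IsBirationalTuple (m := 2) (polarTuple (m := 2) (X 0 * rename Fin.succ g)) := by
  obtain ⟨h, h0, h1⟩ := exists_pderiv_eq_of_degree_eq_zero hg hn
  have hh : h ≠ 0 := by
    rintro rfl
    obtain ⟨i, hi⟩ := hd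
    fin_cases i
    · exact hi (by simpa using h0)
    · exact hi (by simpa using h1)
  have hg0 : g ≠ 0 := by
    rintro rfl
    obtain ⟨i, hi⟩ := hd
    exact hi (map_zero _)
  obtain ⟨a, rfl, ha⟩ : ∃ a, n = a + 2 ∧ h.IsHomogeneous a := by
    have hX1h : X 1 * h ≠ 0 := mul_ne_zero (X_ne_zero (R := k) (1 : Fin 2)) hh
    have e1 : (X 1 * h).IsHomogeneous (n - 1) := h0 ▸ hg.pderiv
    obtain ⟨a, ha⟩ := exists_isHomogeneous_of_mul e1 hX1h
    refine ⟨a, ?_, ha⟩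
    have := e1.inj_right ((isHomogeneous_X k (1 : Fin 2)).mul ha) hX1h
    omega
  set G := rename (Fin.succ (n := 2)) g with hG
  set H := rename (Fin.succ (n := 2)) h with hH
  have hφ0 : polarTuple (m := 2) (X 0 * G) 0 = G := by
    simp [polarTuple, Derivation.leibniz, hG, pderiv_zero_rename_succ]
  have hφs : ∀ t : Fin 2, polarTuple (m := 2) (X 0 * G) t.succ =
      X 0 * rename (Fin.succ (n := 2)) (pderiv t g) := by
    intro t
    rw [← pderiv_rename (Fin.succ_injective 2)]
    simp [polarTuple, Derivation.leibniz, pderiv_X_of_ne (Fin.succ_ne_zero t).symm, hG]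
  have hφ1 : polarTuple (m := 2) (X 0 * G) 1 = X 0 * X 2 * H := by
    have := hφs 0
    rw [h0, map_mul, rename_X] at this
    exact this.trans (mul_assoc _ _ _).symm
  have hφ2 : polarTuple (m := 2) (X 0 * G) 2 = -(X 0 * X 1 * H) := by
    have := hφs 1
    rw [h1, map_neg, map_mul, rename_X, mul_neg, ← mul_assoc] at this
    exact this
  have hφhom : ∀ i, (polarTuple (m := 2) (X 0 * G) i).IsHomogeneous (1 + (a + 2) - 1) := fun i =>
    ((isHomogeneous_X k (0 : Fin 3)).mul hg.rename_isHomogeneous).pderiv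
  set φ := polarTuple (m := 2) (X 0 * G) with hφ
  set y : Fin 2 → MvPolynomial (Fin 3) k := ![-X 2, X 1] with hy
  have hyhom : ∀ i, (y i).IsHomogeneous 1 := by
    intro i
    fin_cases i
    · exact (isHomogeneous_X k (2 : Fin 3)).neg
    · exact isHomogeneous_X k (1 : Fin 3)
  -- substituting `(-X₂, X₁)` is injective
  have hyinj : ∀ q : MvPolynomial (Fin 2) k, aeval y q = 0 → q = 0 := by
    intro q hq
    have e1 := congrArg (aeval (![0, X 1, -X 0] : Fin 3 → MvPolynomial (Fin 2) k)) hq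
    rw [comp_aeval_apply, map_zero] at e1
    have e2 : (fun i => aeval (![0, X 1, -X 0] : Fin 3 → MvPolynomial (Fin 2) k) (y i)) = X := by
      funext i
      fin_cases i <;> simp [hy]
    rwa [e2, aeval_X_left_apply] at e1
  set G' := aeval y g with hG'
  set H' := aeval y h with hH'
  have hG0' : G' ≠ 0 := fun e => hg0 (hyinj g e)
  have hH0' : H' ≠ 0 := fun e => hh (hyinj h e)
  have hG'hom : G'.IsHomogeneous (a + 2) := by
    have := hg.aeval y hyhom
    rwa [one_mul] at this
  have hH'hom : H'.IsHomogeneous a := by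
    have := ha.aeval y hyhom
    rwa [one_mul] at this
  have hG0 : G ≠ 0 := fun e => hg0 (rename_injective _ (Fin.succ_injective 2) (by simpa using e))
  have hH0 : H ≠ 0 := fun e => hh (rename_injective _ (Fin.succ_injective 2) (by simpa using e))
  -- the values of `G'`, `H'` under `φ`
  have hsub1 : ∀ {q : MvPolynomial (Fin 2) k} {e : ℕ}, q.IsHomogeneous e →
      bind₁ φ (aeval y q) = (X 0 * H) ^ e * rename (Fin.succ (n := 2)) q := by
    intro q e hq
    rw [comp_aeval_apply]
    have e1 : (fun i => bind₁ φ (y i)) = fun i => X 0 * H * X (Fin.succ i) := by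
      funext i
      fin_cases i
      · simp only [Fin.zero_eta, hy, Matrix.cons_val_zero, map_neg, bind₁_X_right, hφ2]
        change _ = X 0 * H * X 1
        ring
      · simp only [Fin.mk_one, hy, Matrix.cons_val_one, bind₁_X_right, hφ1,
          Matrix.cons_val_fin_one]
        change _ = X 0 * H * X 2
        ring
    have e2 : rename (Fin.succ (n := 2)) q =
        aeval (fun i : Fin 2 => (X i.succ : MvPolynomial (Fin 3) k)) q := by
      rw [← aeval_X_left_apply (rename (Fin.succ (n := 2)) q), aeval_rename]
      rfl
    rw [e1, aeval_const_mul_of_isHomogeneous hq, e2]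
  set ψ : Fin 3 → MvPolynomial (Fin 3) k := ![G', -(X 2 * X 0 * H'), X 1 * X 0 * H'] with hψ
  have hψ0 : ψ 0 = G' := rfl
  have hψ1 : ψ 1 = -(X 2 * X 0 * H') := rfl
  have hψ2 : ψ 2 = X 1 * X 0 * H' := rfl
  -- the values of `G`, `H` under `ψ`
  have hsub2 : ∀ {q : MvPolynomial (Fin 2) k} {e : ℕ}, q.IsHomogeneous e →
      bind₁ ψ (rename (Fin.succ (n := 2)) q) = (X 0 * H') ^ e * aeval y q := by
    intro q e hq
    have e0 : bind₁ ψ (rename (Fin.succ (n := 2)) q) = aeval (ψ ∘ Fin.succ) q := aeval_rename ..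
    have e1 : ψ ∘ Fin.succ = fun i => X 0 * H' * y i := by
      funext i
      fin_cases i
      · change ψ 1 = X 0 * H' * -X 2
        rw [hψ1]
        ring
      · change ψ 2 = X 0 * H' * X 1
        rw [hψ2]
        ring
    rw [e0, e1, aeval_const_mul_of_isHomogeneous hq]
  refine isBirationalTuple_of_compEqId (ψ := ψ) (e := a + 2) hφhom ?_
    ⟨X 0 ^ (a + 1) * H ^ (a + 2) * G, ?_, ?_⟩ ⟨X 0 ^ (a + 1) * H' ^ (a + 2) * G', ?_, ?_⟩
  · intro i
    have e2 := (((isHomogeneous_X k (2 : Fin 3)).mul (isHomogeneous_X k (0 : Fin 3))).mul hH'hom)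
    have e1 := (((isHomogeneous_X k (1 : Fin 3)).mul (isHomogeneous_X k (0 : Fin 3))).mul hH'hom)
    rw [show 1 + 1 + a = a + 2 by ring] at e1 e2
    fin_cases i
    · exact hG'hom
    · exact e2.neg
    · exact e1
  · exact mul_ne_zero (mul_ne_zero (pow_ne_zero _ (X_ne_zero 0)) (pow_ne_zero _ hH0)) hG0
  · intro i
    have eG := hsub1 hg
    have eH := hsub1 ha
    fin_cases i
    · change bind₁ φ (ψ 0) = _ * X 0
      rw [hψ0, eG]
      ring
    · change bind₁ φ (ψ 1) = _ * X 1
      rw [hψ1, map_neg, map_mul, map_mul, bind₁_X_right, bind₁_X_right, hφ0, hφ2, eH]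
      ring
    · change bind₁ φ (ψ 2) = _ * X 2
      rw [hψ2, map_mul, map_mul, bind₁_X_right, bind₁_X_right, hφ0, hφ1, eH]
      ring
  · exact mul_ne_zero (mul_ne_zero (pow_ne_zero _ (X_ne_zero 0)) (pow_ne_zero _ hH0')) hG0'
  · intro i
    have eG := hsub2 hg
    have eH := hsub2 ha
    fin_cases i
    · change bind₁ ψ (φ 0) = _ * X 0
      rw [hφ0, eG]
      ring
    · change bind₁ ψ (φ 1) = _ * X 1
      rw [hφ1, map_mul, map_mul, bind₁_X_right, bind₁_X_right, hψ0, hψ2, eH]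
      ring
    · change bind₁ ψ (φ 2) = _ * X 2
      rw [hφ2, map_neg, map_mul, map_mul, bind₁_X_right, bind₁_X_right, hψ0, hψ1, eH]
      ring

/-- The standard quadratic transformation. -/
theorem isBirationalTuple_triangle :
    IsBirationalTuple (m := 2)
      (polarTuple (m := 2) (X 0 * (X 1 * X 2) : MvPolynomial (Fin 3) k)) := by
  have hφ : polarTuple (m := 2) (X 0 * (X 1 * X 2) : MvPolynomial (Fin 3) k) =
      ![X 1 * X 2, X 0 * X 2, X 0 * X 1] := by
    funext i
    fin_cases i <;> simp [polarTuple, Derivation.leibniz, pderiv_X]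
  have hhom : ∀ i, ((![X 1 * X 2, X 0 * X 2, X 0 * X 1] : Fin 3 → MvPolynomial (Fin 3) k)
      i).IsHomogeneous (1 + 1) := by
    intro i
    fin_cases i <;> exact (isHomogeneous_X k _).mul (isHomogeneous_X k _)
  have hcomp : CompEqId (m := 2) (![X 1 * X 2, X 0 * X 2, X 0 * X 1] : Fin 3 →
      MvPolynomial (Fin 3) k) ![X 1 * X 2, X 0 * X 2, X 0 * X 1] := by
    refine ⟨X 0 * X 1 * X 2, mul_ne_zero (mul_ne_zero (X_ne_zero 0) (X_ne_zero 1)) (X_ne_zero 2),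
      fun i => ?_⟩
    fin_cases i <;> simp <;> ring
  rw [hφ]
  exact isBirationalTuple_of_compEqId hhom hhom hcomp hcomp

/-- Coordinates in which the near-pencil of lines `M ∈ A` with centre `z` and further line `L` is
`X₀ ∏ l_M(X₁, X₂)`, and two prescribed lines through `z` are `X₁` and `X₂`. -/
theorem exists_coordinates_nearPencil [DecidableEq (ℙ k (Fin 3 → k))]
    {A : Finset (ℙ k (Fin 3 → k))} {z L M N : ℙ k (Fin 3 → k)}
    (hzL : z ∉ L) (hL : L ∈ A) (hA : ∀ K ∈ A, K ≠ L → z ∈ K) (hzM : z ∈ M) (hzN : z ∈ N)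
    (hMN : M ≠ N) :
    ∃ (T T' : Matrix (Fin 3) (Fin 3) k), T * T' = 1 ∧ T' * T = 1 ∧
      (∀ K ∈ A.erase L, Matrix.vecMul K.rep T 0 = 0) ∧
      Matrix.vecMul M.rep T = ![0, 1, 0] ∧ Matrix.vecMul N.rep T = ![0, 0, 1] ∧
      linSubst T (∏ K ∈ A, linearForm K.rep) =
        X 0 * ∏ K ∈ A.erase L, linearForm (Matrix.vecMul K.rep T) := by
  set B : Matrix (Fin 3) (Fin 3) k := Matrix.of ![L.rep, M.rep, N.rep] with hB
  have hdet : B.det ≠ 0 := by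
    intro hdet
    obtain ⟨v, hv, hBv⟩ := Matrix.exists_mulVec_eq_zero_iff.mpr hdet
    have hvL : L.rep ⬝ᵥ v = 0 := congrFun hBv 0
    have hvM : M.rep ⬝ᵥ v = 0 := congrFun hBv 1
    have hvN : N.rep ⬝ᵥ v = 0 := congrFun hBv 2
    have hmem : ∀ K : ℙ k (Fin 3 → k), K.rep ⬝ᵥ v = 0 → Projectivization.mk k v hv ∈ K := by
      intro K hK
      rw [Configuration.ofField.mem_iff, Projectivization.orthogonal_comm, ← K.mk_rep]
      exact (Projectivization.orthogonal_mk K.rep_nonzero hv).mpr hK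
    rw [point_eq_of_mem hMN hzM (hmem M hvM) hzN (hmem N hvN)] at hzL
    exact hzL (hmem L hvL)
  have hu := isUnit_iff_ne_zero.mpr hdet
  have h1 := B.mul_nonsing_inv hu
  have h2 := B.nonsing_inv_mul hu
  have hrow : ∀ i, Matrix.vecMul (B i) B⁻¹ = (1 : Matrix (Fin 3) (Fin 3) k) i := by
    intro i
    rw [← h1]
    rfl
  have hLT : Matrix.vecMul L.rep B⁻¹ = ![1, 0, 0] := by
    refine (hrow 0).trans ?_
    funext j
    fin_cases j <;> simp [Matrix.one_apply]
  refine ⟨B⁻¹, B, h2, h1, ?_, ?_, ?_, ?_⟩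
  · intro K hK
    rw [Finset.mem_erase] at hK
    have e1 := (mem_iff_dotProduct_rep z K).mp (hA K hK.2 hK.1)
    have e2 : B.mulVec z.rep = ![L.rep ⬝ᵥ z.rep, 0, 0] := by
      funext i
      fin_cases i
      · rfl
      · exact (mem_iff_dotProduct_rep z M).mp hzM
      · exact (mem_iff_dotProduct_rep z N).mp hzN
    have e3 : K.rep ⬝ᵥ z.rep = Matrix.vecMul K.rep B⁻¹ ⬝ᵥ B.mulVec z.rep := by
      rw [← Matrix.dotProduct_mulVec, Matrix.mulVec_mulVec, h2, Matrix.one_mulVec]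
    rw [e1, e2] at e3
    have e4 : L.rep ⬝ᵥ z.rep ≠ 0 := fun h => hzL ((mem_iff_dotProduct_rep z L).mpr h)
    simp only [dotProduct, Fin.sum_univ_three, Matrix.cons_val_zero, Matrix.cons_val_one,
      Matrix.cons_val, mul_zero, add_zero] at e3 e4
    exact (mul_eq_zero.mp e3.symm).resolve_right e4
  · refine (hrow 1).trans ?_
    funext j
    fin_cases j <;> simp [Matrix.one_apply]
  · refine (hrow 2).trans ?_
    funext j
    fin_cases j <;> simp [Matrix.one_apply]
  · rw [linSubst_prod_linearForm, ← Finset.mul_prod_erase A _ hL, hLT, linearForm_first]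

/-- A triangle is homaloidal, and so is a near-pencil whose centre has a multiplicity divisible by
the characteristic. -/
theorem isHomaloidal_of_isNearPencil {A : Finset (ℙ k (Fin 3 → k))} {n : ℕ}
    (hn : n = 2 ∨ 0 < n ∧ (n : k) = 0) (hA : IsNearPencil n A) :
    IsHomaloidal (m := 2) (∏ K ∈ A, linearForm K.rep) := by
  classical
  obtain ⟨hcard, z, L, hL, hzL, hzA⟩ := hA
  have hcardE : (A.erase L).card = n := by
    have := Finset.card_erase_add_one hL
    omega
  have hn2 : 1 < n := by
    rcases hn with rfl | ⟨h0, h1⟩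
    · norm_num
    · by_contra hle
      have : n = 1 := by omega
      rw [this, Nat.cast_one] at h1
      exact one_ne_zero h1
  obtain ⟨M, hM, N, hN, hMN⟩ := Finset.one_lt_card.mp (hcardE.symm ▸ hn2)
  have hM' := Finset.mem_erase.mp hM
  have hN' := Finset.mem_erase.mp hN
  obtain ⟨T, T', hT, hT', h0, hMT, hNT, hf⟩ := exists_coordinates_nearPencil hzL hL hzA
    (hzA M hM'.2 hM'.1) (hzA N hN'.2 hN'.1) hMN
  set a : ℙ k (Fin 3 → k) → Fin 3 → k := fun K => Matrix.vecMul K.rep T with ha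
  have hane : ∀ K ∈ A.erase L, a K ≠ 0 := fun K _ h => K.rep_nonzero (vecMul_injective hT h)
  have hfix := noFixedComponent_nearPencil h0 hane fun K _ K' _ hKK =>
    (linearIndependent_rep_pair hKK).vecMul_pair hT
  have hhom : (X 0 * ∏ K ∈ A.erase L, linearForm (a K)).IsHomogeneous
      (1 + (A.erase L).card) :=
    (isHomogeneous_X k (0 : Fin 3)).mul (prod_linearForm_isHomogeneous _ a)
  suffices hbir : IsBirationalTuple (m := 2)
      (polarTuple (m := 2) (X 0 * ∏ K ∈ A.erase L, linearForm (a K))) by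
    have h1 : IsHomaloidal (m := 2) (X 0 * ∏ K ∈ A.erase L, linearForm (a K)) :=
      ⟨⟨_, hhom⟩, hfix, hbir⟩
    rw [← hf] at h1
    have h2 := h1.linSubst hT' hT
    rwa [linSubst_cancel hT] at h2
  rcases hn with rfl | ⟨-, hn⟩
  · have hE : A.erase L = {M, N} := by
      symm
      apply Finset.eq_of_subset_of_card_le
      · intro K hK
        rw [Finset.mem_insert, Finset.mem_singleton] at hK
        rcases hK with rfl | rfl <;> assumption
      · rw [hcardE, Finset.card_pair hMN]
    have e1 : linearForm (a M) = X 1 := by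
      rw [ha]
      simp [hMT, linearForm, Fin.sum_univ_three]
    have e2 : linearForm (a N) = X 2 := by
      rw [ha]
      simp [hNT, linearForm, Fin.sum_univ_three]
    rw [hE, Finset.prod_pair hMN, e1, e2]
    exact isBirationalTuple_triangle
  · set g : MvPolynomial (Fin 2) k :=
      ∏ K ∈ A.erase L, (C (a K 1) * X 0 + C (a K 2) * X 1) with hg
    have hgG : rename Fin.succ g = ∏ K ∈ A.erase L, linearForm (a K) := by
      rw [hg, map_prod]
      refine Finset.prod_congr rfl fun K hK => ?_
      rw [linearForm_eq_binForm (h0 K hK)]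
      simp [binForm, ha]
    have hghom : g.IsHomogeneous n := by
      rw [← IsHomogeneous.rename_isHomogeneous_iff (Fin.succ_injective 2), hgG, ← hcardE]
      exact prod_linearForm_isHomogeneous _ a
    rw [← hgG] at hfix ⊢
    refine isBirationalTuple_nearPencil hghom hn ?_
    -- otherwise `g` itself would be a fixed component
    by_contra! hd
    have hu : IsUnit (rename (Fin.succ (n := 2)) g) := by
      refine hfix _ fun t => ?_
      rcases Fin.eq_zero_or_eq_succ t with rfl | ⟨j, rfl⟩
      · simp [polarTuple, Derivation.leibniz, pderiv_zero_rename_succ]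
      · simp [polarTuple, Derivation.leibniz, pderiv_rename (Fin.succ_injective 2), hd]
    rw [hgG] at hu
    exact (irreducible_linearForm (hane M hM)).not_isUnit
      (isUnit_of_dvd_unit (Finset.dvd_prod_of_mem (fun K => linearForm (a K)) hM) hu)

theorem IsThreeGeneralLines.isNearPencil {A : Finset (ℙ k (Fin 3 → k))}
    (h : IsThreeGeneralLines A) : IsNearPencil 2 A := by
  obtain ⟨h3, hA⟩ := h
  classical
  obtain ⟨L, M, N, hLM, hLN, hMN, rfl⟩ := Finset.card_eq_three.mp h3
  obtain ⟨z, hzM, hzN⟩ := exists_mem_mem hMN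
  refine ⟨h3, z, L, by simp, fun hzL => hA ⟨z, ?_⟩, ?_⟩
  · intro K hK
    simp only [Finset.mem_insert, Finset.mem_singleton] at hK
    rcases hK with rfl | rfl | rfl <;> assumption
  · intro K hK hKL
    simp only [Finset.mem_insert, Finset.mem_singleton] at hK
    rcases hK with rfl | rfl | rfl
    · exact absurd rfl hKL
    · exact hzM
    · exact hzN

end NearPencils

theorem proposition3p1 {k : Type*} [Field k] [IsAlgClosed k] (p : ℕ) [Fact p.Prime] [CharP k p]
    (A : Finset (ℙ k (Fin 3 → k))) (f : MvPolynomial (Fin 3) k) (hf : IsEquationOf f A) :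
    IsHomaloidal f ↔
      (IsThreeGeneralLines A ∨ ∃ n : ℕ, 0 < n ∧ p ∣ n ∧ IsNearPencil n A) := by
  obtain ⟨c, hc, rfl⟩ := hf
  rw [isHomaloidal_C_mul_iff hc]
  constructor
  · exact classification_of_isHomaloidal p
  · rintro (h | ⟨n, hn, hpn, h⟩)
    · exact isHomaloidal_of_isNearPencil (Or.inl rfl) h.isNearPencil
    · exact isHomaloidal_of_isNearPencil (Or.inr ⟨hn, (CharP.cast_eq_zero_iff k p n).mpr hpn⟩) h
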